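/- **Setting.** Let $n\ge 1$, $\rho_*,T>0$, let $\mathcal S$ be a smooth $(n-1)$-dimensional manifold, $\mathcal I=(0,\pi T)\times\mathcal S$ and $\mathcal M=(0,\rho_*)\times\mathcal I$, with coordinates $\rho,t$ on the first two factors. For a chart $\varphi=(x^A)$ of $\mathcal S$, the coordinates on $\mathcal M$ are $(\rho,t,x^A)$. A smooth function $u$ is $\mathcal O(\zeta)$ if every coordinate derivative of $u$ containing exactly $k$ derivatives in $\rho$ is bounded by a constant times $\rho^{-k}\zeta$; a function $u$, smooth on an open set, is $\mathcal O_0(\zeta)$ there if every coordinate derivative of order $m$ is bounded by a constant times $\rho^{-m}\zeta$. Let $(\mathcal M,g)$ be an admissible Fefferman–Graham-aAdS segment: $g$ is Lorentzian and $$g=\rho^{-2}\big[d\rho^2+\mathring{\mathfrak g}+\rho^2\bar{\mathfrak g}+\rho^3\mathfrak r\big],\qquad \mathring{\mathfrak g}=-dt^2+\gamma ,$$ where $\mathring{\mathfrak g},\bar{\mathfrak g}$ are symmetric 2-tensors on $\mathcal I$ (independent of $\rho$), $\mathring{\mathfrak g}$ is Lorentzian, $\gamma$ has no $t$-components (but may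 depend on $t$), $\mathfrak r$ is a symmetric 2-tensor on $\mathcal M$ tangent to the level sets of $\rho$, and there is a finite family $\Xi$ of charts covering $\mathcal S$ in which the components of $\mathring{\mathfrak g},\mathring{\mathfrak g}^{-1},\bar{\mathfrak g},\mathfrak r$ are all $\mathcal O(1)$. All $\mathcal O$ and $\mathcal O_0$ refer to the charts in $\Xi$. For $\xi\ge0$ let $\mu$ be the unique constant with $T=\frac2\mu-\frac{2}{\mu\pi}\arctan\frac{4\mu}{\xi}$ and $\frac1T\le\mu<\frac2T$ (where $\arctan\frac{4\mu}{0}=\frac\pi2$), let $\eta(t)=e^{\xi t/4}\sin(\mu t)$ for $0\le t<\frac{\pi T}2$, $\eta(t)=e^{\xi(\pi T-t)/4}\sin(\mu(\pi T-t))$ for $\frac{\pi T}2\le t\le\pi T$, and let $f=\rho/\eta(t)$. The *pseudoconvexity property* holds at the conformal boundary with parameters $K>0$, $\xi\ge0$, $\zeta\in C^\infty(\mathcal M)$ if $\zeta=\mathcal O(1)$; $|\mathcal L_{\partial_t}\mathring{\mathfrak g}(Y,Y)|\le\xi\,\mathring{\mathfrak g}(Y,Y)$ for all $Y$ tangent to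 $\mathcal S$; and $-\bar{\mathfrak g}(X,X)-(\mu^2+\frac{\xi^2}{16})(X^t)^2-\zeta\,\mathring{\mathfrak g}(X,X)\ge K[(X^t)^2+\gamma_{AB}X^AX^B]$ for all $X=X^t\partial_t+X^A\partial_A$ tangent to $\mathcal I$ (at every value of $\rho$, if $\zeta$ depends on $\rho$). Let $S=f^{n-3}\nabla f$, $w=f-\frac12 f\rho^2\xi\frac{|\eta'|}{\eta}+f\rho^2\zeta$ and $\pi=-(\nabla S+f^{n-3}w\,g)$. Let $(E_X)_{X=1}^{n-1}$ be any $g$-orthonormal frame of the level sets of $(\rho,t)$, $N=|g(\nabla f,\nabla f)|^{-1/2}\nabla f$, and $V=|g(\tilde V,\tilde V)|^{-1/2}\tilde V$ with $\tilde V=\partial_t+\eta'f\,\partial_\rho-\sum_X g(\partial_t+\eta'f\,\partial_\rho,E_X)E_X$. **Theorem.** Suppose the pseudoconvexity property holds with parameters $K,\xi,\zeta$. Then there is $f_0>0$ such that: 1. On $\mathcal M\cap\{f<f_0\}$ the level sets of $(\rho,t)$ are spacelike, and the level sets of $f$ are pseudoconvex: $g(\nabla f,\nabla f)>0$, and $\nabla^2f(X,X)<0$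 for every $X\ne0$ with $g(X,X)=0$ and $Xf=0$. 2. On $\{f<f_0,\ t\ne\frac{\pi T}{2}\}$ there are functions $u=\mathcal O_0(f^{n-1}\rho^2)$ and $v=\mathcal O_0(f^n)$ such that, at every point of this set, for every such frame and every 1-form $\theta$, $$\pi^{\alpha\beta}\theta_\alpha\theta_\beta\ \ge\ \big[Kf^{n-2}\rho^2+u\big]\Big(|\theta(V)|^2+\sum_{X=1}^{n-1}|\theta(E_X)|^2\Big)-\big[(n-1)f^{n-2}+v\big]\,|\theta(N)|^2 .$$ -/

import Mathlib

open Set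
open scoped Manifold ContDiff

noncomputable section

namespace AADS

/-! Throughout, the cross-section `S` is a smooth manifold of dimension `d = n - 1`, the boundary is
`(0, π T) × S` and the spacetime is `M = (0, ρs) × (0, π T) × S`, of dimension `n + 1 = d + 2`. -/

/-- The Euclidean space on which the cross-section is modelled. -/
abbrev Model (d : ℕ) := EuclideanSpace ℝ (Fin d)

/-- Spacetime indices: `none` is `ρ`, `some none` is `t`, and `some (some A)` is `x^A`. -/
abbrev SIdx (d : ℕ) := Option (Option (Fin d))

/-- Coordinate tuples `(ρ, t, x^1, …, x^d)`, and also tuples of components of (co)vectors. -/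
abbrev Coord (d : ℕ) := SIdx d → ℝ

/-- The `ρ`-coordinate. -/
def rho {d : ℕ} (z : Coord d) : ℝ := z none

/-- The `t`-coordinate. -/
def tim {d : ℕ} (z : Coord d) : ℝ := z (some none)

/-- The coordinates on the cross-section. -/
def spc {d : ℕ} (z : Coord d) : Model d := WithLp.toLp 2 (fun A => z (some (some A)))

/-! ### Partial derivatives and the two classes of error terms -/

/-- The partial derivative with respect to the coordinate with index `α`. -/
def pd {d : ℕ} (α : SIdx d) (u : Coord d → ℝ) : Coord d → ℝ :=
  fun z => fderiv ℝ u z (Pi.single α 1)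

/-- Iterated partial derivatives. -/
def pdList {d : ℕ} : List (SIdx d) → (Coord d → ℝ) → Coord d → ℝ
  | [], u => u
  | α :: L, u => pd α (pdList L u)

/-- `u = 𝒪(ζ)` on the open coordinate region `D`: `u` is smooth there and every iterated partial
derivative with `k` derivatives in `ρ` (and any number of derivatives in `t`, `x^A`) is bounded
by a constant times `ρ^{-k} ζ`. -/
def IsO {d : ℕ} (D : Set (Coord d)) (ζ : Coord d → ℝ) (u : Coord d → ℝ) : Prop :=
  ContDiffOn ℝ ∞ u D ∧
    ∀ L : List (SIdx d), ∃ C : ℝ, ∀ z ∈ D,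
      |pdList L u z| ≤ C * (rho z ^ (-(L.count none : ℤ)) * ζ z)

/-- `u = 𝒪₀(ζ)` on the open coordinate region `D`: `u` is smooth there and every iterated partial
derivative of order `m`, in any of the coordinates, is bounded by a constant times `ρ^{-m} ζ`. -/
def IsO₀ {d : ℕ} (D : Set (Coord d)) (ζ : Coord d → ℝ) (u : Coord d → ℝ) : Prop :=
  ContDiffOn ℝ ∞ u D ∧
    ∀ L : List (SIdx d), ∃ C : ℝ, ∀ z ∈ D,
      |pdList L u z| ≤ C * (rho z ^ (-(L.length : ℤ)) * ζ z)

/-! ### Tensor fields on the spacetime and their coordinate components -/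

section Fields

variable {d : ℕ} {S : Type*} [TopologicalSpace S] [ChartedSpace (Model d) S]

/-- The tangent space of `M` at `(ρ, t, x)`: the `∂_ρ`-component, the `∂_t`-component and the
component tangent to `S`. -/
abbrev TM (d : ℕ) {S : Type*} [TopologicalSpace S] [ChartedSpace (Model d) S] (x : S) :=
  ℝ × ℝ × TangentSpace (𝓡 d) x

/-- Covariant 2-tensor fields: a bilinear form on the tangent space at each point `(ρ, t, x)`
(only the values on `M` matter). -/
abbrev Tensor2 (d : ℕ) (S : Type*) [TopologicalSpace S] [ChartedSpace (Model d) S] :=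
  (_ρ _t : ℝ) → (x : S) → LinearMap.BilinForm ℝ (TM d x)

/-- The region of coordinate space covered by the chart `φ` of `S`, with `(ρ, t)` appended. -/
def chartDom (φ : OpenPartialHomeomorph S (Model d)) (ρs T : ℝ) : Set (Coord d) :=
  {z | rho z ∈ Ioo 0 ρs ∧ tim z ∈ Ioo 0 (Real.pi * T) ∧ spc z ∈ φ.target}

/-- The coordinate vector fields `∂_ρ, ∂_t, ∂_{x^A}` at the point with coordinates `z`. -/
def coordVec (φ : OpenPartialHomeomorph S (Model d)) (z : Coord d) :
    SIdx d → TM d (φ.symm (spc z))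
  | none => (1, 0, 0)
  | some none => (0, 1, 0)
  | some (some A) =>
      (0, 0, mfderiv (𝓡 d) (𝓡 d) φ.symm (spc z) (EuclideanSpace.single A (1 : ℝ)))

/-- The matrix of components of a covariant 2-tensor in the chart `φ`. -/
def comps (h : Tensor2 d S) (φ : OpenPartialHomeomorph S (Model d)) (z : Coord d) :
    Matrix (SIdx d) (SIdx d) ℝ :=
  Matrix.of fun α β =>
    h (rho z) (tim z) (φ.symm (spc z)) (coordVec φ z α) (coordVec φ z β)

/-- A scalar function on `M`, expressed in the chart `φ`. -/
def inChart (u : ℝ → ℝ → S → ℝ) (φ : OpenPartialHomeomorph S (Model d)) : Coord d → ℝ :=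
  fun z => u (rho z) (tim z) (φ.symm (spc z))

/-- A bilinear form is Lorentzian: in some basis it is diagonal with one entry `-1` and all other
entries `+1`. -/
def IsLorentzian {x : S} (B : LinearMap.BilinForm ℝ (TM d x)) : Prop :=
  ∃ b : Module.Basis (SIdx d) ℝ (TM d x), ∀ i j,
    B (b i) (b j) = if i = j then (if i = some none then -1 else 1) else 0

/-- `(M, g)` is an admissible aAdS segment, with `g = ρ⁻² (gm + ρ² gs + ρ³ gr)` and with bounded
family of coordinates `Ξ`. Smoothness of all the tensor fields is part of the `IsO` conditions. -/
structure IsAdmissible (ρs T : ℝ) (g gm gs gr : Tensor2 d S)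
    (Ξ : Set (OpenPartialHomeomorph S (Model d))) : Prop where
  lorentzian : ∀ ρ ∈ Ioo 0 ρs, ∀ t ∈ Ioo 0 (Real.pi * T), ∀ x, IsLorentzian (g ρ t x)
  gm_symm : ∀ ρ ∈ Ioo 0 ρs, ∀ t ∈ Ioo 0 (Real.pi * T), ∀ x X Y, gm ρ t x X Y = gm ρ t x Y X
  gs_symm : ∀ ρ ∈ Ioo 0 ρs, ∀ t ∈ Ioo 0 (Real.pi * T), ∀ x X Y, gs ρ t x X Y = gs ρ t x Y X
  gr_symm : ∀ ρ ∈ Ioo 0 ρs, ∀ t ∈ Ioo 0 (Real.pi * T), ∀ x X Y, gr ρ t x X Y = gr ρ t x Y X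
  expansion : ∀ ρ ∈ Ioo 0 ρs, ∀ t ∈ Ioo 0 (Real.pi * T), ∀ x X Y,
    g ρ t x X Y = (ρ ^ 2)⁻¹ * (gm ρ t x X Y + ρ ^ 2 * gs ρ t x X Y + ρ ^ 3 * gr ρ t x X Y)
  /-- `gm` and `gs` do not depend on `ρ`. -/
  gm_indep : ∀ ρ ∈ Ioo 0 ρs, ∀ ρ' ∈ Ioo 0 ρs, ∀ t ∈ Ioo 0 (Real.pi * T), ∀ x,
    gm ρ t x = gm ρ' t x
  gs_indep : ∀ ρ ∈ Ioo 0 ρs, ∀ ρ' ∈ Ioo 0 ρs, ∀ t ∈ Ioo 0 (Real.pi * T), ∀ x,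
    gs ρ t x = gs ρ' t x
  /-- `gm = dρ² - dt² + γ`, where `γ` is a (time-dependent) symmetric tensor on `S`. -/
  gm_form : ∀ ρ ∈ Ioo 0 ρs, ∀ t ∈ Ioo 0 (Real.pi * T), ∀ x, ∀ X Y : TM d x,
    gm ρ t x X Y = X.1 * Y.1 - X.2.1 * Y.2.1 + gm ρ t x (0, 0, X.2.2) (0, 0, Y.2.2)
  /-- The induced boundary metric `-dt² + γ` is Lorentzian, that is, `γ` is positive definite. -/
  gm_pos : ∀ ρ ∈ Ioo 0 ρs, ∀ t ∈ Ioo 0 (Real.pi * T), ∀ x, ∀ Y : TangentSpace (𝓡 d) x,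
    Y ≠ 0 → 0 < gm ρ t x (0, 0, Y) (0, 0, Y)
  /-- `gs` is a function times `dρ²` plus a tensor on the boundary. -/
  gs_form : ∀ ρ ∈ Ioo 0 ρs, ∀ t ∈ Ioo 0 (Real.pi * T), ∀ x, ∀ X : ℝ × TangentSpace (𝓡 d) x,
    gs ρ t x (1, 0, 0) (0, X) = 0
  finite : Ξ.Finite
  compatible : ∀ φ ∈ Ξ, φ ∈ IsManifold.maximalAtlas (𝓡 d) ∞ S
  covers : ∀ x : S, ∃ φ ∈ Ξ, x ∈ φ.source
  gm_bdd : ∀ φ ∈ Ξ, ∀ α β, IsO (chartDom φ ρs T) 1 (fun z => comps gm φ z α β)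
  gm_inv_bdd : ∀ φ ∈ Ξ, ∀ α β, IsO (chartDom φ ρs T) 1 (fun z => (comps gm φ z)⁻¹ α β)
  gs_bdd : ∀ φ ∈ Ξ, ∀ α β, IsO (chartDom φ ρs T) 1 (fun z => comps gs φ z α β)
  gr_bdd : ∀ φ ∈ Ξ, ∀ α β, IsO (chartDom φ ρs T) 1 (fun z => comps gr φ z α β)

/-- `(M, g)` is an admissible Fefferman–Graham aAdS segment: moreover `gs` and `gr` only have
components tangent to the level sets of `ρ`. -/
structure IsAdmissibleFG (ρs T : ℝ) (g gm gs gr : Tensor2 d S)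
    (Ξ : Set (OpenPartialHomeomorph S (Model d))) : Prop
    extends IsAdmissible ρs T g gm gs gr Ξ where
  gs_tangent : ∀ ρ ∈ Ioo 0 ρs, ∀ t ∈ Ioo 0 (Real.pi * T), ∀ x, ∀ X : TM d x,
    gs ρ t x (1, 0, 0) X = 0
  gr_tangent : ∀ ρ ∈ Ioo 0 ρs, ∀ t ∈ Ioo 0 (Real.pi * T), ∀ x, ∀ X : TM d x,
    gr ρ t x (1, 0, 0) X = 0

/-- The pseudoconvexity property at the conformal boundary, with parameters `K`, `ξ`, `ζ` (and the
constant `μ` determined by `T` and `ξ`). Since `∂_t` generates translations in `t`, the Lie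
derivative of `gm` along `∂_t`, evaluated on a vector tangent to `S`, is a derivative in `t`. -/
structure PseudoconvexityProperty (ρs T : ℝ) (gm gs : Tensor2 d S)
    (Ξ : Set (OpenPartialHomeomorph S (Model d))) (K ξ μ : ℝ) (ζ : ℝ → ℝ → S → ℝ) : Prop where
  K_pos : 0 < K
  ξ_nonneg : 0 ≤ ξ
  ζ_bdd : ∀ φ ∈ Ξ, IsO (chartDom φ ρs T) 1 (inChart ζ φ)
  nonstatic : ∀ ρ ∈ Ioo 0 ρs, ∀ t ∈ Ioo 0 (Real.pi * T), ∀ x, ∀ Y : TangentSpace (𝓡 d) x,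
    |deriv (fun s => gm ρ s x (0, 0, Y) (0, 0, Y)) t| ≤ ξ * gm ρ t x (0, 0, Y) (0, 0, Y)
  positive : ∀ ρ ∈ Ioo 0 ρs, ∀ t ∈ Ioo 0 (Real.pi * T), ∀ x, ∀ X : ℝ × TangentSpace (𝓡 d) x,
    K * (X.1 ^ 2 + gm ρ t x (0, 0, X.2) (0, 0, X.2)) ≤
      -gs ρ t x (0, X) (0, X) - (μ ^ 2 + ξ ^ 2 / 16) * X.1 ^ 2
        - ζ ρ t x * gm ρ t x (0, X) (0, X)

end Fields

/-! ### The function `f` -/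

/-- The defining equation of `μ`: `T = 2 / μ - (2 / (μ π)) arctan (4 μ / ξ)` and
`1 / T ≤ μ < 2 / T`, where `arctan (4 μ / ξ)` means `π / 2` if `ξ = 0`. -/
def IsMu (T ξ μ : ℝ) : Prop :=
  T = 2 / μ - 2 / (μ * Real.pi) * (if ξ = 0 then Real.pi / 2 else Real.arctan (4 * μ / ξ)) ∧
    1 / T ≤ μ ∧ μ < 2 / T

/-- The function `η` of time. -/
def eta (T ξ μ : ℝ) (t : ℝ) : ℝ :=
  if t < Real.pi * T / 2 then Real.exp (ξ / 4 * t) * Real.sin (μ * t)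
  else Real.exp (ξ / 4 * (Real.pi * T - t)) * Real.sin (μ * (Real.pi * T - t))

/-- The function `f = ρ / η(t)`, in coordinates. -/
def fol {d : ℕ} (T ξ μ : ℝ) (z : Coord d) : ℝ := rho z / eta T ξ μ (tim z)

/-! ### Coordinate expressions of geometric objects -/

section Geometry

variable {d : ℕ}

/-- The inner product of two vectors given by components. -/
def ip (B : Matrix (SIdx d) (SIdx d) ℝ) (X Y : SIdx d → ℝ) : ℝ :=
  ∑ α, ∑ β, B α β * X α * Y β

/-- The Christoffel symbols `Γ^μ_{αβ}` of the metric with components `G`. -/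
def christoffel (G : Coord d → Matrix (SIdx d) (SIdx d) ℝ) (z : Coord d) (μ α β : SIdx d) : ℝ :=
  1 / 2 * ∑ ν, (G z)⁻¹ μ ν *
    (pd α (fun z' => G z' ν β) z + pd β (fun z' => G z' ν α) z - pd ν (fun z' => G z' α β) z)

/-- The Levi-Civita covariant derivative `∇_α σ_β` of a covector field. -/
def covD (G : Coord d → Matrix (SIdx d) (SIdx d) ℝ) (σ : Coord d → SIdx d → ℝ) (z : Coord d) :
    Matrix (SIdx d) (SIdx d) ℝ :=
  Matrix.of fun α β => pd α (fun z' => σ z' β) z - ∑ μ, christoffel G z μ α β * σ z μ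

/-- The Hessian `∇²u`. -/
def hess (G : Coord d → Matrix (SIdx d) (SIdx d) ℝ) (u : Coord d → ℝ) (z : Coord d) :
    Matrix (SIdx d) (SIdx d) ℝ :=
  covD G (fun z' β => pd β u z') z

/-- The gradient `∇^α u`. -/
def grad (G : Coord d → Matrix (SIdx d) (SIdx d) ℝ) (u : Coord d → ℝ) (z : Coord d) :
    SIdx d → ℝ :=
  fun α => ∑ β, (G z)⁻¹ α β * pd β u z

/-- The square `∇^α u ∇_α u` of the gradient. -/
def gradSq (G : Coord d → Matrix (SIdx d) (SIdx d) ℝ) (u : Coord d → ℝ) (z : Coord d) : ℝ :=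
  ∑ α, grad G u z α * pd α u z

/-- The covector field `S_α = f^{n-3} ∇_α f` (with `n = d + 1`). -/
def Sform (T ξ μ : ℝ) (z : Coord d) (α : SIdx d) : ℝ :=
  fol T ξ μ z ^ ((d : ℤ) + 1 - 3) * pd α (fol T ξ μ) z

/-- The function `w = f - (1/2) f ρ² ξ |η'| / η + f ρ² ζ`. -/
def wfun (T ξ μ : ℝ) (ζ : Coord d → ℝ) (z : Coord d) : ℝ :=
  fol T ξ μ z
    - 1 / 2 * fol T ξ μ z * rho z ^ 2 * ξ * (|deriv (eta T ξ μ) (tim z)| / eta T ξ μ (tim z))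
    + fol T ξ μ z * rho z ^ 2 * ζ z

/-- The modified deformation tensor `π = -(∇S + f^{n-3} w g)`, with lower indices. -/
def defTensor (G : Coord d → Matrix (SIdx d) (SIdx d) ℝ) (T ξ μ : ℝ) (ζ : Coord d → ℝ)
    (z : Coord d) : Matrix (SIdx d) (SIdx d) ℝ :=
  -(covD G (Sform T ξ μ) z + (fol T ξ μ z ^ ((d : ℤ) + 1 - 3) * wfun T ξ μ ζ z) • G z)

/-- The contraction `π^{αβ} θ_α θ_β`, indices being raised with the metric. -/
def defContraction (G : Coord d → Matrix (SIdx d) (SIdx d) ℝ) (T ξ μ : ℝ) (ζ : Coord d → ℝ)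
    (z : Coord d) (θ : SIdx d → ℝ) : ℝ :=
  ∑ α, ∑ β, (∑ α', ∑ β', (G z)⁻¹ α α' * (G z)⁻¹ β β' * defTensor G T ξ μ ζ z α' β') * θ α * θ β

/-- The value `θ(X)`. -/
def pair (θ X : SIdx d → ℝ) : ℝ := ∑ α, θ α * X α

/-- `E_1, …, E_d` is an orthonormal frame, at `z`, of the level set of `(ρ, t)` through `z`. -/
def IsHorizontalFrame (G : Coord d → Matrix (SIdx d) (SIdx d) ℝ) (z : Coord d)
    (E : Fin d → SIdx d → ℝ) : Prop :=
  (∀ X, E X none = 0 ∧ E X (some none) = 0) ∧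
    ∀ X Y, ip (G z) (E X) (E Y) = if X = Y then 1 else 0

/-- The unit normal `N = |∇^α f ∇_α f|^{-1/2} ∇f` of the level sets of `f`. -/
def vecN (G : Coord d → Matrix (SIdx d) (SIdx d) ℝ) (T ξ μ : ℝ) (z : Coord d) : SIdx d → ℝ :=
  (Real.sqrt |gradSq G (fol T ξ μ) z|)⁻¹ • grad G (fol T ξ μ) z

/-- The vector `∂_t + η' f ∂_ρ`. -/
def vecW (T ξ μ : ℝ) (z : Coord d) : SIdx d → ℝ :=
  Pi.single (some none) 1 + (deriv (eta T ξ μ) (tim z) * fol T ξ μ z) • Pi.single none 1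

/-- The part of `∂_t + η' f ∂_ρ` that is orthogonal to the frame `E`. -/
def vecVtilde (G : Coord d → Matrix (SIdx d) (SIdx d) ℝ) (T ξ μ : ℝ) (E : Fin d → SIdx d → ℝ)
    (z : Coord d) : SIdx d → ℝ :=
  vecW T ξ μ z - ∑ X, ip (G z) (vecW T ξ μ z) (E X) • E X

/-- The normalized vector `V = |g(Ṽ, Ṽ)|^{-1/2} Ṽ`. -/
def vecV (G : Coord d → Matrix (SIdx d) (SIdx d) ℝ) (T ξ μ : ℝ) (E : Fin d → SIdx d → ℝ)
    (z : Coord d) : SIdx d → ℝ :=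
  (Real.sqrt |ip (G z) (vecVtilde G T ξ μ E z) (vecVtilde G T ξ μ E z)|)⁻¹ •
    vecVtilde G T ξ μ E z

/-- The level set of `(ρ, t)` through `z` is spacelike at `z`. -/
def HorizontalSpacelikeAt (G : Coord d → Matrix (SIdx d) (SIdx d) ℝ) (z : Coord d) : Prop :=
  ∀ Y : SIdx d → ℝ, Y none = 0 → Y (some none) = 0 → Y ≠ 0 → 0 < ip (G z) Y Y

/-- The level set of `u` through `z` is, at `z`, a timelike hypersurface that is pseudoconvex for
the wave operator (in the direction of increasing `u`): `∇²u` is negative on all nonzero null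
vectors tangent to the level set. -/
def LevelSetPseudoconvexAt (G : Coord d → Matrix (SIdx d) (SIdx d) ℝ) (u : Coord d → ℝ)
    (z : Coord d) : Prop :=
  0 < gradSq G u z ∧
    ∀ X : SIdx d → ℝ, X ≠ 0 → ip (G z) X X = 0 → ∑ α, X α * pd α u z = 0 →
      ip (hess G u z) X X < 0

end Geometry

/-- The part of a chart domain where `f < f₀` and where `f` is smooth, that is, `t ≠ π T / 2`. -/
def smoothRegion {d : ℕ} {S : Type*} [TopologicalSpace S] [ChartedSpace (Model d) S]
    (φ : OpenPartialHomeomorph S (Model d)) (ρs T ξ μ f₀ : ℝ) : Set (Coord d) :=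
  {z | z ∈ chartDom φ ρs T ∧ tim z ≠ Real.pi * T / 2 ∧ fol T ξ μ z < f₀}

end AADS

end

open AADS

noncomputable section

namespace AADS

/-! ### The function `η` -/

/-! Near the boundary the metric is `ρ⁻² A + P` with `A = dρ² - dt² + γ` and `P = B + ρ R` bounded,
and the theorem rests on computing `∇²f + w g` one order beyond its singular part.

Let `X` be tangent to a level set of `f`, so that `X^ρ = f η' X^t`. Adding `f g` to the Hessian
cancels everything of size `ρ⁻²`, and the main part of what is left is `-(f²/ρ) η'' (X^t)² + f
B(X,X) + (f²/2ρ) η' ∂_tγ(X,X)` (`hessF_tangent`). Since `f²/ρ = f/η` is not controlled by `f` near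
the ends of the time interval, the terms with `η'` cannot be treated as errors; they need a sign.
This is what `η` and `w` are made for. The profile satisfies `η'' = (ξ/2)|η'| - (μ² + ξ²/16) η`, the
equation for `μ` being exactly the condition `η'(πT/2) = 0` under which the two halves fit together
twice differentiably. The `ξ`-term of `w` combines with the `ξ`-part of `η''` into `-(f²/2ρ) ξ |η'|
γ(X,X)`, up to a nonpositive term, and this absorbs `η' ∂_tγ` because `|∂_tγ| ≤ ξ γ`. The rest,
together with the `ζ`-term of `w`, is at most `-f K ((X^t)² + γ(X,X))` by the positivity condition.
The remaining terms are `O(f²)`, as `ρ ≤ C f`. This is `hessF_add_le`. On null vectors the term `w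
g` disappears, which gives the pseudoconvexity.

For the lower bound on `π`, `∇²f(∇f, ·) = ½ d|∇f|²` equals `f df` up to lower order (`hessF_gradF`).
In the normal direction the Hessian, `w` and the weight `f^{n-3}` contribute `f + f + (n-3) f`,
whence the coefficient `n - 1`; the mixed terms are `O(f³)` and are split by the
arithmetic-geometric inequality (`hessF_combined_le`). Expanding the vector dual to `θ` in the frame
`N, V, E` and comparing `dt² + γ` with `ρ²` times the squares of the tangential components
(`posForm_frame_ge`) yields the result, with explicit multiples of `f^{n-1} ρ²` and `f^n` as error
terms.

All of this is linear algebra at one point, with a single constant `C` (`PointData`, `ScalarData`).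
The admissibility conditions supply `C` uniformly over the finitely many charts
(`exists_uniform_bound`). -/

theorem hasDerivAt_ite_lt {m c t : ℝ} {p q p' q' : ℝ → ℝ} (hp : ∀ s, HasDerivAt p (p' s) s)
    (hq : ∀ s, HasDerivAt q (q' s) s) (h0 : p m = q m) (h1 : p' m = q' m)
    (hc : c = if t < m then p' t else q' t) :
    HasDerivAt (fun s => if s < m then p s else q s) c t := by
  rcases lt_trichotomy t m with h | h | h
  · rw [hc, if_pos h]
    refine (hp t).congr_of_eventuallyEq ?_
    filter_upwards [eventually_lt_nhds h] with s hs
    simp [hs]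
  · subst h
    rw [hc, if_neg (lt_irrefl _), ← hasDerivWithinAt_univ, ← Iic_union_Ici (a := t)]
    refine HasDerivWithinAt.union ?_ ?_
    · rw [← h1]
      refine (hp t).hasDerivWithinAt.congr_of_mem (fun s hs => ?_) (mem_Iic.2 le_rfl)
      rcases (mem_Iic.1 hs).lt_or_eq with h | h
      · simp [h]
      · simp [h, h0]
    · refine (hq t).hasDerivWithinAt.congr_of_mem (fun s hs => ?_) (mem_Ici.2 le_rfl)
      simp [not_lt.2 (mem_Ici.1 hs)]
  · rw [hc, if_neg h.not_gt]
    refine (hq t).congr_of_eventuallyEq ?_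
    filter_upwards [eventually_gt_nhds h] with s hs
    simp [not_lt.2 hs.le]

/-- The profile of `η` on the first half of the time interval. -/
def etaHalf (ξ μ t : ℝ) : ℝ := Real.exp (ξ / 4 * t) * Real.sin (μ * t)

/-- The derivative of `etaHalf`. -/
def etaHalf' (ξ μ t : ℝ) : ℝ :=
  Real.exp (ξ / 4 * t) * (ξ / 4 * Real.sin (μ * t) + μ * Real.cos (μ * t))

theorem hasDerivAt_etaHalf (ξ μ t : ℝ) : HasDerivAt (etaHalf ξ μ) (etaHalf' ξ μ t) t := by
  have h1 : HasDerivAt (fun s : ℝ => ξ / 4 * s) (ξ / 4) t := by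
    simpa using (hasDerivAt_id t).const_mul (ξ / 4)
  have h2 : HasDerivAt (fun s : ℝ => μ * s) μ t := by
    simpa using (hasDerivAt_id t).const_mul μ
  refine (h1.exp.mul h2.sin).congr_deriv ?_
  unfold etaHalf'; ring

/-- The profile `e^{ξt/4} sin(μt)` belongs to the characteristic roots `ξ/4 ± iμ`, so it solves a
linear equation with coefficients `ξ/2` and `μ² + ξ²/16`. -/
theorem hasDerivAt_etaHalf' (ξ μ t : ℝ) : HasDerivAt (etaHalf' ξ μ)
    (ξ / 2 * etaHalf' ξ μ t - (μ ^ 2 + ξ ^ 2 / 16) * etaHalf ξ μ t) t := by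
  have h1 : HasDerivAt (fun s : ℝ => ξ / 4 * s) (ξ / 4) t := by
    simpa using (hasDerivAt_id t).const_mul (ξ / 4)
  have h2 : HasDerivAt (fun s : ℝ => μ * s) μ t := by
    simpa using (hasDerivAt_id t).const_mul μ
  refine (h1.exp.mul ((h2.sin.const_mul (ξ / 4)).add (h2.cos.const_mul μ))).congr_deriv ?_
  unfold etaHalf' etaHalf; simp only [Pi.add_apply]; ring

/-- The derivative of `η`. -/
def eta' (T ξ μ t : ℝ) : ℝ :=
  if t < Real.pi * T / 2 then etaHalf' ξ μ t else -etaHalf' ξ μ (Real.pi * T - t)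

/-- The second derivative of `η`. -/
def eta'' (T ξ μ t : ℝ) : ℝ :=
  ξ / 2 * |eta' T ξ μ t| - (μ ^ 2 + ξ ^ 2 / 16) * eta T ξ μ t

theorem eta_eq (T ξ μ t : ℝ) : eta T ξ μ t =
    if t < Real.pi * T / 2 then etaHalf ξ μ t else etaHalf ξ μ (Real.pi * T - t) := rfl

variable {T ξ μ : ℝ}

theorem IsMu.pos (hT : 0 < T) (h : IsMu T ξ μ) : 0 < μ :=
  lt_of_lt_of_le (by positivity) h.2.1

/-- With `a = arctan(4μ/ξ)`, read as `π/2` if `ξ = 0`, the defining equation of `μ` says that the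
phase `μt` equals `π - a` at the midpoint. Stating `tan a = 4μ/ξ` without a quotient makes the two
cases uniform. -/
theorem IsMu.exists_angle (hT : 0 < T) (hξ : 0 ≤ ξ) (h : IsMu T ξ μ) :
    ∃ a, 0 < a ∧ a ≤ Real.pi / 2 ∧ μ * (Real.pi * T / 2) = Real.pi - a ∧
      ξ * Real.sin a = 4 * μ * Real.cos a := by
  have hμ := h.pos hT
  refine ⟨if ξ = 0 then Real.pi / 2 else Real.arctan (4 * μ / ξ), ?_, ?_, ?_, ?_⟩
  · split_ifs with h0
    · positivity
    · have : 0 < ξ := lt_of_le_of_ne hξ (Ne.symm h0)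
      exact Real.arctan_pos.2 (by positivity)
  · split_ifs with h0
    · exact le_rfl
    · exact (Real.arctan_lt_pi_div_two _).le
  · have := h.1
    generalize (if ξ = 0 then Real.pi / 2 else Real.arctan (4 * μ / ξ)) = a at *
    rw [this]
    field_simp
  · split_ifs with h0
    · simp [h0]
    · have h1 := Real.tan_arctan (4 * μ / ξ)
      have hc := Real.cos_arctan_pos (4 * μ / ξ)
      rw [Real.tan_eq_sin_div_cos] at h1
      field_simp at h1
      linarith

/-- The factor `sin a` merges sine and cosine into a single shifted sine, from which the zero of the
derivative at the midpoint and its sign before it can be read off. -/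
theorem etaHalf'_eq {a : ℝ} (ha : ξ * Real.sin a = 4 * μ * Real.cos a) (t : ℝ) :
    Real.sin a * etaHalf' ξ μ t = Real.exp (ξ / 4 * t) * (μ * Real.sin (μ * t + a)) := by
  rw [Real.sin_add]; unfold etaHalf'
  linear_combination Real.exp (ξ / 4 * t) * Real.sin (μ * t) / 4 * ha

theorem etaHalf'_mid (hT : 0 < T) (hξ : 0 ≤ ξ) (h : IsMu T ξ μ) :
    etaHalf' ξ μ (Real.pi * T / 2) = 0 := by
  obtain ⟨a, ha0, ha1, ha2, ha3⟩ := h.exists_angle hT hξ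
  have hs : 0 < Real.sin a := Real.sin_pos_of_pos_of_lt_pi ha0 (by linarith [Real.pi_pos])
  have := etaHalf'_eq ha3 (Real.pi * T / 2)
  rw [ha2] at this
  simp [hs.ne'] at this
  exact this

theorem etaHalf'_nonneg (hT : 0 < T) (hξ : 0 ≤ ξ) (h : IsMu T ξ μ) {t : ℝ} (h0 : 0 < t)
    (h1 : t ≤ Real.pi * T / 2) : 0 ≤ etaHalf' ξ μ t := by
  obtain ⟨a, ha0, ha1, ha2, ha3⟩ := h.exists_angle hT hξ
  have hμ := h.pos hT
  have hs : 0 < Real.sin a := Real.sin_pos_of_pos_of_lt_pi ha0 (by linarith [Real.pi_pos])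
  have h2 := etaHalf'_eq ha3 t
  have h3 : μ * t ≤ Real.pi - a := ha2 ▸ mul_le_mul_of_nonneg_left h1 hμ.le
  have h4 : 0 ≤ Real.sin (μ * t + a) :=
    Real.sin_nonneg_of_nonneg_of_le_pi (by positivity) (by linarith)
  refine nonneg_of_mul_nonneg_right (h2 ▸ ?_) hs
  positivity

theorem etaHalf_pos (hT : 0 < T) (hξ : 0 ≤ ξ) (h : IsMu T ξ μ) {t : ℝ} (h0 : 0 < t)
    (h1 : t ≤ Real.pi * T / 2) : 0 < etaHalf ξ μ t := by
  obtain ⟨a, ha0, ha1, ha2, ha3⟩ := h.exists_angle hT hξ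
  have hμ := h.pos hT
  have h3 : μ * t ≤ Real.pi - a := ha2 ▸ mul_le_mul_of_nonneg_left h1 hμ.le
  have := Real.sin_pos_of_pos_of_lt_pi (x := μ * t) (by positivity) (by linarith)
  unfold etaHalf; positivity

theorem eta_pos (hT : 0 < T) (hξ : 0 ≤ ξ) (h : IsMu T ξ μ) {t : ℝ}
    (ht : t ∈ Ioo 0 (Real.pi * T)) : 0 < eta T ξ μ t := by
  rw [eta_eq]
  split_ifs with h1
  · exact etaHalf_pos hT hξ h ht.1 h1.le
  · exact etaHalf_pos hT hξ h (by linarith [ht.2]) (by linarith)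

theorem hasDerivAt_reflect {p : ℝ → ℝ} {c b t : ℝ} (hp : HasDerivAt p c (b - t)) :
    HasDerivAt (fun s => p (b - s)) (-c) t :=
  (hp.comp t ((hasDerivAt_id t).const_sub b)).congr_deriv (by ring)

theorem hasDerivAt_eta (hT : 0 < T) (hξ : 0 ≤ ξ) (h : IsMu T ξ μ) (t : ℝ) :
    HasDerivAt (eta T ξ μ) (eta' T ξ μ t) t := by
  refine hasDerivAt_ite_lt (m := Real.pi * T / 2) (p := etaHalf ξ μ) (p' := etaHalf' ξ μ)
    (q := fun s => etaHalf ξ μ (Real.pi * T - s))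
    (q' := fun s => -etaHalf' ξ μ (Real.pi * T - s)) (hasDerivAt_etaHalf ξ μ)
    (fun s => hasDerivAt_reflect (hasDerivAt_etaHalf ξ μ _)) ?_ ?_ rfl
  · congr 1; ring
  · rw [show Real.pi * T - Real.pi * T / 2 = Real.pi * T / 2 by ring, etaHalf'_mid hT hξ h, neg_zero]

theorem deriv_eta (hT : 0 < T) (hξ : 0 ≤ ξ) (h : IsMu T ξ μ) (t : ℝ) :
    deriv (eta T ξ μ) t = eta' T ξ μ t := (hasDerivAt_eta hT hξ h t).deriv

/-- Reflection in the midpoint changes the sign of `η'` but not of `η''`. Replacing `η'` by `|η'|`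
in the equation of the first half therefore gives one formula for the whole interval, valid at the
midpoint as well. -/
theorem hasDerivAt_eta' (hT : 0 < T) (hξ : 0 ≤ ξ) (h : IsMu T ξ μ) {t : ℝ}
    (ht : t ∈ Ioo 0 (Real.pi * T)) : HasDerivAt (eta' T ξ μ) (eta'' T ξ μ t) t := by
  refine hasDerivAt_ite_lt (m := Real.pi * T / 2) (p := etaHalf' ξ μ)
    (p' := fun s => ξ / 2 * etaHalf' ξ μ s - (μ ^ 2 + ξ ^ 2 / 16) * etaHalf ξ μ s)
    (q := fun s => -etaHalf' ξ μ (Real.pi * T - s))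
    (q' := fun s => - -(ξ / 2 * etaHalf' ξ μ (Real.pi * T - s)
      - (μ ^ 2 + ξ ^ 2 / 16) * etaHalf ξ μ (Real.pi * T - s))) (hasDerivAt_etaHalf' ξ μ)
    (fun s => (hasDerivAt_reflect (hasDerivAt_etaHalf' ξ μ _)).neg) ?_ ?_ ?_
  · rw [show Real.pi * T - Real.pi * T / 2 = Real.pi * T / 2 by ring, etaHalf'_mid hT hξ h, neg_zero]
  · simp only [show Real.pi * T - Real.pi * T / 2 = Real.pi * T / 2 by ring, neg_neg]
  · unfold eta'' eta'
    rw [eta_eq]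
    split_ifs with h1
    · rw [abs_of_nonneg (etaHalf'_nonneg hT hξ h ht.1 h1.le)]
    · rw [abs_neg, abs_of_nonneg (etaHalf'_nonneg hT hξ h (by linarith [ht.2]) (by linarith)), neg_neg]

theorem exists_eta_bound (T μ : ℝ) (hξ : 0 ≤ ξ) :
    ∃ M : ℝ, ∀ t ∈ Ioo 0 (Real.pi * T),
      |eta T ξ μ t| ≤ M ∧ |eta' T ξ μ t| ≤ M ∧ |eta'' T ξ μ t| ≤ M := by
  have c0 : Continuous (etaHalf ξ μ) := by unfold etaHalf; fun_prop
  have c1 : Continuous (etaHalf' ξ μ) := by unfold etaHalf'; fun_prop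
  obtain ⟨M0, h0⟩ := (isCompact_Icc (a := 0) (b := Real.pi * T)).exists_bound_of_continuousOn
    c0.continuousOn
  obtain ⟨M1, h1⟩ := (isCompact_Icc (a := 0) (b := Real.pi * T)).exists_bound_of_continuousOn
    c1.continuousOn
  have hM0 : ∀ t ∈ Ioo 0 (Real.pi * T), |eta T ξ μ t| ≤ M0 := by
    intro t ht
    rw [eta_eq]
    split_ifs
    · exact h0 t (Ioo_subset_Icc_self ht)
    · exact h0 _ ⟨by linarith [ht.2], by linarith [ht.1]⟩
  have hM1 : ∀ t ∈ Ioo 0 (Real.pi * T), |eta' T ξ μ t| ≤ M1 := by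
    intro t ht
    unfold eta'
    split_ifs
    · exact h1 t (Ioo_subset_Icc_self ht)
    · rw [abs_neg]; exact h1 _ ⟨by linarith [ht.2], by linarith [ht.1]⟩
  refine ⟨max (max M0 M1) (ξ / 2 * M1 + (μ ^ 2 + ξ ^ 2 / 16) * M0), fun t ht => ⟨?_, ?_, ?_⟩⟩
  · exact (hM0 t ht).trans ((le_max_left _ _).trans (le_max_left _ _))
  · exact (hM1 t ht).trans ((le_max_right _ _).trans (le_max_left _ _))
  · refine le_trans ?_ (le_max_right _ _)
    unfold eta''
    refine (abs_sub _ _).trans ?_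
    rw [abs_mul, abs_mul, abs_abs, abs_of_nonneg (by positivity : 0 ≤ ξ / 2),
      abs_of_nonneg (by positivity : 0 ≤ μ ^ 2 + ξ ^ 2 / 16)]
    gcongr
    · exact hM1 t ht
    · exact hM0 t ht

/-! ### Bilinear and trilinear forms given by components -/

section Forms

variable {d : ℕ}

theorem ip_eq_dotProduct (B : Matrix (SIdx d) (SIdx d) ℝ) (X Y : SIdx d → ℝ) :
    ip B X Y = dotProduct X (B.mulVec Y) := by
  unfold ip dotProduct Matrix.mulVec dotProduct
  refine Finset.sum_congr rfl fun α _ => ?_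
  rw [Finset.mul_sum]
  exact Finset.sum_congr rfl fun β _ => by ring

variable (B B' : Matrix (SIdx d) (SIdx d) ℝ) (X X' Y Y' : SIdx d → ℝ) (c : ℝ)

theorem ip_add_left : ip B (X + X') Y = ip B X Y + ip B X' Y := by
  simp only [ip_eq_dotProduct, add_dotProduct]

theorem ip_add_right : ip B X (Y + Y') = ip B X Y + ip B X Y' := by
  simp only [ip_eq_dotProduct, Matrix.mulVec_add, dotProduct_add]

theorem ip_sub_left : ip B (X - X') Y = ip B X Y - ip B X' Y := by
  simp only [ip_eq_dotProduct, sub_dotProduct]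

theorem ip_sub_right : ip B X (Y - Y') = ip B X Y - ip B X Y' := by
  simp only [ip_eq_dotProduct, Matrix.mulVec_sub, dotProduct_sub]

theorem ip_smul_left : ip B (c • X) Y = c * ip B X Y := by
  simp only [ip_eq_dotProduct, smul_dotProduct, smul_eq_mul]

theorem ip_smul_right : ip B X (c • Y) = c * ip B X Y := by
  simp only [ip_eq_dotProduct, Matrix.mulVec_smul, dotProduct_smul, smul_eq_mul]

theorem ip_add_form : ip (B + B') X Y = ip B X Y + ip B' X Y := by
  simp only [ip_eq_dotProduct, Matrix.add_mulVec, dotProduct_add]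

theorem ip_sub_form : ip (B - B') X Y = ip B X Y - ip B' X Y := by
  simp only [ip_eq_dotProduct, Matrix.sub_mulVec, dotProduct_sub]

theorem ip_neg_form : ip (-B) X Y = -ip B X Y := by
  simp only [ip_eq_dotProduct, Matrix.neg_mulVec, dotProduct_neg]

theorem ip_smul_form : ip (c • B) X Y = c * ip B X Y := by
  simp only [ip_eq_dotProduct, Matrix.smul_mulVec, dotProduct_smul, smul_eq_mul]

theorem ip_sum_left {ι : Type*} (s : Finset ι) (Z : ι → SIdx d → ℝ) :
    ip B (∑ i ∈ s, Z i) Y = ∑ i ∈ s, ip B (Z i) Y := by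
  simp only [ip_eq_dotProduct, sum_dotProduct]

theorem ip_sum_right {ι : Type*} (s : Finset ι) (Z : ι → SIdx d → ℝ) :
    ip B X (∑ i ∈ s, Z i) = ∑ i ∈ s, ip B X (Z i) := by
  simp only [ip_eq_dotProduct, Matrix.mulVec_sum, dotProduct_sum]

theorem ip_single (α : SIdx d) : ip B (Pi.single α 1) Y = ∑ β, B α β * Y β := by
  rw [ip_eq_dotProduct, single_one_dotProduct]; rfl

theorem ip_single_single (α β : SIdx d) : ip B (Pi.single α 1) (Pi.single β 1) = B α β := by
  rw [ip_eq_dotProduct, single_one_dotProduct, Matrix.mulVec_single_one]; rfl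

variable {B} in
theorem ip_comm (h : ∀ α β, B α β = B β α) : ip B X Y = ip B Y X := by
  unfold ip
  rw [Finset.sum_comm]
  exact Finset.sum_congr rfl fun α _ => Finset.sum_congr rfl fun β _ => by rw [h]; ring

variable {B} in
theorem abs_ip_le {C : ℝ} (h : ∀ α β, |B α β| ≤ C) :
    |ip B X Y| ≤ ((d : ℝ) + 2) ^ 2 * C * (‖X‖ * ‖Y‖) := by
  unfold ip
  have hb : ∀ α β, |B α β * X α * Y β| ≤ C * (‖X‖ * ‖Y‖) := fun α β => by
    rw [abs_mul, abs_mul, mul_assoc]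
    have h1 : |X α| ≤ ‖X‖ := norm_le_pi_norm X α
    have h2 : |Y β| ≤ ‖Y‖ := norm_le_pi_norm Y β
    have := h α β
    gcongr
    exact (abs_nonneg _).trans this
  calc _ ≤ ∑ α : SIdx d, ∑ β : SIdx d, C * (‖X‖ * ‖Y‖) :=
        (Finset.abs_sum_le_sum_abs _ _).trans (Finset.sum_le_sum fun α _ =>
          (Finset.abs_sum_le_sum_abs _ _).trans (Finset.sum_le_sum fun β _ => hb α β))
    _ = _ := by
        simp [Finset.card_univ, Fintype.card_option]; ring

/-- The trilinear form whose components are given by a family of matrices. -/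
def tri (D : SIdx d → Matrix (SIdx d) (SIdx d) ℝ) (Z X Y : SIdx d → ℝ) : ℝ :=
  ∑ α, Z α * ip (D α) X Y

variable (D : SIdx d → Matrix (SIdx d) (SIdx d) ℝ) (Z Z' : SIdx d → ℝ)

theorem tri_sub₁ : tri D (Z - Z') X Y = tri D Z X Y - tri D Z' X Y := by
  simp only [tri, Pi.sub_apply, sub_mul, Finset.sum_sub_distrib]

theorem tri_smul₁ : tri D (c • Z) X Y = c * tri D Z X Y := by
  simp only [tri, Pi.smul_apply, smul_eq_mul, mul_assoc, Finset.mul_sum]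

theorem tri_sub₂ : tri D Z (X - X') Y = tri D Z X Y - tri D Z X' Y := by
  simp only [tri, ip_sub_left, mul_sub, Finset.sum_sub_distrib]

theorem tri_smul₂ : tri D Z (c • X) Y = c * tri D Z X Y := by
  simp only [tri, ip_smul_left, Finset.mul_sum]
  exact Finset.sum_congr rfl fun _ _ => by ring

variable {D} in
theorem tri_comm (h : ∀ μ α β, D μ α β = D μ β α) : tri D Z X Y = tri D Z Y X := by
  unfold tri
  exact Finset.sum_congr rfl fun α _ => by rw [ip_comm X Y (h α)]

theorem tri_single₁ (α : SIdx d) : tri D (Pi.single α 1) X Y = ip (D α) X Y := by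
  simp [tri, Pi.single_apply]

variable {D} in
theorem abs_tri_le {C : ℝ} (h : ∀ μ α β, |D μ α β| ≤ C) :
    |tri D Z X Y| ≤ ((d : ℝ) + 2) ^ 3 * C * (‖Z‖ * (‖X‖ * ‖Y‖)) := by
  unfold tri
  have hb : ∀ α, |Z α * ip (D α) X Y| ≤ ‖Z‖ * (((d : ℝ) + 2) ^ 2 * C * (‖X‖ * ‖Y‖)) := fun α => by
    rw [abs_mul]
    have h1 : |Z α| ≤ ‖Z‖ := norm_le_pi_norm Z α
    have := abs_ip_le X Y (h α)
    gcongr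
  calc _ ≤ ∑ α : SIdx d, ‖Z‖ * (((d : ℝ) + 2) ^ 2 * C * (‖X‖ * ‖Y‖)) :=
        (Finset.abs_sum_le_sum_abs _ _).trans (Finset.sum_le_sum fun α _ => hb α)
    _ = _ := by
        simp [Finset.card_univ, Fintype.card_option]; ring

/-! ### The Hessian in terms of first derivatives of the metric -/

variable (G : Coord d → Matrix (SIdx d) (SIdx d) ℝ) (u : Coord d → ℝ) (z : Coord d)

theorem ip_grad {G : Coord d → Matrix (SIdx d) (SIdx d) ℝ} {z : Coord d}
    (hu : IsUnit (G z).det) (hG : ∀ α β, G z α β = G z β α) (X : SIdx d → ℝ) :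
    ip (G z) (grad G u z) X = ∑ α, X α * pd α u z := by
  rw [ip_comm _ _ hG, ip_eq_dotProduct]
  have : grad G u z = (G z)⁻¹.mulVec (fun β => pd β u z) := rfl
  rw [this, Matrix.mulVec_mulVec, Matrix.mul_nonsing_inv _ hu, Matrix.one_mulVec]
  rfl

theorem inv_symm {M : Matrix (SIdx d) (SIdx d) ℝ} (h : ∀ α β, M α β = M β α) (α β : SIdx d) :
    M⁻¹ α β = M⁻¹ β α := by
  have h1 : M.transpose = M := by ext; simp [h]
  have h2 := Matrix.transpose_nonsing_inv M
  rw [h1] at h2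
  exact congrFun (congrFun h2 β) α

theorem sum_christoffel {G : Coord d → Matrix (SIdx d) (SIdx d) ℝ} {z : Coord d}
    (hG : ∀ α β, G z α β = G z β α) (D : SIdx d → Matrix (SIdx d) (SIdx d) ℝ)
    (hD : ∀ α β γ, pd α (fun z' => G z' β γ) z = D α β γ) (α β : SIdx d) :
    ∑ ν, christoffel G z ν α β * pd ν u z =
      1 / 2 * ∑ ν, grad G u z ν * (D α ν β + D β ν α - D ν α β) := by
  unfold christoffel grad
  simp only [Finset.mul_sum, Finset.sum_mul, hD]
  rw [Finset.sum_comm]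
  refine Finset.sum_congr rfl fun ν _ => Finset.sum_congr rfl fun κ _ => ?_
  rw [inv_symm hG κ ν]
  ring

/-- Contracting the Christoffel symbols with `du` lowers their upper index against the gradient.
Only first derivatives of the metric remain, in Koszul form, and the later computations never meet
the symbols themselves. -/
theorem ip_hess {G : Coord d → Matrix (SIdx d) (SIdx d) ℝ} {z : Coord d}
    (hG : ∀ α β, G z α β = G z β α) (D : SIdx d → Matrix (SIdx d) (SIdx d) ℝ)
    (hD : ∀ α β γ, pd α (fun z' => G z' β γ) z = D α β γ) :
    ip (hess G u z) X Y = ip (Matrix.of fun α β => pd α (pd β u) z) X Y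
      - 1 / 2 * (tri D X (grad G u z) Y + tri D Y (grad G u z) X - tri D (grad G u z) X Y) := by
  have h : hess G u z = (Matrix.of fun α β => pd α (pd β u) z) -
      Matrix.of fun α β => 1 / 2 * ∑ ν, grad G u z ν * (D α ν β + D β ν α - D ν α β) := by
    ext α β
    simp only [hess, covD, Matrix.of_apply, Matrix.sub_apply]
    rw [sum_christoffel u hG D hD]
  rw [h, ip_sub_form]
  congr 1
  set F := grad G u z
  have e1 : tri D X F Y = ∑ α, ∑ β, ∑ ν, F ν * D α ν β * X α * Y β := by
    simp only [tri, ip, Finset.mul_sum]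
    refine Finset.sum_congr rfl fun α _ => ?_
    rw [Finset.sum_comm]
    refine Finset.sum_congr rfl fun β _ => Finset.sum_congr rfl fun ν _ => by ring
  have e2 : tri D Y F X = ∑ α, ∑ β, ∑ ν, F ν * D β ν α * X α * Y β := by
    simp only [tri, ip, Finset.mul_sum]
    rw [Finset.sum_comm (s := Finset.univ (α := SIdx d))]
    have : ∀ β : SIdx d, (∑ ν : SIdx d, ∑ α : SIdx d, Y β * (D β ν α * F ν * X α)) =
        ∑ α, ∑ ν, F ν * D β ν α * X α * Y β := fun β => by
      rw [Finset.sum_comm]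
      exact Finset.sum_congr rfl fun α _ => Finset.sum_congr rfl fun ν _ => by ring
    rw [Finset.sum_comm (s := Finset.univ (α := SIdx d))]
    rw [Finset.sum_congr rfl fun β _ => this β, Finset.sum_comm]
  have e3 : tri D F X Y = ∑ α, ∑ β, ∑ ν, F ν * D ν α β * X α * Y β := by
    simp only [tri, ip, Finset.mul_sum]
    rw [Finset.sum_comm]
    refine Finset.sum_congr rfl fun α _ => ?_
    rw [Finset.sum_comm]
    refine Finset.sum_congr rfl fun β _ => Finset.sum_congr rfl fun ν _ => by ring
  rw [e1, e2, e3]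
  simp only [ip, Matrix.of_apply, ← Finset.sum_add_distrib, ← Finset.sum_sub_distrib,
    Finset.mul_sum, Finset.sum_mul]
  refine Finset.sum_congr rfl fun α _ => Finset.sum_congr rfl fun β _ =>
    Finset.sum_congr rfl fun ν _ => by ring

end Forms

/-! ### Pointwise estimates -/

section Pointwise

variable {d : ℕ}

/-- The coordinate vector `∂_ρ`. -/
def eR : SIdx d → ℝ := Pi.single none 1

/-- The coordinate vector `∂_t`. -/
def eT : SIdx d → ℝ := Pi.single (some none) 1

@[simp] theorem eR_rho : (eR : SIdx d → ℝ) none = 1 := by simp [eR]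
@[simp] theorem eR_tim : (eR : SIdx d → ℝ) (some none) = 0 := by simp [eR]
@[simp] theorem eT_rho : (eT : SIdx d → ℝ) none = 0 := by simp [eT]
@[simp] theorem eT_tim : (eT : SIdx d → ℝ) (some none) = 1 := by simp [eT]

theorem norm_eR : ‖(eR : SIdx d → ℝ)‖ ≤ 1 := by
  refine (pi_norm_le_iff_of_nonneg zero_le_one).2 fun i => ?_
  unfold eR
  rw [Pi.single_apply]; split_ifs <;> simp

theorem norm_eT : ‖(eT : SIdx d → ℝ)‖ ≤ 1 := by
  refine (pi_norm_le_iff_of_nonneg zero_le_one).2 fun i => ?_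
  unfold eT
  rw [Pi.single_apply]; split_ifs <;> simp

/-- The values at a point of the components of the metric `ρ⁻² A + B + ρ R`, where `P = B + ρ R`,
together with the first derivatives `dA`, `dP` of `A` and `P`, with bounds in terms of `C`. -/
structure PointData (C ρ : ℝ) (A B R P : Matrix (SIdx d) (SIdx d) ℝ)
    (dA dP : SIdx d → Matrix (SIdx d) (SIdx d) ℝ) : Prop where
  one_le : 1 ≤ C
  ρ_pos : 0 < ρ
  P_eq : P = B + ρ • R
  A_symm : ∀ α β, A α β = A β α
  P_symm : ∀ α β, P α β = P β α
  dA_symm : ∀ μ α β, dA μ α β = dA μ β α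
  dP_symm : ∀ μ α β, dP μ α β = dP μ β α
  A_rho : ∀ X, ip A eR X = X none
  A_tim : ∀ X, ip A eT X = -X (some none)
  P_rho : ∀ X, ip P eR X = 0
  dA_none : ∀ X Y, tri dA eR X Y = 0
  dA_rho : ∀ Z X, tri dA Z eR X = 0
  dA_tim : ∀ Z X, tri dA Z eT X = 0
  dP_rho : ∀ Z X, tri dP Z eR X = 0
  P_le : ∀ X Y, |ip P X Y| ≤ C * (‖X‖ * ‖Y‖)
  R_le : ∀ X Y, |ip R X Y| ≤ C * (‖X‖ * ‖Y‖)
  dA_le : ∀ Z X Y, |tri dA Z X Y| ≤ C * (‖Z‖ * (‖X‖ * ‖Y‖))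
  dP_le : ∀ Z X Y, |tri dP Z X Y| ≤ C * (‖Z‖ * (‖X‖ * ‖Y‖))
  coercive : ∀ X, ‖X‖ ^ 2 ≤ C * (ip A X X + 2 * X (some none) ^ 2)

variable {C ρ : ℝ} {A B R P : Matrix (SIdx d) (SIdx d) ℝ}
  {dA dP : SIdx d → Matrix (SIdx d) (SIdx d) ℝ}

/-- The reflection of a vector in the `t`-direction. -/
def reflT (X : SIdx d → ℝ) : SIdx d → ℝ := X - (2 * X (some none)) • eT

theorem norm_reflT (X : SIdx d → ℝ) : ‖reflT X‖ ≤ 3 * ‖X‖ := by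
  unfold reflT
  refine (norm_sub_le _ _).trans ?_
  rw [norm_smul, Real.norm_eq_abs, abs_mul, abs_two]
  have h1 : |X (some none)| ≤ ‖X‖ := norm_le_pi_norm X _
  nlinarith [norm_eT (d := d), norm_nonneg (eT : SIdx d → ℝ), abs_nonneg (X (some none))]

namespace PointData

variable (h : PointData C ρ A B R P dA dP)
include h

/-- Reflecting one argument in `t` turns the Lorentzian form `A` into a positive definite one. The
perturbation is at most `3 C ρ² ‖X‖²`, because reflection costs a factor 3, and the hypothesis on
`ρ` lets half of the left side absorb it. -/
theorem norm_sq_le (hρ : 6 * C ^ 2 * ρ ^ 2 ≤ 1) (X : SIdx d → ℝ) :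
    ‖X‖ ^ 2 ≤ 2 * C * (ip A X (reflT X) + ρ ^ 2 * ip P X (reflT X)) := by
  have h1 : ip A X (reflT X) = ip A X X + 2 * X (some none) ^ 2 := by
    unfold reflT
    rw [ip_sub_right, ip_smul_right, ip_comm X eT h.A_symm, h.A_tim]; ring
  have h2 := (abs_le.1 (h.P_le X (reflT X))).1
  have h3 := h.coercive X
  have h4 := norm_reflT X
  have hC := h.one_le
  have hX := norm_nonneg X
  have h5 : C * (‖X‖ * ‖reflT X‖) ≤ C * (‖X‖ * (3 * ‖X‖)) := by gcongr
  rw [h1]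
  have h6 : -(3 * C * ‖X‖ ^ 2) ≤ ip P X (reflT X) := by linarith
  have h7 : ρ ^ 2 * -(3 * C * ‖X‖ ^ 2) ≤ ρ ^ 2 * ip P X (reflT X) := by gcongr
  have h8 : C * (ρ ^ 2 * -(3 * C * ‖X‖ ^ 2)) ≤ C * (ρ ^ 2 * ip P X (reflT X)) := by gcongr
  have h9 := mul_le_mul_of_nonneg_right hρ (sq_nonneg ‖X‖)
  linarith

theorem isUnit_det (hρ : 6 * C ^ 2 * ρ ^ 2 ≤ 1) : IsUnit ((ρ ^ 2)⁻¹ • A + P).det := by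
  rw [← Matrix.isUnit_iff_isUnit_det, ← Matrix.mulVec_injective_iff_isUnit]
  have hρ0 := h.ρ_pos
  refine (injective_iff_map_eq_zero (Matrix.mulVecLin ((ρ ^ 2)⁻¹ • A + P))).2 fun X hX => ?_
  rw [Matrix.mulVecLin_apply] at hX
  have h1 : ip ((ρ ^ 2)⁻¹ • A + P) X (reflT X) = 0 := by
    rw [ip_comm, ip_eq_dotProduct, hX, dotProduct_zero]
    intro α β
    simp [h.A_symm α β, h.P_symm α β]
  rw [ip_add_form, ip_smul_form] at h1
  have h2 := h.norm_sq_le hρ X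
  have h3 : ip A X (reflT X) + ρ ^ 2 * ip P X (reflT X) = 0 := by
    field_simp at h1
    linarith
  rw [h3, mul_zero] at h2
  exact norm_eq_zero.1 (pow_eq_zero_iff two_ne_zero |>.1 (le_antisymm h2 (sq_nonneg _)))

/-- The vector field `∇t`, up to the factor `ρ²`. -/
theorem exists_dual (hρ : 6 * C ^ 2 * ρ ^ 2 ≤ 1) : ∃ j : SIdx d → ℝ,
    j none = 0 ∧ ‖j‖ ≤ 6 * C ^ 2 * ρ ^ 2 ∧
    ∀ X, ip A j X + ρ ^ 2 * ip P j X = ρ ^ 2 * ip P eT X := by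
  have hρ0 := h.ρ_pos
  set M := (ρ ^ 2)⁻¹ • A + P with hM
  have hs : ∀ α β, M α β = M β α := fun α β => by simp [hM, h.A_symm α β, h.P_symm α β]
  -- Since `A ∂_t = -dt`, the vector `j` with `(A + ρ²P) j = ρ² P ∂_t` satisfies `∇t = ρ² (j -
  -- ∂_t)`. Thus `j` is the deviation of the time gradient from that of the model, and it is
  -- `O(ρ²)`.
  have hj : ∀ X, ip M (M⁻¹.mulVec (P.mulVec eT)) X = ip P eT X := fun X => by
    rw [ip_comm _ _ hs, ip_eq_dotProduct, Matrix.mulVec_mulVec,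
      Matrix.mul_nonsing_inv _ (h.isUnit_det hρ), Matrix.one_mulVec, ← ip_eq_dotProduct,
      ip_comm _ _ h.P_symm]
  generalize M⁻¹.mulVec (P.mulVec eT) = j at hj
  have hj' : ∀ X, ip A j X + ρ ^ 2 * ip P j X = ρ ^ 2 * ip P eT X := fun X => by
    have := hj X
    rw [hM, ip_add_form, ip_smul_form] at this
    rw [← this]
    field_simp
  refine ⟨j, ?_, ?_, hj'⟩
  · have := hj' eR
    rw [ip_comm j eR h.A_symm, ip_comm j eR h.P_symm, ip_comm eT eR h.P_symm, h.A_rho, h.P_rho,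
      h.P_rho] at this
    simpa using this
  · have h1 := h.norm_sq_le hρ j
    rw [hj'] at h1
    have h2 := (abs_le.1 (h.P_le eT (reflT j))).2
    have hC := h.one_le
    have h3 : C * (‖(eT : SIdx d → ℝ)‖ * ‖reflT j‖) ≤ C * (1 * (3 * ‖j‖)) := by
      gcongr
      · exact norm_eT
      · exact norm_reflT j
    have h4 : 2 * C * (ρ ^ 2 * ip P eT (reflT j)) ≤ 2 * C * (ρ ^ 2 * (C * (1 * (3 * ‖j‖)))) := by
      gcongr; linarith
    by_contra hcon
    push Not at hcon
    have h5 : 0 < ‖j‖ := lt_of_le_of_lt (by positivity) hcon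
    nlinarith

end PointData

/-- The second derivatives of `f = ρ / η` as a bilinear form, in terms of `f`, `ρ`, and the first
two derivatives of `η`. -/
def secondF (f ρ η₁ η₂ : ℝ) (X Y : SIdx d → ℝ) : ℝ :=
  -(f ^ 2 * η₁ / ρ ^ 2) * (X none * Y (some none) + X (some none) * Y none)
    + (-(f ^ 2 * η₂ / ρ) + 2 * f ^ 3 * η₁ ^ 2 / ρ ^ 2) * (X (some none) * Y (some none))

/-- The derivative of the metric. -/
def triG (ρ : ℝ) (A : Matrix (SIdx d) (SIdx d) ℝ) (dA dP : SIdx d → Matrix (SIdx d) (SIdx d) ℝ)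
    (Z X Y : SIdx d → ℝ) : ℝ :=
  (ρ ^ 2)⁻¹ * tri dA Z X Y + tri dP Z X Y - 2 * (ρ ^ 3)⁻¹ * Z none * ip A X Y

/-- The gradient of `f`. -/
def gradF (f ρ η₁ : ℝ) (j : SIdx d → ℝ) : SIdx d → ℝ :=
  (ρ * f) • eR - (ρ * f ^ 2 * η₁) • (j - eT)

/-- The Hessian of `f`. -/
def hessF (f ρ η₁ η₂ : ℝ) (A : Matrix (SIdx d) (SIdx d) ℝ)
    (dA dP : SIdx d → Matrix (SIdx d) (SIdx d) ℝ) (j X Y : SIdx d → ℝ) : ℝ :=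
  secondF f ρ η₁ η₂ X Y - 1 / 2 * (triG ρ A dA dP X (gradF f ρ η₁ j) Y
    + triG ρ A dA dP Y (gradF f ρ η₁ j) X - triG ρ A dA dP (gradF f ρ η₁ j) X Y)

/-- The square of the gradient of `f`. -/
def sqF (f η₁ : ℝ) (j : SIdx d → ℝ) : ℝ := f ^ 2 * (1 + f ^ 2 * η₁ ^ 2 * (j (some none) - 1))

/-- The differential of `f`. -/
def dF (f ρ η₁ : ℝ) (X : SIdx d → ℝ) : ℝ :=
  f / ρ * X none - f ^ 2 * η₁ / ρ * X (some none)

namespace PointData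

variable (h : PointData C ρ A B R P dA dP) {f η₁ η₂ : ℝ} {j : SIdx d → ℝ}
include h

/-- Checking duality with `df` characterizes the gradient through nondegeneracy, so no entry of the
inverse metric has to be computed. -/
theorem ip_gradF (hj : ∀ X, ip A j X + ρ ^ 2 * ip P j X = ρ ^ 2 * ip P eT X) (X : SIdx d → ℝ) :
    ip ((ρ ^ 2)⁻¹ • A + P) (gradF f ρ η₁ j) X = dF f ρ η₁ X := by
  have hρ0 := h.ρ_pos.ne'
  unfold gradF dF
  have := hj X
  simp only [ip_add_form, ip_smul_form, ip_sub_left, ip_smul_left, h.A_rho, h.P_rho, h.A_tim]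
  field_simp
  linear_combination (-(f ^ 2 * η₁)) * this

theorem dF_gradF (j0 : j none = 0) : dF f ρ η₁ (gradF f ρ η₁ j) = sqF f η₁ j := by
  have hρ0 := h.ρ_pos.ne'
  simp only [dF, gradF, sqF, Pi.sub_apply, Pi.smul_apply, smul_eq_mul, eR_rho, eR_tim, eT_rho,
    eT_tim, j0]
  field_simp
  ring

/-- Two cancellations make this identity useful. On tangent vectors the mixed and the `η'²` parts of
the coordinate second derivatives of `f` cancel. The derivative of `ρ⁻²` along the `∂_ρ`-part of
`∇f` produces `-f ρ⁻² A`, which the added multiple of the metric removes. The last two lines will be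
errors. -/
theorem hessF_tangent (j0 : j none = 0)
    (hj : ∀ X, ip A j X + ρ ^ 2 * ip P j X = ρ ^ 2 * ip P eT X) (X : SIdx d → ℝ)
    (hX : X none = f * η₁ * X (some none)) :
    hessF f ρ η₁ η₂ A dA dP j X X + f * ip ((ρ ^ 2)⁻¹ • A + P) X X =
      -(f ^ 2 * η₂ / ρ) * X (some none) ^ 2 + f * ip B X X
        + 1 / 2 * (f ^ 2 * η₁ / ρ) * tri dA eT X X
        + f * ρ * (1 / 2 * tri dP eR X X + ip R X X)
        + f ^ 2 * η₁ / ρ * (tri dA X j X - 1 / 2 * tri dA j X X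
          + ρ ^ 2 * (tri dP X j X - tri dP X eT X - 1 / 2 * (tri dP j X X - tri dP eT X X))
          + 2 * ρ * X none * (ip P j X - ip P eT X)) := by
  have hρ0 := h.ρ_pos.ne'
  have hP : ip P X X = ip B X X + ρ * ip R X X := by rw [h.P_eq, ip_add_form, ip_smul_form]
  have hA := hj X
  simp only [hessF, triG, secondF, gradF, ip_add_form, ip_smul_form, ip_sub_left, ip_smul_left,
    tri_sub₁, tri_sub₂, tri_smul₁, tri_smul₂, h.A_rho, h.A_tim, h.dA_none, h.dA_rho, h.dA_tim,
    h.dP_rho, Pi.sub_apply, Pi.smul_apply, smul_eq_mul, eR_rho, eT_rho, j0]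
  have hA' : ip A j X = ρ ^ 2 * ip P eT X - ρ ^ 2 * ip P j X := by linarith
  rw [hA', hP, hX]
  field_simp
  ring

/-- This is `∇²f(∇f, ·) = ½ d|∇f|²` written out. The part not proportional to `df` is of order `f⁴`.
-/
theorem hessF_gradF (j0 : j none = 0)
    (hj : ∀ X, ip A j X + ρ ^ 2 * ip P j X = ρ ^ 2 * ip P eT X) (Y : SIdx d → ℝ) :
    hessF f ρ η₁ η₂ A dA dP j (gradF f ρ η₁ j) Y =
      f * (1 + 2 * f ^ 2 * η₁ ^ 2 * (j (some none) - 1)) * dF f ρ η₁ Y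
        + f ^ 4 * (η₂ * η₁ * (j (some none) - 1) * Y (some none)
          - 1 / 2 * η₁ ^ 2 * (tri dA Y j j + ρ ^ 2 * tri dP Y (j - eT) (j - eT)
            + 2 * ρ * Y none * ip P (j - eT) (j - eT))) := by
  have hρ0 := h.ρ_pos.ne'
  -- With `∇f` as first argument two of the three Koszul terms cancel, so this is the only
  -- derivative of the metric that matters.
  have s1 : triG ρ A dA dP Y (gradF f ρ η₁ j) (gradF f ρ η₁ j) =
      ρ ^ 2 * f ^ 4 * η₁ ^ 2 * ((ρ ^ 2)⁻¹ * tri dA Y j j + tri dP Y (j - eT) (j - eT))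
      - 2 * (ρ ^ 3)⁻¹ * Y none * (ρ ^ 2 * sqF f η₁ j
        - ρ ^ 4 * f ^ 4 * η₁ ^ 2 * ip P (j - eT) (j - eT)) := by
    have t1 : ∀ Z X, tri dA Z X eR = 0 := fun Z X => by rw [tri_comm _ _ _ h.dA_symm, h.dA_rho]
    have t2 : ∀ Z X, tri dA Z X eT = 0 := fun Z X => by rw [tri_comm _ _ _ h.dA_symm, h.dA_tim]
    have t3 : ∀ Z X, tri dP Z X eR = 0 := fun Z X => by rw [tri_comm _ _ _ h.dP_symm, h.dP_rho]
    have q1 := h.ip_gradF hj (gradF f ρ η₁ j) (f := f) (η₁ := η₁)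
    rw [h.dF_gradF j0, ip_add_form, ip_smul_form] at q1
    have t4 : ∀ X, ip P X eR = 0 := fun X => by rw [ip_comm _ _ h.P_symm, h.P_rho]
    have q2 : ip P (gradF f ρ η₁ j) (gradF f ρ η₁ j) =
        ρ ^ 2 * f ^ 4 * η₁ ^ 2 * ip P (j - eT) (j - eT) := by
      unfold gradF
      generalize j - eT = k
      simp only [ip_sub_left, ip_sub_right, ip_smul_left, ip_smul_right, h.P_rho, t4]
      ring
    have q3 : tri dA Y (gradF f ρ η₁ j) (gradF f ρ η₁ j) =
        ρ ^ 2 * f ^ 4 * η₁ ^ 2 * tri dA Y j j := by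
      rw [tri_comm _ _ _ h.dA_symm]
      unfold gradF
      simp only [tri_sub₂, tri_smul₂, h.dA_rho, h.dA_tim]
      rw [tri_comm _ _ _ h.dA_symm]
      simp only [tri_sub₂, tri_smul₂, h.dA_rho, h.dA_tim]
      ring
    have q4 : tri dP Y (gradF f ρ η₁ j) (gradF f ρ η₁ j) =
        ρ ^ 2 * f ^ 4 * η₁ ^ 2 * tri dP Y (j - eT) (j - eT) := by
      unfold gradF
      generalize j - eT = k
      rw [tri_sub₂, tri_smul₂, tri_smul₂, h.dP_rho, tri_comm _ _ _ h.dP_symm, tri_sub₂, tri_smul₂,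
        tri_smul₂, h.dP_rho]
      ring
    unfold triG
    rw [q3, q4]
    have q5 : ip A (gradF f ρ η₁ j) (gradF f ρ η₁ j) =
        ρ ^ 2 * (sqF f η₁ j - ip P (gradF f ρ η₁ j) (gradF f ρ η₁ j)) := by
      rw [← q1]; field_simp; ring
    rw [q5, q2]
    ring
  unfold hessF
  rw [s1]
  simp only [secondF, dF, sqF]
  have g1 : gradF f ρ η₁ j none = ρ * f := by simp [gradF, j0]
  have g2 : gradF f ρ η₁ j (some none) = -(ρ * f ^ 2 * η₁ * (j (some none) - 1)) := by simp [gradF]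
  rw [g1, g2]
  field_simp
  ring

end PointData

end Pointwise

/-! ### Estimates for the Hessian of `f` in tangential and normal directions -/

section Estimates

variable {d : ℕ}

/-- The values at a point of the scalar quantities that enter the estimates, with bounds. -/
structure ScalarData (C f ρ η η₁ η₂ ξ κ ζ w : ℝ) : Prop where
  f_pos : 0 < f
  f_mul : f * η = ρ
  ρ_le : ρ ≤ C * f
  small : 1000 * C ^ 10 * f ≤ 1
  η₁_le : |η₁| ≤ C
  η₂_le : |η₂| ≤ C
  ζ_le : |ζ| ≤ C
  ξ_nonneg : 0 ≤ ξ
  ξ_le : ξ ≤ C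
  η₂_eq : η₂ = ξ / 2 * |η₁| - κ * η
  w_eq : w = f - 1 / 2 * (f ^ 2 * ρ) * ξ * |η₁| + f * ρ ^ 2 * ζ

variable {C ρ : ℝ} {A B R P : Matrix (SIdx d) (SIdx d) ℝ}
  {dA dP : SIdx d → Matrix (SIdx d) (SIdx d) ℝ} {f η η₁ η₂ ξ κ ζ w K : ℝ} {j : SIdx d → ℝ}

/-- The positive definite form `dt² + γ`. -/
def posForm (A : Matrix (SIdx d) (SIdx d) ℝ) (X : SIdx d → ℝ) : ℝ :=
  ip A X X - X none ^ 2 + 2 * X (some none) ^ 2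

namespace ScalarData

variable (s : ScalarData C f ρ η η₁ η₂ ξ κ ζ w) (hC : 1 ≤ C)
include s hC

theorem pow_mul_le (k : ℕ) (hk : k ≤ 10 := by norm_num) : C ^ k * f ≤ 1 / 1000 := by
  have h1 : C ^ k ≤ C ^ 10 := pow_le_pow_right₀ hC hk
  have := mul_le_mul_of_nonneg_right h1 s.f_pos.le
  linarith [s.small]

theorem f_le : f ≤ 1 / 1000 := by simpa using s.pow_mul_le hC 0

theorem ρ_small : ρ ≤ 1 / 1000 := by simpa using s.ρ_le.trans (by simpa using s.pow_mul_le hC 1)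

theorem ρ_sq_le (hρ : 0 < ρ) : 6 * C ^ 2 * ρ ^ 2 ≤ 1 := by
  have h1 : C ^ 2 * ρ ≤ C ^ 2 * (C * f) := by gcongr; exact s.ρ_le
  have h2 := s.pow_mul_le hC 3
  have h3 := s.ρ_small hC
  nlinarith

end ScalarData

theorem ScalarData.abs_rho_le (s : ScalarData C f ρ η η₁ η₂ ξ κ ζ w) {X : SIdx d → ℝ}
    (hX : X none = f * η₁ * X (some none)) : |X none| ≤ f * C * |X (some none)| := by
  rw [hX, abs_mul, abs_mul, abs_of_pos s.f_pos]
  have := s.η₁_le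
  have := s.f_pos
  gcongr

namespace PointData

variable (h : PointData C ρ A B R P dA dP) (s : ScalarData C f ρ η η₁ η₂ ξ κ ζ w)
include h s

/-- The form `dt² + γ` ignores the `ρ`-component, but tangency makes that component a multiple of
`X^t` of size `C f`, which the coercivity of `A` absorbs. -/
theorem norm_sq_le_posForm {X : SIdx d → ℝ} (hX : X none = f * η₁ * X (some none)) :
    0 ≤ posForm A X ∧ ‖X‖ ^ 2 ≤ 2 * C * posForm A X := by
  have hC := h.one_le
  have h1 := h.coercive X
  have h2 := s.abs_rho_le hX
  have h3 := norm_le_pi_norm X none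
  have h4 := norm_le_pi_norm X (some none)
  rw [Real.norm_eq_abs] at h3 h4
  have h5 : X none ^ 2 ≤ (f * C * ‖X‖) ^ 2 := by
    rw [← sq_abs]
    have := s.f_pos
    gcongr
    exact h2.trans (by gcongr)
  have h7 : C * (f * C * ‖X‖) ^ 2 ≤ 1 / 2 * ‖X‖ ^ 2 := by
    have h8 : C * (f * C) ^ 2 ≤ 1 / 2 := by
      have e1 := s.pow_mul_le hC 3
      have e2 := s.f_le hC
      have e3 : (C ^ 3 * f) * f ≤ 1 / 1000 * (1 / 1000) := by
        have := s.f_pos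
        gcongr
      linarith
    calc C * (f * C * ‖X‖) ^ 2 = C * (f * C) ^ 2 * ‖X‖ ^ 2 := by ring
      _ ≤ _ := by gcongr
  have h6 : C * X none ^ 2 ≤ C * (f * C * ‖X‖) ^ 2 := by gcongr
  have h9 : ‖X‖ ^ 2 ≤ 2 * C * posForm A X := by unfold posForm; linarith
  refine ⟨?_, h9⟩
  by_contra hn
  push Not at hn
  nlinarith [sq_nonneg ‖X‖]

/-- The first group carries `f ρ ≤ C f²`. In the second, the prefactor `f²/ρ` is harmless because
the bracket is `O(ρ f)`: the terms in `dA` contain `j = O(ρ²)`, those in `dP` carry `ρ²`, and the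
last one has `ρ X^ρ` with `X^ρ = O(f)`. -/
theorem hessF_tangent_error (hj1 : ‖j‖ ≤ 6 * C ^ 2 * ρ ^ 2) {X : SIdx d → ℝ}
    (hX : X none = f * η₁ * X (some none)) :
    |f * ρ * (1 / 2 * tri dP eR X X + ip R X X)
        + f ^ 2 * η₁ / ρ * (tri dA X j X - 1 / 2 * tri dA j X X
          + ρ ^ 2 * (tri dP X j X - tri dP X eT X - 1 / 2 * (tri dP j X X - tri dP eT X X))
          + 2 * ρ * X none * (ip P j X - ip P eT X))| ≤ 18 * C ^ 5 * f ^ 2 * ‖X‖ ^ 2 := by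
  have hC := h.one_le
  have hρ := h.ρ_pos
  have hf := s.f_pos
  have hρf := s.ρ_le
  have hN := norm_nonneg X
  have hj2 : ‖j‖ ≤ 1 := hj1.trans (s.ρ_sq_le hC hρ)
  have heT := norm_eT (d := d)
  have heR := norm_eR (d := d)
  have b1 : |tri dP eR X X| ≤ C * ‖X‖ ^ 2 := (h.dP_le _ _ _).trans <| by
    calc C * (‖(eR : SIdx d → ℝ)‖ * (‖X‖ * ‖X‖)) ≤ C * (1 * (‖X‖ * ‖X‖)) := by gcongr
      _ = _ := by ring
  have b2 : |ip R X X| ≤ C * ‖X‖ ^ 2 := (h.R_le _ _).trans (by rw [sq])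
  have c1 : |tri dA X j X| ≤ 6 * C ^ 3 * ρ ^ 2 * ‖X‖ ^ 2 := (h.dA_le _ _ _).trans <| by
    calc C * (‖X‖ * (‖j‖ * ‖X‖)) ≤ C * (‖X‖ * ((6 * C ^ 2 * ρ ^ 2) * ‖X‖)) := by gcongr
      _ = _ := by ring
  have c2 : |tri dA j X X| ≤ 6 * C ^ 3 * ρ ^ 2 * ‖X‖ ^ 2 := (h.dA_le _ _ _).trans <| by
    calc C * (‖j‖ * (‖X‖ * ‖X‖)) ≤ C * ((6 * C ^ 2 * ρ ^ 2) * (‖X‖ * ‖X‖)) := by gcongr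
      _ = _ := by ring
  have c3 : |tri dP X j X| ≤ C * ‖X‖ ^ 2 := (h.dP_le _ _ _).trans <| by
    calc C * (‖X‖ * (‖j‖ * ‖X‖)) ≤ C * (‖X‖ * (1 * ‖X‖)) := by gcongr
      _ = _ := by ring
  have c4 : |tri dP X eT X| ≤ C * ‖X‖ ^ 2 := (h.dP_le _ _ _).trans <| by
    calc C * (‖X‖ * (‖(eT : SIdx d → ℝ)‖ * ‖X‖)) ≤ C * (‖X‖ * (1 * ‖X‖)) := by gcongr
      _ = _ := by ring
  have c5 : |tri dP j X X| ≤ C * ‖X‖ ^ 2 := (h.dP_le _ _ _).trans <| by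
    calc C * (‖j‖ * (‖X‖ * ‖X‖)) ≤ C * (1 * (‖X‖ * ‖X‖)) := by gcongr
      _ = _ := by ring
  have c6 : |tri dP eT X X| ≤ C * ‖X‖ ^ 2 := (h.dP_le _ _ _).trans <| by
    calc C * (‖(eT : SIdx d → ℝ)‖ * (‖X‖ * ‖X‖)) ≤ C * (1 * (‖X‖ * ‖X‖)) := by gcongr
      _ = _ := by ring
  have c7 : |ip P j X| ≤ C * ‖X‖ := (h.P_le _ _).trans <| by
    calc C * (‖j‖ * ‖X‖) ≤ C * (1 * ‖X‖) := by gcongr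
      _ = _ := by ring
  have c8 : |ip P eT X| ≤ C * ‖X‖ := (h.P_le _ _).trans <| by
    calc C * (‖(eT : SIdx d → ℝ)‖ * ‖X‖) ≤ C * (1 * ‖X‖) := by gcongr
      _ = _ := by ring
  have c9 : |X none| ≤ f * C * ‖X‖ := (s.abs_rho_le hX).trans <| by
    have := norm_le_pi_norm X (some none)
    rw [Real.norm_eq_abs] at this
    gcongr
  have e1 : |f * ρ * (1 / 2 * tri dP eR X X + ip R X X)| ≤ f * (C * f) * (3 / 2 * C * ‖X‖ ^ 2) := by
    rw [abs_mul, abs_of_pos (by positivity : 0 < f * ρ)]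
    have : |1 / 2 * tri dP eR X X + ip R X X| ≤ 3 / 2 * C * ‖X‖ ^ 2 := by
      rw [abs_le] at *
      constructor <;> linarith
    gcongr
  have e2 : |ρ ^ 2 * (tri dP X j X - tri dP X eT X - 1 / 2 * (tri dP j X X - tri dP eT X X))| ≤
      ρ ^ 2 * (3 * (C * ‖X‖ ^ 2)) := by
    rw [abs_mul, abs_of_pos (by positivity : 0 < ρ ^ 2)]
    have : |tri dP X j X - tri dP X eT X - 1 / 2 * (tri dP j X X - tri dP eT X X)| ≤
        3 * (C * ‖X‖ ^ 2) := by
      rw [abs_le] at *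
      constructor <;> linarith
    gcongr
  have e3 : |2 * ρ * X none * (ip P j X - ip P eT X)| ≤ 2 * ρ * (f * C * ‖X‖) * (2 * (C * ‖X‖)) := by
    rw [abs_mul, abs_mul, abs_of_pos (by positivity : 0 < 2 * ρ)]
    have : |ip P j X - ip P eT X| ≤ 2 * (C * ‖X‖) := (abs_sub _ _).trans (by linarith)
    gcongr
  have e4 : |tri dA X j X - 1 / 2 * tri dA j X X
          + ρ ^ 2 * (tri dP X j X - tri dP X eT X - 1 / 2 * (tri dP j X X - tri dP eT X X))
          + 2 * ρ * X none * (ip P j X - ip P eT X)| ≤ ρ * (16 * C ^ 4 * f * ‖X‖ ^ 2) := by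
    have u1 : 9 * C ^ 3 * ρ ^ 2 * ‖X‖ ^ 2 ≤ 9 * C ^ 4 * (ρ * f) * ‖X‖ ^ 2 := by
      calc 9 * C ^ 3 * ρ ^ 2 * ‖X‖ ^ 2 = 9 * C ^ 3 * ρ * ρ * ‖X‖ ^ 2 := by ring
        _ ≤ 9 * C ^ 3 * ρ * (C * f) * ‖X‖ ^ 2 := by gcongr
        _ = _ := by ring
    have u2 : ρ ^ 2 * (3 * (C * ‖X‖ ^ 2)) ≤ 3 * C ^ 4 * (ρ * f) * ‖X‖ ^ 2 := by
      calc ρ ^ 2 * (3 * (C * ‖X‖ ^ 2)) = 3 * C * ρ * ρ * ‖X‖ ^ 2 := by ring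
        _ ≤ 3 * C * ρ * (C * f) * ‖X‖ ^ 2 := by gcongr
        _ = 3 * C ^ 2 * (ρ * f) * ‖X‖ ^ 2 := by ring
        _ ≤ _ := by gcongr; norm_num
    have u3 : 2 * ρ * (f * C * ‖X‖) * (2 * (C * ‖X‖)) ≤ 4 * C ^ 4 * (ρ * f) * ‖X‖ ^ 2 := by
      calc 2 * ρ * (f * C * ‖X‖) * (2 * (C * ‖X‖)) = 4 * C ^ 2 * (ρ * f) * ‖X‖ ^ 2 := by ring
        _ ≤ _ := by gcongr; norm_num
    rw [abs_le] at *
    constructor <;> linarith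
  have e5 : |f ^ 2 * η₁ / ρ * (tri dA X j X - 1 / 2 * tri dA j X X
          + ρ ^ 2 * (tri dP X j X - tri dP X eT X - 1 / 2 * (tri dP j X X - tri dP eT X X))
          + 2 * ρ * X none * (ip P j X - ip P eT X))| ≤ f ^ 2 * C * (16 * C ^ 4 * f * ‖X‖ ^ 2) := by
    rw [abs_mul, abs_div, abs_mul, abs_of_pos (by positivity : 0 < f ^ 2), abs_of_pos hρ]
    have := s.η₁_le
    calc _ ≤ f ^ 2 * C / ρ * (ρ * (16 * C ^ 4 * f * ‖X‖ ^ 2)) := by gcongr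
      _ = _ := by field_simp
  refine (abs_add_le _ _).trans ((add_le_add e1 e5).trans ?_)
  have v1 : f * (C * f) * (3 / 2 * C * ‖X‖ ^ 2) ≤ 3 / 2 * C ^ 5 * f ^ 2 * ‖X‖ ^ 2 := by
    calc f * (C * f) * (3 / 2 * C * ‖X‖ ^ 2) = 3 / 2 * C ^ 2 * f ^ 2 * ‖X‖ ^ 2 := by ring
      _ ≤ _ := by gcongr; norm_num
  have v2 : f ^ 2 * C * (16 * C ^ 4 * f * ‖X‖ ^ 2) ≤ 16 * C ^ 5 * f ^ 2 * ‖X‖ ^ 2 := by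
    calc f ^ 2 * C * (16 * C ^ 4 * f * ‖X‖ ^ 2) = 16 * C ^ 5 * f ^ 2 * ‖X‖ ^ 2 * f := by ring
      _ ≤ 16 * C ^ 5 * f ^ 2 * ‖X‖ ^ 2 * 1 := by
        gcongr
        linarith [s.f_le hC]
      _ = _ := by ring
  have v3 : 0 ≤ C ^ 5 * f ^ 2 * ‖X‖ ^ 2 := by positivity
  linarith

/-- The corrections in `w` carry `f² ρ` and `f ρ²`, so they are negligible unless multiplied by the
singular part `ρ⁻² A` of the metric. -/
theorem abs_w_sub_le : |w - f| ≤ 2 * C ^ 3 * f ^ 3 := by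
  have hC := h.one_le
  have hρ := h.ρ_pos
  have hf := s.f_pos
  have b1 := s.ξ_le
  have b2 := s.η₁_le
  have b3 := s.ξ_nonneg
  have b4 := s.ρ_le
  have b5 := s.ζ_le
  have e : w - f = -(1 / 2 * (f ^ 2 * ρ) * ξ * |η₁|) + f * ρ ^ 2 * ζ := by rw [s.w_eq]; ring
  rw [e]
  refine (abs_add_le _ _).trans ?_
  rw [abs_neg, abs_of_nonneg (by positivity : 0 ≤ 1 / 2 * (f ^ 2 * ρ) * ξ * |η₁|),
    abs_mul (f * ρ ^ 2), abs_of_pos (by positivity : 0 < f * ρ ^ 2)]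
  calc 1 / 2 * (f ^ 2 * ρ) * ξ * |η₁| + f * ρ ^ 2 * |ζ|
      ≤ 1 / 2 * (f ^ 2 * (C * f)) * C * C + f * (C * f) ^ 2 * C := by gcongr
    _ = 3 / 2 * C ^ 3 * f ^ 3 := by ring
    _ ≤ _ := by gcongr; norm_num

/-- This is where the hypotheses at the boundary enter. Through `ρ⁻² A`, the corrections in `w`
contribute at the same order as the terms left in `hessF_tangent`: the `ξ`-part pays for the time
derivative of `γ`, and the `ζ`-part supplies the free multiple of the boundary metric in the
positivity condition. -/
theorem hessF_add_le (hj0 : j none = 0) (hj1 : ‖j‖ ≤ 6 * C ^ 2 * ρ ^ 2)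
    (hj : ∀ X, ip A j X + ρ ^ 2 * ip P j X = ρ ^ 2 * ip P eT X) {X : SIdx d → ℝ}
    (hX : X none = f * η₁ * X (some none))
    (hns : |tri dA eT X X| ≤ ξ * (posForm A X - X (some none) ^ 2))
    (hpos : K * posForm A X ≤ -ip B X X - κ * X (some none) ^ 2
      - ζ * (posForm A X - 2 * X (some none) ^ 2)) :
    hessF f ρ η₁ η₂ A dA dP j X X + w * ip ((ρ ^ 2)⁻¹ • A + P) X X ≤
      -(f * (K - 42 * C ^ 6 * f) * posForm A X) := by
  have hC := h.one_le
  have hρ := h.ρ_pos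
  have hf := s.f_pos
  have hf1 := s.f_le hC
  have hN := norm_nonneg X
  have hρf := s.ρ_le
  have herr := (abs_le.1 (h.hessF_tangent_error s hj1 hX)).2
  have heq := h.hessF_tangent (f := f) (η₂ := η₂) hj0 hj X hX
  set H := hessF f ρ η₁ η₂ A dA dP j X X with hH
  set E := f * ρ * (1 / 2 * tri dP eR X X + ip R X X)
        + f ^ 2 * η₁ / ρ * (tri dA X j X - 1 / 2 * tri dA j X X
          + ρ ^ 2 * (tri dP X j X - tri dP X eT X - 1 / 2 * (tri dP j X X - tri dP eT X X))
          + 2 * ρ * X none * (ip P j X - ip P eT X)) with hE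
  set h0 := posForm A X with hh0
  obtain ⟨h00, hN2⟩ := h.norm_sq_le_posForm s hX
  have hA : ip A X X = h0 + X none ^ 2 - 2 * X (some none) ^ 2 := by
    rw [hh0, posForm]; ring
  -- the exact expression
  have key : H + w * ip ((ρ ^ 2)⁻¹ • A + P) X X =
      f * (ip B X X + κ * X (some none) ^ 2 + ζ * (h0 - 2 * X (some none) ^ 2))
      + f ^ 2 / ρ * (1 / 2 * (η₁ * tri dA eT X X - ξ * |η₁| * (h0 - X (some none) ^ 2))
        - 1 / 2 * ξ * |η₁| * X none ^ 2)
      + E + f * ζ * X none ^ 2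
      + (-(1 / 2) * (f ^ 2 * ρ) * ξ * |η₁| + f * ρ ^ 2 * ζ) * ip P X X := by
    have heq' : H = -(f ^ 2 * η₂ / ρ) * X (some none) ^ 2 + f * ip B X X
        + 1 / 2 * (f ^ 2 * η₁ / ρ) * tri dA eT X X + E - f * ip ((ρ ^ 2)⁻¹ • A + P) X X := by
      linarith
    have hη : η = ρ / f := by rw [← s.f_mul]; field_simp
    rw [heq', s.w_eq, s.η₂_eq, ip_add_form, ip_smul_form, hA, hη]
    field_simp
    ring
  rw [key]
  have t1 : f * (ip B X X + κ * X (some none) ^ 2 + ζ * (h0 - 2 * X (some none) ^ 2)) ≤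
      f * (-(K * h0)) := by gcongr; linarith
  -- The difference of `posForm` and `(X^t)²` is `γ(X,X)`, so the bound on the time derivative of
  -- `γ` gives this bracket a sign. No smallness is available, since `f²/ρ` is not small relative to
  -- `f`.
  have t2 : f ^ 2 / ρ * (1 / 2 * (η₁ * tri dA eT X X - ξ * |η₁| * (h0 - X (some none) ^ 2))
        - 1 / 2 * ξ * |η₁| * X none ^ 2) ≤ 0 := by
    have hξ := s.ξ_nonneg
    have a1 : η₁ * tri dA eT X X ≤ |η₁| * (ξ * (h0 - X (some none) ^ 2)) := by
      refine (le_abs_self _).trans ?_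
      rw [abs_mul]
      gcongr
    have a2 : 0 ≤ 1 / 2 * ξ * |η₁| * X none ^ 2 := by positivity
    refine mul_nonpos_of_nonneg_of_nonpos (by positivity) ?_
    linarith
  have hζ := s.ζ_le
  have t3 : f * ζ * X none ^ 2 ≤ C ^ 5 * f ^ 2 * ‖X‖ ^ 2 := by
    have a1 : |X none| ≤ f * C * ‖X‖ := (s.abs_rho_le hX).trans <| by
      have := norm_le_pi_norm X (some none)
      rw [Real.norm_eq_abs] at this
      gcongr
    have a2 : X none ^ 2 ≤ (f * C * ‖X‖) ^ 2 := by rw [← sq_abs]; gcongr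
    calc f * ζ * X none ^ 2 ≤ f * C * (f * C * ‖X‖) ^ 2 := by
          gcongr; exact (le_abs_self _).trans hζ
      _ = C ^ 3 * f ^ 2 * ‖X‖ ^ 2 * f := by ring
      _ ≤ C ^ 5 * f ^ 2 * ‖X‖ ^ 2 * 1 := by
        gcongr
        · norm_num
        · linarith
      _ = _ := by ring
  have t4 : (-(1 / 2) * (f ^ 2 * ρ) * ξ * |η₁| + f * ρ ^ 2 * ζ) * ip P X X ≤
      2 * C ^ 5 * f ^ 2 * ‖X‖ ^ 2 := by
    refine (le_abs_self _).trans ?_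
    rw [abs_mul]
    have a1 : |-(1 / 2) * (f ^ 2 * ρ) * ξ * |η₁| + f * ρ ^ 2 * ζ| ≤ 2 * C ^ 3 * f ^ 3 := by
      have e : -(1 / 2) * (f ^ 2 * ρ) * ξ * |η₁| + f * ρ ^ 2 * ζ = w - f := by rw [s.w_eq]; ring
      rw [e]; exact h.abs_w_sub_le s
    calc _ ≤ 2 * C ^ 3 * f ^ 3 * (C * (‖X‖ * ‖X‖)) := by
          gcongr; exact h.P_le _ _
      _ = 2 * C ^ 4 * f ^ 2 * ‖X‖ ^ 2 * f := by ring
      _ ≤ 2 * C ^ 5 * f ^ 2 * ‖X‖ ^ 2 * 1 := by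
        gcongr
        · norm_num
        · linarith
      _ = _ := by ring
  -- The errors add up to `18 + 1 + 2 = 21`, and passing from the norm to `posForm` costs a factor
  -- `2 C`; hence the constant 42.
  have t5 : 21 * C ^ 5 * f ^ 2 * ‖X‖ ^ 2 ≤ 21 * C ^ 5 * f ^ 2 * (2 * C * h0) := by gcongr
  linarith

theorem gradF_bounds (hj1 : ‖j‖ ≤ 6 * C ^ 2 * ρ ^ 2) :
    |j (some none) - 1| ≤ 2 ∧ ‖j - eT‖ ≤ 2 ∧ ‖gradF f ρ η₁ j‖ ≤ 2 * C * f ^ 2 := by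
  have hC := h.one_le
  have hρ := h.ρ_pos
  have hf := s.f_pos
  have hρf := s.ρ_le
  have hj2 : ‖j‖ ≤ 1 := hj1.trans (s.ρ_sq_le hC hρ)
  have h1 : ‖j - eT‖ ≤ 2 := (norm_sub_le _ _).trans (by linarith [norm_eT (d := d)])
  refine ⟨?_, h1, ?_⟩
  · have := norm_le_pi_norm (j - eT) (some none)
    simp only [Pi.sub_apply, eT_tim, Real.norm_eq_abs] at this
    exact this.trans h1
  · unfold gradF
    refine (norm_sub_le _ _).trans ?_
    have h2 := s.η₁_le
    rw [norm_smul, norm_smul, Real.norm_eq_abs, Real.norm_eq_abs, abs_mul (ρ * f ^ 2),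
      abs_of_pos (by positivity : 0 < ρ * f), abs_of_pos (by positivity : 0 < ρ * f ^ 2)]
    calc _ ≤ C * f * f * 1 + C * f * f ^ 2 * C * 2 := by
          gcongr; exact norm_eR
      _ = C * f ^ 2 * (1 + 2 * (C * f)) := by ring
      _ ≤ C * f ^ 2 * 2 := by
        gcongr
        have := s.pow_mul_le hC 1
        linarith
      _ = _ := by ring

theorem abs_hessF_gradF_le (hj0 : j none = 0) (hj1 : ‖j‖ ≤ 6 * C ^ 2 * ρ ^ 2)
    (hj : ∀ X, ip A j X + ρ ^ 2 * ip P j X = ρ ^ 2 * ip P eT X) (Y : SIdx d → ℝ) :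
    |hessF f ρ η₁ η₂ A dA dP j (gradF f ρ η₁ j) Y
      - f * (1 + 2 * f ^ 2 * η₁ ^ 2 * (j (some none) - 1)) * dF f ρ η₁ Y| ≤
      9 * C ^ 3 * f ^ 4 * ‖Y‖ := by
  have hC := h.one_le
  have hρ := h.ρ_pos
  have hf := s.f_pos
  have hj2 : ‖j‖ ≤ 1 := hj1.trans (s.ρ_sq_le hC hρ)
  have hρ1 : ρ ≤ 1 := by linarith [s.ρ_small hC]
  obtain ⟨k1, k2, -⟩ := h.gradF_bounds s hj1
  rw [h.hessF_gradF hj0 hj, add_sub_cancel_left, abs_mul, abs_of_pos (by positivity : 0 < f ^ 4)]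
  have y0 : |Y none| ≤ ‖Y‖ := norm_le_pi_norm Y _
  have y1 : |Y (some none)| ≤ ‖Y‖ := norm_le_pi_norm Y _
  have h1 := s.η₁_le
  have h2 := s.η₂_le
  have b1 : |η₂ * η₁ * (j (some none) - 1) * Y (some none)| ≤ C * C * 2 * ‖Y‖ := by
    rw [abs_mul, abs_mul, abs_mul]; gcongr
  have b2 : |tri dA Y j j| ≤ C * ‖Y‖ := (h.dA_le _ _ _).trans <| by
    calc _ ≤ C * (‖Y‖ * (1 * 1)) := by gcongr
      _ = _ := by ring
  have b3 : |ρ ^ 2 * tri dP Y (j - eT) (j - eT)| ≤ 4 * (C * ‖Y‖) := by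
    rw [abs_mul, abs_of_pos (by positivity : 0 < ρ ^ 2)]
    calc _ ≤ 1 ^ 2 * (C * (‖Y‖ * (2 * 2))) := by
          gcongr
          refine (h.dP_le _ _ _).trans ?_
          gcongr
      _ = _ := by ring
  have b4 : |2 * ρ * Y none * ip P (j - eT) (j - eT)| ≤ 8 * (C * ‖Y‖) := by
    rw [abs_mul, abs_mul, abs_of_pos (by positivity : 0 < 2 * ρ)]
    calc _ ≤ 2 * 1 * ‖Y‖ * (C * (2 * 2)) := by
          gcongr
          refine (h.P_le _ _).trans ?_
          gcongr
      _ = _ := by ring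
  have b5 : |1 / 2 * η₁ ^ 2 * (tri dA Y j j + ρ ^ 2 * tri dP Y (j - eT) (j - eT)
            + 2 * ρ * Y none * ip P (j - eT) (j - eT))| ≤ 1 / 2 * C ^ 2 * (13 * (C * ‖Y‖)) := by
    rw [abs_mul, abs_mul, abs_pow, abs_of_pos (by norm_num : (0 : ℝ) < 1 / 2)]
    gcongr
    refine (abs_add_le _ _).trans ((add_le_add (abs_add_le _ _) le_rfl).trans ?_)
    linarith
  have b6 : C * C * 2 * ‖Y‖ ≤ 2 * C ^ 3 * ‖Y‖ := by
    calc C * C * 2 * ‖Y‖ = 2 * C ^ 2 * ‖Y‖ := by ring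
      _ ≤ _ := by gcongr; norm_num
  have b7 : 0 ≤ C ^ 3 * ‖Y‖ := by positivity
  calc _ ≤ f ^ 4 * (9 * C ^ 3 * ‖Y‖) := by
        gcongr
        refine (abs_sub _ _).trans ((add_le_add b1 b5).trans ?_)
        linarith
    _ = _ := by ring

theorem sqF_bounds (hj1 : ‖j‖ ≤ 6 * C ^ 2 * ρ ^ 2) :
    |f ^ 2 * η₁ ^ 2 * (j (some none) - 1)| ≤ 2 * C ^ 2 * f ^ 2 ∧ f ^ 2 / 2 ≤ sqF f η₁ j := by
  have hC := h.one_le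
  have hf := s.f_pos
  obtain ⟨k1, -, -⟩ := h.gradF_bounds s hj1
  have h1 := s.η₁_le
  have b1 : |f ^ 2 * η₁ ^ 2 * (j (some none) - 1)| ≤ 2 * C ^ 2 * f ^ 2 := by
    rw [abs_mul, abs_mul, abs_pow, abs_pow, abs_of_pos hf]
    calc _ ≤ f ^ 2 * C ^ 2 * 2 := by gcongr
      _ = _ := by ring
  refine ⟨b1, ?_⟩
  have b2 : 2 * C ^ 2 * f ^ 2 ≤ 1 / 2 := by
    have := s.pow_mul_le hC 1
    have h3 : (C ^ 1 * f) ^ 2 ≤ (1 / 1000) ^ 2 := by gcongr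
    linarith
  have b3 := (abs_le.1 b1).1
  have b4 : f ^ 2 * (1 / 2) ≤ f ^ 2 * (1 + f ^ 2 * η₁ ^ 2 * (j (some none) - 1)) := by
    gcongr; linarith
  unfold sqF; linarith

/-- In the unit normal direction the Hessian, `w` and the term `m |∇f|² / f` are `f`, `f` and `m f`
to leading order. For `m = n - 3` this is the coefficient `(n - 1) f`. -/
theorem hessF_normal_le (hj0 : j none = 0) (hj1 : ‖j‖ ≤ 6 * C ^ 2 * ρ ^ 2)
    (hj : ∀ X, ip A j X + ρ ^ 2 * ip P j X = ρ ^ 2 * ip P eT X) (m : ℝ) :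
    hessF f ρ η₁ η₂ A dA dP j (gradF f ρ η₁ j) (gradF f ρ η₁ j) / sqF f η₁ j + w
      + m / f * sqF f η₁ j ≤ (m + 2) * f + (42 + 2 * |m|) * C ^ 4 * f ^ 3 := by
  have hC := h.one_le
  have hf := s.f_pos
  obtain ⟨-, -, k3⟩ := h.gradF_bounds s hj1
  obtain ⟨b1, b2⟩ := h.sqF_bounds s hj1
  have h1 := h.abs_hessF_gradF_le s hj0 hj1 hj (gradF f ρ η₁ j)
  rw [h.dF_gradF hj0] at h1
  have hS : 0 < sqF f η₁ j := lt_of_lt_of_le (by positivity) b2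
  have h2 : hessF f ρ η₁ η₂ A dA dP j (gradF f ρ η₁ j) (gradF f ρ η₁ j) / sqF f η₁ j ≤
      f * (1 + 2 * (f ^ 2 * η₁ ^ 2 * (j (some none) - 1))) + 36 * C ^ 4 * f ^ 4 := by
    rw [div_le_iff₀ hS]
    have h3 : 9 * C ^ 3 * f ^ 4 * ‖gradF f ρ η₁ j‖ ≤ 36 * C ^ 4 * f ^ 4 * sqF f η₁ j := by
      calc _ ≤ 9 * C ^ 3 * f ^ 4 * (2 * C * f ^ 2) := by gcongr
        _ = 36 * C ^ 4 * f ^ 4 * (f ^ 2 / 2) := by ring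
        _ ≤ _ := by gcongr
    have := (abs_le.1 h1).2
    linarith
  have h3 := (abs_le.1 (h.abs_w_sub_le s)).2
  have h4 : m / f * sqF f η₁ j = m * f + f * (m * (f ^ 2 * η₁ ^ 2 * (j (some none) - 1))) := by
    unfold sqF; field_simp
  set x := f ^ 2 * η₁ ^ 2 * (j (some none) - 1)
  have h5 : m * x ≤ |m| * (2 * C ^ 2 * f ^ 2) := by
    refine (le_abs_self _).trans ?_
    rw [abs_mul]; gcongr
  have h6 : f * (m * x) ≤ f * (|m| * (2 * C ^ 2 * f ^ 2)) := by gcongr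
  have h7 : f * x ≤ f * (2 * C ^ 2 * f ^ 2) := by gcongr; exact (abs_le.1 b1).2
  have h8 : f * (2 * C ^ 2 * f ^ 2) ≤ 2 * C ^ 4 * f ^ 3 := by
    calc f * (2 * C ^ 2 * f ^ 2) = 2 * C ^ 2 * f ^ 3 := by ring
      _ ≤ _ := by gcongr; norm_num
  have h9 : 2 * C ^ 3 * f ^ 3 ≤ 2 * C ^ 4 * f ^ 3 := by
    gcongr; norm_num
  have h10 : 36 * C ^ 4 * f ^ 4 ≤ 36 * C ^ 4 * f ^ 3 := by
    gcongr 36 * C ^ 4 * ?_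
    calc f ^ 4 = f ^ 3 * f := by ring
      _ ≤ f ^ 3 * 1 := by gcongr; linarith [s.f_le hC]
      _ = _ := by ring
  have h11 : |m| * (f * (2 * C ^ 2 * f ^ 2)) ≤ |m| * (2 * C ^ 4 * f ^ 3) := by gcongr
  linarith

/-- The normal is orthogonal to `X` and `df(X) = 0`, so only the Hessian has a mixed term. Its
leading part `f df(X)` vanishes, and what remains is small enough to be divided between the two
squares. -/
theorem hessF_combined_le (hj0 : j none = 0) (hj1 : ‖j‖ ≤ 6 * C ^ 2 * ρ ^ 2)
    (hj : ∀ X, ip A j X + ρ ^ 2 * ip P j X = ρ ^ 2 * ip P eT X) {X : SIdx d → ℝ}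
    (hX : X none = f * η₁ * X (some none))
    (hns : |tri dA eT X X| ≤ ξ * (posForm A X - X (some none) ^ 2))
    (hpos : K * posForm A X ≤ -ip B X X - κ * X (some none) ^ 2
      - ζ * (posForm A X - 2 * X (some none) ^ 2)) (m a : ℝ) {H : Matrix (SIdx d) (SIdx d) ℝ}
    (hH : ∀ X Y, ip H X Y = hessF f ρ η₁ η₂ A dA dP j X Y) {Z : SIdx d → ℝ}
    (hZ : Z = a • (Real.sqrt (sqF f η₁ j))⁻¹ • gradF f ρ η₁ j + X) :
    ip H Z Z + w * ip ((ρ ^ 2)⁻¹ • A + P) Z Z + m / f * dF f ρ η₁ Z ^ 2 ≤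
      ((m + 2) * f + (78 + 2 * |m|) * C ^ 4 * f ^ 3) * a ^ 2
        - f * (K - 78 * C ^ 6 * f) * posForm A X := by
  have hC := h.one_le
  have hρ := h.ρ_pos
  have hf := s.f_pos
  obtain ⟨b1, b2⟩ := h.sqF_bounds s hj1
  have hS : 0 < sqF f η₁ j := lt_of_lt_of_le (by positivity) b2
  have hdX : dF f ρ η₁ X = 0 := by unfold dF; rw [hX]; ring
  set F := gradF f ρ η₁ j with hF
  set S := sqF f η₁ j with hSdef
  have hr : Real.sqrt S ^ 2 = S := Real.sq_sqrt hS.le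
  have hr0 : 0 < Real.sqrt S := Real.sqrt_pos.2 hS
  set r := Real.sqrt S
  have hsymm : ip H X F = ip H F X := by
    rw [hH, hH]
    have e : ∀ Z, triG ρ A dA dP Z X F = triG ρ A dA dP Z F X := fun Z => by
      unfold triG
      rw [tri_comm _ _ _ h.dA_symm, tri_comm _ _ _ h.dP_symm, ip_comm _ _ h.A_symm]
    have e2 : secondF f ρ η₁ η₂ X F = secondF f ρ η₁ η₂ F X := by unfold secondF; ring
    unfold hessF
    rw [e2, ← hF, e F]; ring
  have hGs : ∀ α β, ((ρ ^ 2)⁻¹ • A + P) α β = ((ρ ^ 2)⁻¹ • A + P) β α := fun α β => by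
    simp [h.A_symm α β, h.P_symm α β]
  have hGF := h.ip_gradF hj (f := f) (η₁ := η₁)
  have hdZ : dF f ρ η₁ Z = a * r := by
    have e1 : dF f ρ η₁ Z = a * r⁻¹ * dF f ρ η₁ F + dF f ρ η₁ X := by
      rw [hZ]; unfold dF
      simp only [Pi.add_apply, Pi.smul_apply, smul_eq_mul]; ring
    rw [e1, hdX, hF, h.dF_gradF hj0, ← hSdef, ← hr]
    field_simp
    ring
  have hGZ : ip ((ρ ^ 2)⁻¹ • A + P) Z Z = a ^ 2 + ip ((ρ ^ 2)⁻¹ • A + P) X X := by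
    have e1 : ip ((ρ ^ 2)⁻¹ • A + P) F F = S := by rw [hF, hGF, h.dF_gradF hj0]
    have e2 : ip ((ρ ^ 2)⁻¹ • A + P) F X = 0 := by rw [hF, hGF, hdX]
    have e3 : ip ((ρ ^ 2)⁻¹ • A + P) X F = 0 := by rw [ip_comm _ _ hGs, e2]
    rw [hZ]
    simp only [ip_add_left, ip_add_right, ip_smul_left, ip_smul_right]
    rw [e1, e2, e3, ← hr]
    field_simp
    ring
  have hHZ : ip H Z Z = a ^ 2 * (ip H F F / S) + 2 * a * (ip H F X / r) + ip H X X := by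
    rw [hZ]
    simp only [ip_add_left, ip_add_right, ip_smul_left, ip_smul_right]
    rw [hsymm, ← hr]
    field_simp
    ring
  have n1 := h.hessF_normal_le s hj0 hj1 hj m
  rw [← hF, ← hH, ← hSdef] at n1
  have n2 := h.hessF_add_le s hj0 hj1 hj hX hns hpos
  rw [← hH] at n2
  have n3 := h.abs_hessF_gradF_le s hj0 hj1 hj X
  rw [hdX, mul_zero, sub_zero, ← hF, ← hH] at n3
  obtain ⟨p0, p1⟩ := h.norm_sq_le_posForm s hX
  -- Normalizing `∇f` costs only one power of `f`, so the mixed Hessian term of order `f⁴` becomes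
  -- one of order `f³`.
  have hr2 : f / 2 ≤ r := by
    refine Real.le_sqrt_of_sq_le ?_
    nlinarith
  have n4 : |ip H F X / r| ≤ 18 * C ^ 3 * f ^ 3 * ‖X‖ := by
    rw [abs_div, abs_of_pos hr0, div_le_iff₀ hr0]
    calc _ ≤ 9 * C ^ 3 * f ^ 4 * ‖X‖ := n3
      _ = 18 * C ^ 3 * f ^ 3 * ‖X‖ * (f / 2) := by ring
      _ ≤ _ := by gcongr
  have n5 : 2 * a * (ip H F X / r) ≤ 18 * C ^ 3 * f ^ 3 * (a ^ 2 + ‖X‖ ^ 2) := by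
    refine (le_abs_self _).trans ?_
    rw [abs_mul, abs_mul, abs_two]
    calc 2 * |a| * |ip H F X / r| ≤ 2 * |a| * (18 * C ^ 3 * f ^ 3 * ‖X‖) := by gcongr
      _ = 18 * C ^ 3 * f ^ 3 * (2 * |a| * ‖X‖) := by ring
      _ ≤ _ := by
        gcongr
        rw [← sq_abs a]
        exact two_mul_le_add_sq _ _
  have n6 : 18 * C ^ 3 * f ^ 3 * a ^ 2 ≤ 18 * C ^ 4 * f ^ 3 * a ^ 2 := by
    gcongr; norm_num
  have n7 : 18 * C ^ 3 * f ^ 3 * ‖X‖ ^ 2 ≤ 36 * C ^ 6 * f ^ 2 * posForm A X := by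
    calc _ ≤ 18 * C ^ 3 * f ^ 3 * (2 * C * posForm A X) := by gcongr
      _ = 36 * C ^ 4 * f ^ 2 * posForm A X * f := by ring
      _ ≤ 36 * C ^ 6 * f ^ 2 * posForm A X * 1 := by
        gcongr
        · norm_num
        · linarith [s.f_le hC]
      _ = _ := by ring
  have n8 := mul_le_mul_of_nonneg_right n1 (sq_nonneg a)
  have n9 : 0 ≤ C ^ 4 * f ^ 3 * a ^ 2 := by positivity
  rw [hHZ, hGZ, hdZ, mul_pow, hr]
  linarith

end PointData

end Estimates

/-! ### The adapted frame and the contraction with a 1-form -/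

section Frames

variable {d : ℕ}

/-- Raising an index by means of a pseudo-orthonormal basis. -/
theorem inv_mulVec_eq_sum {G : Matrix (SIdx d) (SIdx d) ℝ} {e : SIdx d → SIdx d → ℝ}
    {ε : SIdx d → ℝ} (hε : ∀ i, ε i * ε i = 1)
    (he : ∀ i j, ip G (e i) (e j) = if i = j then ε i else 0) (θ : SIdx d → ℝ) :
    G⁻¹.mulVec θ = ∑ i, (ε i * pair θ (e i)) • e i := by
  have h1 : Matrix.of e * G * (Matrix.of e).transpose = Matrix.diagonal ε := by
    ext i j
    rw [Matrix.diagonal_apply, ← he i j, ip_eq_dotProduct, Matrix.mul_assoc, Matrix.mul_apply]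
    simp only [dotProduct]
    refine Finset.sum_congr rfl fun α _ => ?_
    rw [Matrix.of_apply]
    rfl
  have h2 : Matrix.diagonal ε * Matrix.diagonal ε = 1 := by
    rw [Matrix.diagonal_mul_diagonal, ← Matrix.diagonal_one]
    congr 1; ext i; exact hε i
  have h3 : Matrix.of e * (G * (Matrix.of e).transpose * Matrix.diagonal ε) = 1 := by
    rw [← Matrix.mul_assoc, ← Matrix.mul_assoc, h1, h2]
  rw [mul_eq_one_comm] at h3
  have h4 : G⁻¹ = (Matrix.of e).transpose * Matrix.diagonal ε * Matrix.of e :=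
    Matrix.inv_eq_right_inv (by simpa only [Matrix.mul_assoc] using h3)
  rw [h4, ← Matrix.mulVec_mulVec, ← Matrix.mulVec_mulVec]
  ext α
  simp only [Matrix.mulVec, dotProduct, Finset.sum_apply, Pi.smul_apply, smul_eq_mul,
    Matrix.transpose_apply, Matrix.of_apply, Matrix.diagonal_apply, ite_mul, zero_mul,
    Finset.sum_ite_eq, Finset.mem_univ, if_true, pair]
  refine Finset.sum_congr rfl fun i _ => ?_
  rw [mul_comm]
  congr 2
  exact Finset.sum_congr rfl fun β _ => mul_comm _ _

variable {C ρ : ℝ} {A B R P : Matrix (SIdx d) (SIdx d) ℝ}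
  {dA dP : SIdx d → Matrix (SIdx d) (SIdx d) ℝ} {f η η₁ η₂ ξ κ ζ w K : ℝ} {j : SIdx d → ℝ}
  {E : Fin d → SIdx d → ℝ}

/-- The vector `∂_t + η' f ∂_ρ`. -/
def levelT (f η₁ : ℝ) : SIdx d → ℝ := eT + (η₁ * f) • eR

/-- The part of `∂_t + η' f ∂_ρ` that is orthogonal to the vectors `E X`. -/
def levelV (G : Matrix (SIdx d) (SIdx d) ℝ) (f η₁ : ℝ) (E : Fin d → SIdx d → ℝ) : SIdx d → ℝ :=
  levelT f η₁ - ∑ X, ip G (levelT f η₁) (E X) • E X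

theorem ip_sum_smul_frame {G : Matrix (SIdx d) (SIdx d) ℝ}
    (hE : ∀ X Y, ip G (E X) (E Y) = if X = Y then 1 else 0) (a : Fin d → ℝ) (Y : Fin d) :
    ip G (∑ X, a X • E X) (E Y) = a Y := by
  simp [ip_sum_left, ip_smul_left, hE]

theorem ip_sum_smul_self {G : Matrix (SIdx d) (SIdx d) ℝ}
    (hE : ∀ X Y, ip G (E X) (E Y) = if X = Y then 1 else 0) (a : Fin d → ℝ) :
    ip G (∑ X, a X • E X) (∑ X, a X • E X) = ∑ X, a X ^ 2 := by
  rw [ip_sum_right]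
  refine Finset.sum_congr rfl fun Y _ => ?_
  rw [ip_smul_right, ip_sum_smul_frame hE, sq]

theorem ip_levelV_frame {G : Matrix (SIdx d) (SIdx d) ℝ}
    (hE : ∀ X Y, ip G (E X) (E Y) = if X = Y then 1 else 0) (Y : Fin d) :
    ip G (levelV G f η₁ E) (E Y) = 0 := by
  unfold levelV
  rw [ip_sub_left, ip_sum_smul_frame hE, sub_self]

namespace PointData

variable (h : PointData C ρ A B R P dA dP) (s : ScalarData C f ρ η η₁ η₂ ξ κ ζ w)
include h

theorem metric_symm (α β : SIdx d) : ((ρ ^ 2)⁻¹ • A + P) α β = ((ρ ^ 2)⁻¹ • A + P) β α := by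
  simp [h.A_symm α β, h.P_symm α β]

include s

/-- Here `q` is the square of the projection `Z₀` of `∂_t + η' f ∂_ρ` to the horizontal space. Only
`P` pairs this vector with horizontal ones, so `q = P(∂_t, Z₀) ≤ C ‖Z₀‖`. As coercivity gives `‖Z₀‖²
≤ 2 C ρ² q`, the projection is `O(ρ²)`. -/
theorem exists_ip_levelV (hE0 : ∀ X, E X none = 0 ∧ E X (some none) = 0)
    (hE : ∀ X Y, ip ((ρ ^ 2)⁻¹ • A + P) (E X) (E Y) = if X = Y then 1 else 0) :
    ∃ q, 0 ≤ q ∧ q ≤ 2 * C ^ 3 * ρ ^ 2 ∧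
      ρ ^ 2 * -ip ((ρ ^ 2)⁻¹ • A + P) (levelV ((ρ ^ 2)⁻¹ • A + P) f η₁ E)
        (levelV ((ρ ^ 2)⁻¹ • A + P) f η₁ E) =
      1 - f ^ 2 * η₁ ^ 2 - ρ ^ 2 * ip P eT eT + ρ ^ 2 * q := by
  have hC := h.one_le
  have hρ := h.ρ_pos
  have hf := s.f_pos
  have hρ6 := s.ρ_sq_le hC hρ
  have heT := norm_eT (d := d)
  set G := (ρ ^ 2)⁻¹ • A + P with hG
  set Z₀ := ∑ X, ip G (levelT f η₁) (E X) • E X with hZ₀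
  set q := ∑ X, ip G (levelT f η₁) (E X) ^ 2 with hq
  have q0 : 0 ≤ q := Finset.sum_nonneg fun X _ => sq_nonneg _
  have z0 : Z₀ none = 0 := by simp [hZ₀, (hE0 _).1]
  have z1 : Z₀ (some none) = 0 := by simp [hZ₀, (hE0 _).2]
  have g1 : ip G Z₀ Z₀ = q := ip_sum_smul_self hE _
  have g2 : ip G (levelT f η₁) Z₀ = q := by
    rw [hZ₀, ip_sum_right]
    exact Finset.sum_congr rfl fun X _ => by rw [ip_smul_right, sq]
  have g3 : ip G Z₀ (levelT f η₁) = q := by rw [ip_comm _ _ h.metric_symm, g2]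
  have g4 : ip G (levelV G f η₁ E) (levelV G f η₁ E) = ip G (levelT f η₁) (levelT f η₁) - q := by
    unfold levelV
    rw [← hZ₀, ip_sub_left, ip_sub_right, ip_sub_right, g1, g2, g3]; ring
  have hPe : ip P eT eR = 0 := by rw [ip_comm _ _ h.P_symm, h.P_rho]
  have g5 : ip G (levelT f η₁) (levelT f η₁) =
      (ρ ^ 2)⁻¹ * (f ^ 2 * η₁ ^ 2 - 1) + ip P eT eT := by
    unfold levelT
    simp only [hG, ip_add_form, ip_smul_form, ip_add_left, ip_smul_left, ip_add_right,
      ip_smul_right, h.A_rho, h.A_tim, h.P_rho, hPe, eR_rho, eR_tim, eT_rho, eT_tim]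
    ring
  have g6 : q = ip P eT Z₀ := by
    rw [← g2]
    unfold levelT
    simp only [hG, ip_add_form, ip_smul_form, ip_add_left, ip_smul_left, h.A_rho, h.A_tim, h.P_rho,
      z0, z1]
    ring
  have g7 : q ≤ C * ‖Z₀‖ := by
    rw [g6]
    refine (le_abs_self _).trans ((h.P_le _ _).trans ?_)
    calc C * (‖(eT : SIdx d → ℝ)‖ * ‖Z₀‖) ≤ C * (1 * ‖Z₀‖) := by gcongr
      _ = _ := by ring
  have g8 : ‖Z₀‖ ^ 2 ≤ 2 * C * ρ ^ 2 * q := by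
    have a1 := h.coercive Z₀
    rw [z1] at a1
    have a2 : ip A Z₀ Z₀ = ρ ^ 2 * q - ρ ^ 2 * ip P Z₀ Z₀ := by
      rw [← g1, hG, ip_add_form, ip_smul_form]; field_simp; ring
    have a3 := (abs_le.1 (h.P_le Z₀ Z₀)).1
    have a4 : C * (ρ ^ 2 * -ip P Z₀ Z₀) ≤ C * (ρ ^ 2 * (C * (‖Z₀‖ * ‖Z₀‖))) := by
      gcongr; linarith
    have a5 := mul_le_mul_of_nonneg_right hρ6 (sq_nonneg ‖Z₀‖)
    rw [a2] at a1
    nlinarith [sq_nonneg ‖Z₀‖]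
  have g9 : q ≤ 2 * C ^ 3 * ρ ^ 2 := by
    by_contra hcon
    push Not at hcon
    have a1 : q ^ 2 ≤ (C * ‖Z₀‖) ^ 2 := by gcongr
    have a2 : C ^ 2 * ‖Z₀‖ ^ 2 ≤ C ^ 2 * (2 * C * ρ ^ 2 * q) := by gcongr
    have a3 : 0 < q := lt_of_le_of_lt (by positivity) hcon
    have a4 : q * (2 * C ^ 3 * ρ ^ 2) < q * q := by gcongr
    linarith
  refine ⟨q, q0, g9, ?_⟩
  rw [g4, g5]; field_simp; ring

theorem levelV_bounds (hE0 : ∀ X, E X none = 0 ∧ E X (some none) = 0)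
    (hE : ∀ X Y, ip ((ρ ^ 2)⁻¹ • A + P) (E X) (E Y) = if X = Y then 1 else 0) :
    ip ((ρ ^ 2)⁻¹ • A + P) (levelV ((ρ ^ 2)⁻¹ • A + P) f η₁ E)
        (levelV ((ρ ^ 2)⁻¹ • A + P) f η₁ E) < 0 ∧
      ρ ^ 2 * -ip ((ρ ^ 2)⁻¹ • A + P) (levelV ((ρ ^ 2)⁻¹ • A + P) f η₁ E)
        (levelV ((ρ ^ 2)⁻¹ • A + P) f η₁ E) ≤ 1 + 3 * C ^ 3 * ρ ^ 2 := by
  have hC := h.one_le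
  have hρ := h.ρ_pos
  have hf := s.f_pos
  have heT := norm_eT (d := d)
  obtain ⟨q, q0, g9, e1⟩ := h.exists_ip_levelV s hE0 hE
  generalize ip ((ρ ^ 2)⁻¹ • A + P) (levelV ((ρ ^ 2)⁻¹ • A + P) f η₁ E)
        (levelV ((ρ ^ 2)⁻¹ • A + P) f η₁ E) = V at *
  have p1 := abs_le.1 (h.P_le eT eT)
  have p2 : C * (‖(eT : SIdx d → ℝ)‖ * ‖(eT : SIdx d → ℝ)‖) ≤ C * (1 * 1) := by gcongr
  have hsmall := s.ρ_small hC
  have b1 : f ^ 2 * η₁ ^ 2 ≤ 1 / 1000 := by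
    have c1 : η₁ ^ 2 ≤ C ^ 2 := sq_le_sq' (by linarith [(abs_le.1 s.η₁_le).1]) (abs_le.1 s.η₁_le).2
    have c2 := s.pow_mul_le hC 1
    have c3 : (C ^ 1 * f) ^ 2 ≤ (1 / 1000) ^ 2 := by gcongr
    have c4 : f ^ 2 * η₁ ^ 2 ≤ f ^ 2 * C ^ 2 := by gcongr
    linarith
  have b2 : ρ ^ 2 * ip P eT eT ≤ ρ ^ 2 * C := by gcongr; linarith [p1.2]
  have b3 : ρ ^ 2 * -ip P eT eT ≤ ρ ^ 2 * C := by gcongr; linarith [p1.1]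
  have b5 : ρ ^ 2 * q ≤ ρ ^ 2 * (2 * C ^ 3) := by
    gcongr
    refine g9.trans ?_
    calc 2 * C ^ 3 * ρ ^ 2 ≤ 2 * C ^ 3 * 1 := by
          gcongr
          nlinarith
      _ = _ := by ring
  have b6 : ρ ^ 2 * C ≤ ρ ^ 2 * C ^ 3 := by
    gcongr
    calc C = C ^ 1 := by ring
      _ ≤ _ := by gcongr; norm_num
  have b7 : 0 ≤ ρ ^ 2 * q := by positivity
  constructor
  · have : 0 < ρ ^ 2 * -V := by
      have c0 : C ^ 3 * ρ ^ 2 ≤ 1 / 10 := by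
        have c1 := s.pow_mul_le hC 4
        have c2 : C ^ 3 * ρ ≤ C ^ 3 * (C * f) := by gcongr; exact s.ρ_le
        have c3 : C ^ 3 * ρ * ρ ≤ 1 / 1000 * 1 := by
          gcongr
          · linarith
          · linarith
        linarith
      rw [e1]; linarith
    have := pos_of_mul_pos_right this (by positivity)
    linarith
  · rw [e1]
    have : 0 ≤ f ^ 2 * η₁ ^ 2 := by positivity
    linarith

/-- In the model geometry `V` is close to `ρ ∂_t` and the frame `E` is `ρ` times a `γ`-orthonormal
one, so `dt² + γ` is `ρ²` times the sum of squares. The true metric changes this by a relative error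
`O(f)`. -/
theorem posForm_frame_ge (hE0 : ∀ X, E X none = 0 ∧ E X (some none) = 0)
    (hE : ∀ X Y, ip ((ρ ^ 2)⁻¹ • A + P) (E X) (E Y) = if X = Y then 1 else 0)
    (b : ℝ) (c : Fin d → ℝ) {v : ℝ}
    (hv : v = -ip ((ρ ^ 2)⁻¹ • A + P) (levelV ((ρ ^ 2)⁻¹ • A + P) f η₁ E)
        (levelV ((ρ ^ 2)⁻¹ • A + P) f η₁ E)) {X : SIdx d → ℝ}
    (hXeq : X = b • (Real.sqrt v)⁻¹ • levelV ((ρ ^ 2)⁻¹ • A + P) f η₁ E + ∑ Y, c Y • E Y) :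
    X none = f * η₁ * X (some none) ∧
      ρ ^ 2 * (1 - 27 * C ^ 7 * f) * (b ^ 2 + ∑ Y, c Y ^ 2) ≤ posForm A X := by
  have hC := h.one_le
  have hρ := h.ρ_pos
  have hf := s.f_pos
  obtain ⟨v0, v1⟩ := h.levelV_bounds s hE0 hE
  rw [← hv] at v1
  have v2 : 0 < v := by linarith
  have hVE := ip_levelV_frame (f := f) (η₁ := η₁) hE
  set G := (ρ ^ 2)⁻¹ • A + P with hG
  have hr : Real.sqrt v ^ 2 = v := Real.sq_sqrt v2.le
  have hr0 : 0 < Real.sqrt v := Real.sqrt_pos.2 v2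
  set r := Real.sqrt v
  have V0 : levelV G f η₁ E none = η₁ * f := by simp [levelV, levelT, (hE0 _).1]
  have V1 : levelV G f η₁ E (some none) = 1 := by simp [levelV, levelT, (hE0 _).2]
  have X0 : X none = b * r⁻¹ * (η₁ * f) := by simp [hXeq, V0, (hE0 _).1, mul_assoc]
  have X1 : X (some none) = b * r⁻¹ := by simp [hXeq, V1, (hE0 _).2]
  have hX : X none = f * η₁ * X (some none) := by rw [X0, X1]; ring
  refine ⟨hX, ?_⟩
  obtain ⟨p0, p1⟩ := h.norm_sq_le_posForm s hX
  have hGX : ip G X X = -b ^ 2 + ∑ Y, c Y ^ 2 := by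
    have e1 : ∀ Z : Fin d → ℝ, ip G (levelV G f η₁ E) (∑ Y, Z Y • E Y) = 0 := fun Z => by
      rw [ip_sum_right]
      exact Finset.sum_eq_zero fun Y _ => by rw [ip_smul_right, hVE, mul_zero]
    have e3 : ∀ Z : Fin d → ℝ, ip G (∑ Y, Z Y • E Y) (levelV G f η₁ E) = 0 := fun Z => by
      rw [ip_comm _ _ h.metric_symm, ← hG, e1]
    have e2 : ip G (levelV G f η₁ E) (levelV G f η₁ E) = -v := by rw [hv, neg_neg]
    rw [hXeq]
    simp only [ip_add_left, ip_add_right, ip_smul_left, ip_smul_right]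
    rw [e1, e3, ip_sum_smul_self hE, e2, ← hr]
    field_simp
    ring
  set q := ∑ Y, c Y ^ 2
  have hq0 : 0 ≤ q := Finset.sum_nonneg fun Y _ => sq_nonneg _
  have hA : ip A X X = ρ ^ 2 * (-b ^ 2 + q) - ρ ^ 2 * ip P X X := by
    rw [← hGX, hG, ip_add_form, ip_smul_form]; field_simp; ring
  -- The metric contributes `-b²` from the timelike direction. The term `2 (X^t)²` in `posForm`
  -- reverses this sign, as `X^t = b / √v` with `v` close to `ρ⁻²`.
  have h1 : posForm A X + ρ ^ 2 * ip P X X =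
      ρ ^ 2 * (-b ^ 2 + q) + (2 - f ^ 2 * η₁ ^ 2) * (b ^ 2 * v⁻¹) := by
    unfold posForm
    rw [hA, X0, X1, ← hr]; field_simp; ring
  have h2 : ρ ^ 2 * ip P X X ≤ 2 * C ^ 2 * ρ ^ 2 * posForm A X := by
    calc ρ ^ 2 * ip P X X ≤ ρ ^ 2 * (C * (‖X‖ * ‖X‖)) := by
          gcongr; exact (le_abs_self _).trans (h.P_le _ _)
      _ = ρ ^ 2 * C * ‖X‖ ^ 2 := by ring
      _ ≤ ρ ^ 2 * C * (2 * C * posForm A X) := by gcongr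
      _ = _ := by ring
  have τ0 : 0 ≤ C ^ 7 * f := by positivity
  have τ1 := s.pow_mul_le hC 7
  have hf1 := s.f_le hC
  have hρ2 : ρ ^ 2 ≤ C ^ 2 * f * f := by
    calc ρ ^ 2 ≤ (C * f) ^ 2 := by gcongr; exact s.ρ_le
      _ = _ := by ring
  have δ1 : f ^ 2 * η₁ ^ 2 ≤ C ^ 7 * f := by
    calc f ^ 2 * η₁ ^ 2 = f ^ 2 * |η₁| ^ 2 := by rw [sq_abs]
      _ ≤ f ^ 2 * C ^ 2 := by gcongr; exact s.η₁_le
      _ = C ^ 2 * f * f := by ring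
      _ ≤ C ^ 7 * f * 1 := by gcongr <;> linarith
      _ = _ := by ring
  have ε1 : C ^ 3 * ρ ^ 2 ≤ C ^ 7 * f := by
    calc C ^ 3 * ρ ^ 2 ≤ C ^ 3 * (C ^ 2 * f * f) := by gcongr
      _ = C ^ 5 * f * f := by ring
      _ ≤ C ^ 7 * f * 1 := by gcongr <;> linarith
      _ = _ := by ring
  have ε2 : C ^ 2 * ρ ^ 2 ≤ C ^ 7 * f := by
    calc C ^ 2 * ρ ^ 2 ≤ C ^ 2 * (C ^ 2 * f * f) := by gcongr
      _ = C ^ 4 * f * f := by ring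
      _ ≤ C ^ 7 * f * 1 := by gcongr <;> linarith
      _ = _ := by ring
  have ε0 : 0 ≤ C ^ 3 * ρ ^ 2 := by positivity
  set τ := C ^ 7 * f
  have h3 : ρ ^ 2 * (1 - 3 * τ) ≤ v⁻¹ := by
    rw [← one_div, le_div_iff₀ v2]
    have a1 : ρ ^ 2 * v ≤ 1 + 3 * τ := by linarith
    have a2 : (1 - 3 * τ) * (ρ ^ 2 * v) ≤ (1 - 3 * τ) * (1 + 3 * τ) := by
      gcongr; linarith
    nlinarith [sq_nonneg τ]
  -- From `(2 - τ)(1 - 3τ) ≥ 2 - 7τ`, the coefficient of `ρ² b²` becomes at least `1 - 7τ`.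
  have h4 : (2 - τ) * (b ^ 2 * (ρ ^ 2 * (1 - 3 * τ))) ≤
      (2 - f ^ 2 * η₁ ^ 2) * (b ^ 2 * v⁻¹) := by
    have a0 : 0 ≤ 1 - 3 * τ := by linarith
    have a1 : 0 ≤ 2 - f ^ 2 * η₁ ^ 2 := by linarith
    gcongr
  have h5 : C ^ 2 * ρ ^ 2 * posForm A X ≤ τ * posForm A X := by gcongr
  have h6 : ρ ^ 2 * (1 - 7 * τ) * (b ^ 2 + q) ≤ posForm A X * (1 + 2 * τ) := by
    have a1 : 0 ≤ ρ ^ 2 * q * τ := by positivity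
    have a2 : 0 ≤ ρ ^ 2 * b ^ 2 * τ ^ 2 := by positivity
    linarith
  have h7 : ρ ^ 2 * (1 - 27 * τ) * (b ^ 2 + q) * (1 + 2 * τ) ≤
      ρ ^ 2 * (1 - 7 * τ) * (b ^ 2 + q) := by
    have a1 : 0 ≤ ρ ^ 2 * (b ^ 2 + q) * τ := by positivity
    have a2 : 0 ≤ ρ ^ 2 * (b ^ 2 + q) * τ * τ := by positivity
    linarith
  have h8 := le_of_mul_le_mul_right (h7.trans h6) (by linarith : 0 < 1 + 2 * τ)
  linarith

/-- The vectors `N`, `V`, `E` form a pseudo-orthonormal basis with `V` timelike. The minus sign in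
front of its coefficient is harmless, since only squares of tangential coefficients are used later.
-/
theorem inv_mulVec_eq_frame (hj0 : j none = 0) (hj1 : ‖j‖ ≤ 6 * C ^ 2 * ρ ^ 2)
    (hj : ∀ X, ip A j X + ρ ^ 2 * ip P j X = ρ ^ 2 * ip P eT X)
    (hE0 : ∀ X, E X none = 0 ∧ E X (some none) = 0)
    (hE : ∀ X Y, ip ((ρ ^ 2)⁻¹ • A + P) (E X) (E Y) = if X = Y then 1 else 0)
    {v : ℝ} (hv : v = -ip ((ρ ^ 2)⁻¹ • A + P) (levelV ((ρ ^ 2)⁻¹ • A + P) f η₁ E)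
        (levelV ((ρ ^ 2)⁻¹ • A + P) f η₁ E)) (θ : SIdx d → ℝ) {N V : SIdx d → ℝ}
    (hN : N = (Real.sqrt (sqF f η₁ j))⁻¹ • gradF f ρ η₁ j)
    (hV : V = (Real.sqrt v)⁻¹ • levelV ((ρ ^ 2)⁻¹ • A + P) f η₁ E) :
    ((ρ ^ 2)⁻¹ • A + P)⁻¹.mulVec θ =
      pair θ N • N + (-pair θ V • V + ∑ Y, pair θ (E Y) • E Y) := by
  have hf := s.f_pos
  have hS : 0 < sqF f η₁ j := lt_of_lt_of_le (by positivity) (h.sqF_bounds s hj1).2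
  have hv0 : 0 < v := by linarith [(h.levelV_bounds s hE0 hE).1]
  have hr : Real.sqrt (sqF f η₁ j) ^ 2 = sqF f η₁ j := Real.sq_sqrt hS.le
  have hr0 : 0 < Real.sqrt (sqF f η₁ j) := Real.sqrt_pos.2 hS
  have hq : Real.sqrt v ^ 2 = v := Real.sq_sqrt hv0.le
  have hq0 : 0 < Real.sqrt v := Real.sqrt_pos.2 hv0
  generalize Real.sqrt (sqF f η₁ j) = r at *
  generalize Real.sqrt v = q at *
  have hVE := ip_levelV_frame (f := f) (η₁ := η₁) hE
  have hGF := h.ip_gradF hj (f := f) (η₁ := η₁)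
  have hFF := hGF (gradF f ρ η₁ j)
  rw [h.dF_gradF hj0] at hFF
  have hs := h.metric_symm
  set G := (ρ ^ 2)⁻¹ • A + P with hG
  have dV : dF f ρ η₁ (levelV G f η₁ E) = 0 := by
    simp [dF, levelV, levelT, (hE0 _).1, (hE0 _).2]; ring
  have dE : ∀ Y, dF f ρ η₁ (E Y) = 0 := fun Y => by simp [dF, (hE0 _).1, (hE0 _).2]
  have NN : ip G N N = 1 := by
    rw [hN, ip_smul_left, ip_smul_right, hFF, ← hr]
    field_simp
  have NV : ip G N V = 0 := by rw [hN, hV, ip_smul_left, ip_smul_right, hGF, dV]; ring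
  have NE : ∀ Y, ip G N (E Y) = 0 := fun Y => by rw [hN, ip_smul_left, hGF, dE, mul_zero]
  have VV : ip G V V = -1 := by
    have e2 : ip G (levelV G f η₁ E) (levelV G f η₁ E) = -v := by rw [hv, neg_neg]
    rw [hV, ip_smul_left, ip_smul_right, e2, ← hq]
    field_simp
  have VE : ∀ Y, ip G V (E Y) = 0 := fun Y => by rw [hV, ip_smul_left, hVE, mul_zero]
  have VN : ip G V N = 0 := by rw [ip_comm _ _ hs, NV]
  have EN : ∀ Y, ip G (E Y) N = 0 := fun Y => by rw [ip_comm _ _ hs, NE]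
  have EV : ∀ Y, ip G (E Y) V = 0 := fun Y => by rw [ip_comm _ _ hs, VE]
  let e : SIdx d → SIdx d → ℝ := fun i => i.elim N fun i => i.elim V E
  let ε : SIdx d → ℝ := fun i => i.elim 1 fun i => i.elim (-1) fun _ => 1
  have key := inv_mulVec_eq_sum (G := G) (e := e) (ε := ε)
    (by rintro (_ | _ | i) <;> simp [ε])
    (by rintro (_ | _ | i) (_ | _ | k) <;> simp [e, ε, NN, NV, NE, VV, VE, VN, EN, EV, hE]) θ
  rw [key, Fintype.sum_option, Fintype.sum_option]
  simp [e, ε]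

theorem contraction_le (hj0 : j none = 0) (hj1 : ‖j‖ ≤ 6 * C ^ 2 * ρ ^ 2)
    (hj : ∀ X, ip A j X + ρ ^ 2 * ip P j X = ρ ^ 2 * ip P eT X)
    (hns : ∀ X, |tri dA eT X X| ≤ ξ * (posForm A X - X (some none) ^ 2))
    (hpos : ∀ X, K * posForm A X ≤ -ip B X X - κ * X (some none) ^ 2
      - ζ * (posForm A X - 2 * X (some none) ^ 2)) (hK : K ≤ C) (hKf : 78 * C ^ 6 * f ≤ K)
    (m : ℝ) {H : Matrix (SIdx d) (SIdx d) ℝ}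
    (hH : ∀ X Y, ip H X Y = hessF f ρ η₁ η₂ A dA dP j X Y)
    (hE0 : ∀ X, E X none = 0 ∧ E X (some none) = 0)
    (hE : ∀ X Y, ip ((ρ ^ 2)⁻¹ • A + P) (E X) (E Y) = if X = Y then 1 else 0)
    {v : ℝ} (hv : v = -ip ((ρ ^ 2)⁻¹ • A + P) (levelV ((ρ ^ 2)⁻¹ • A + P) f η₁ E)
        (levelV ((ρ ^ 2)⁻¹ • A + P) f η₁ E)) (θ : SIdx d → ℝ) {N V Z : SIdx d → ℝ}
    (hN : N = (Real.sqrt (sqF f η₁ j))⁻¹ • gradF f ρ η₁ j)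
    (hV : V = (Real.sqrt v)⁻¹ • levelV ((ρ ^ 2)⁻¹ • A + P) f η₁ E)
    (hZ : Z = ((ρ ^ 2)⁻¹ • A + P)⁻¹.mulVec θ) :
    ip H Z Z + w * ip ((ρ ^ 2)⁻¹ • A + P) Z Z + m / f * dF f ρ η₁ Z ^ 2 ≤
      ((m + 2) * f + (78 + 2 * |m|) * C ^ 4 * f ^ 3) * pair θ N ^ 2
        - f * (K - 105 * C ^ 8 * f) * ρ ^ 2 * (pair θ V ^ 2 + ∑ Y, pair θ (E Y) ^ 2) := by
  have hC := h.one_le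
  have hf := s.f_pos
  rw [h.inv_mulVec_eq_frame s hj0 hj1 hj hE0 hE hv θ hN hV] at hZ
  set X := -pair θ V • V + ∑ Y, pair θ (E Y) • E Y with hX
  obtain ⟨t1, t2⟩ := h.posForm_frame_ge s hE0 hE (-pair θ V) (fun Y => pair θ (E Y)) hv
    (X := X) (by rw [← hV])
  have t3 := h.hessF_combined_le s hj0 hj1 hj t1 (hns X) (hpos X) m (pair θ N) hH (Z := Z)
    (by rw [← hN, hZ])
  refine t3.trans (sub_le_sub_left ?_ _)
  rw [neg_sq] at t2
  have hq : 0 ≤ pair θ V ^ 2 + ∑ Y, pair θ (E Y) ^ 2 :=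
    add_nonneg (sq_nonneg _) (Finset.sum_nonneg fun Y _ => sq_nonneg _)
  set q := pair θ V ^ 2 + ∑ Y, pair θ (E Y) ^ 2
  have t4 : f * (K - 78 * C ^ 6 * f) * (ρ ^ 2 * (1 - 27 * C ^ 7 * f) * q) ≤
      f * (K - 78 * C ^ 6 * f) * posForm A X := by
    have : 0 ≤ K - 78 * C ^ 6 * f := by linarith
    gcongr
  refine le_trans ?_ t4
  -- The two relative losses combine to `105 = 78 + 27`; one factor `C` comes from `K ≤ C`.
  have t5 : K - 105 * C ^ 8 * f ≤ (K - 78 * C ^ 6 * f) * (1 - 27 * C ^ 7 * f) := by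
    have a1 : K * (27 * C ^ 7 * f) ≤ C * (27 * C ^ 7 * f) := by gcongr
    have a2 : C ^ 6 * f ≤ C ^ 8 * f := by gcongr; norm_num
    have a3 : 0 ≤ 78 * C ^ 6 * f * (27 * C ^ 7 * f) := by positivity
    linarith
  calc f * (K - 105 * C ^ 8 * f) * ρ ^ 2 * q ≤
      f * ((K - 78 * C ^ 6 * f) * (1 - 27 * C ^ 7 * f)) * ρ ^ 2 * q := by gcongr
    _ = _ := by ring

/-- Pseudoconvexity of the level sets of `f`. -/
theorem hessF_neg_of_null (hj0 : j none = 0) (hj1 : ‖j‖ ≤ 6 * C ^ 2 * ρ ^ 2)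
    (hj : ∀ X, ip A j X + ρ ^ 2 * ip P j X = ρ ^ 2 * ip P eT X)
    (hns : ∀ X, |tri dA eT X X| ≤ ξ * (posForm A X - X (some none) ^ 2))
    (hpos : ∀ X, K * posForm A X ≤ -ip B X X - κ * X (some none) ^ 2
      - ζ * (posForm A X - 2 * X (some none) ^ 2)) (hKf : 78 * C ^ 6 * f ≤ K)
    {X : SIdx d → ℝ} (hX0 : X ≠ 0) (hX : dF f ρ η₁ X = 0)
    (hnull : ip ((ρ ^ 2)⁻¹ • A + P) X X = 0) : hessF f ρ η₁ η₂ A dA dP j X X < 0 := by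
  have hC := h.one_le
  have hf := s.f_pos
  have hρ := h.ρ_pos
  have t1 : X none = f * η₁ * X (some none) := by
    have t0 : f / ρ * (X none - f * η₁ * X (some none)) = 0 := by
      rw [← hX]; unfold dF; ring
    linarith [(mul_eq_zero.1 t0).resolve_left (by positivity)]
  have t2 := h.hessF_add_le s hj0 hj1 hj t1 (hns X) (hpos X)
  -- On a null vector the multiple of the metric drops out, whatever `w` is, and the estimate
  -- concerns the Hessian alone.
  rw [hnull, mul_zero, add_zero] at t2
  obtain ⟨p0, p1⟩ := h.norm_sq_le_posForm s t1
  have p2 : 0 < ‖X‖ := norm_pos_iff.2 hX0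
  have p3 : 0 < posForm A X := by
    by_contra hcon
    have : posForm A X = 0 := le_antisymm (not_lt.1 hcon) p0
    rw [this, mul_zero] at p1
    nlinarith
  have p4 : 0 < K - 42 * C ^ 6 * f := by
    have : 0 < C ^ 6 * f := by positivity
    linarith
  have : 0 < f * (K - 42 * C ^ 6 * f) * posForm A X := by positivity
  linarith

theorem ip_pos_of_horizontal {Y : SIdx d → ℝ} (hY1 : Y (some none) = 0)
    (hY : Y ≠ 0) : 0 < ip ((ρ ^ 2)⁻¹ • A + P) Y Y := by
  have hC := h.one_le
  have hρ := h.ρ_pos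
  have h1 := h.coercive Y
  rw [hY1] at h1
  have h2 := (abs_le.1 (h.P_le Y Y)).1
  have h3 : 0 < ‖Y‖ := norm_pos_iff.2 hY
  have h4 := mul_le_mul_of_nonneg_right (s.ρ_sq_le hC hρ) (sq_nonneg ‖Y‖)
  have h5 : 0 < ip A Y Y + ρ ^ 2 * ip P Y Y := by
    have h6 : C * (ρ ^ 2 * -ip P Y Y) ≤ C * (ρ ^ 2 * (C * (‖Y‖ * ‖Y‖))) := by
      gcongr; linarith
    have h7 : 0 < C * (ip A Y Y + ρ ^ 2 * ip P Y Y) := by nlinarith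
    exact pos_of_mul_pos_right h7 (by linarith)
  rw [ip_add_form, ip_smul_form]
  have h8 : (ρ ^ 2)⁻¹ * ip A Y Y + ip P Y Y = (ρ ^ 2)⁻¹ * (ip A Y Y + ρ ^ 2 * ip P Y Y) := by
    field_simp
  rw [h8]
  positivity

end PointData

end Frames

/-! ### Partial derivatives -/

section PartialDerivatives

variable {d : ℕ}

theorem HasFDerivAt.pd_eq {u : Coord d → ℝ} {L : Coord d →L[ℝ] ℝ} {z : Coord d}
    (h : HasFDerivAt u L z) (α : SIdx d) : pd α u z = L (Pi.single α 1) := by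
  unfold pd; rw [h.fderiv]

theorem pd_congr {u v : Coord d → ℝ} {z : Coord d} (h : u =ᶠ[nhds z] v) (α : SIdx d) :
    pd α u z = pd α v z := by
  unfold pd; rw [h.fderiv_eq]

theorem hasFDerivAt_coord (α : SIdx d) (z : Coord d) :
    HasFDerivAt (fun z : Coord d => z α) (ContinuousLinearMap.proj (R := ℝ) (φ := fun _ => ℝ) α) z :=
  (ContinuousLinearMap.proj (R := ℝ) (φ := fun _ : SIdx d => ℝ) α).hasFDerivAt

/-- The curve along the coordinate line in the direction `α`. -/
theorem hasDerivAt_comp_update {u : Coord d → ℝ} {z : Coord d} (h : DifferentiableAt ℝ u z)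
    (α : SIdx d) : HasDerivAt (fun s => u (Function.update z α s)) (pd α u z) (z α) := by
  have h1 : HasDerivAt (Function.update z α) (Pi.single α (1 : ℝ)) (z α) := hasDerivAt_update z α _
  have h2 : HasFDerivAt u (fderiv ℝ u z) (Function.update z α (z α)) := by
    rw [Function.update_eq_self]; exact h.hasFDerivAt
  exact h2.comp_hasDerivAt (z α) h1

theorem pd_eq_zero_of_eventually {u : Coord d → ℝ} {z : Coord d} (h : DifferentiableAt ℝ u z)
    {α : SIdx d} (hc : ∀ᶠ s in nhds (z α), u (Function.update z α s) = u z) : pd α u z = 0 := by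
  refine (hasDerivAt_comp_update h α).unique ?_
  exact (hasDerivAt_const (z α) (u z)).congr_of_eventuallyEq hc

theorem continuous_rho : Continuous (rho : Coord d → ℝ) := continuous_apply _
theorem continuous_tim : Continuous (tim : Coord d → ℝ) := continuous_apply _
theorem continuous_spc : Continuous (spc : Coord d → Model d) := by
  unfold spc
  exact (PiLp.continuous_toLp 2 _).comp (continuous_pi fun A => continuous_apply _)

theorem hasFDerivAt_rho_mul {b : ℝ → ℝ} {b' : ℝ} {z : Coord d} (hb : HasDerivAt b b' (tim z)) :
    HasFDerivAt (fun z : Coord d => rho z * b (tim z))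
      (b (tim z) • ContinuousLinearMap.proj (R := ℝ) (φ := fun _ => ℝ) none +
        (rho z * b') • ContinuousLinearMap.proj (R := ℝ) (φ := fun _ => ℝ) (some none)) z := by
  have h1 := hasFDerivAt_coord (none : SIdx d) z
  have h2 : HasFDerivAt (fun z : Coord d => b (tim z))
      (b' • ContinuousLinearMap.proj (R := ℝ) (φ := fun _ => ℝ) (some none)) z :=
    hb.comp_hasFDerivAt z (hasFDerivAt_coord (some none : SIdx d) z)
  refine (h1.mul h2).congr_fderiv ?_
  rw [smul_smul, add_comm]; rfl

theorem IsO.differentiableAt {D : Set (Coord d)} {ζ u : Coord d → ℝ} (h : IsO D ζ u)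
    (hD : IsOpen D) {z : Coord d} (hz : z ∈ D) : DifferentiableAt ℝ u z :=
  (h.1.differentiableOn (by simp)).differentiableAt (hD.mem_nhds hz)

theorem IsO.eventually_abs_le {D : Set (Coord d)} {u : Coord d → ℝ} (h : IsO D 1 u) :
    ∀ᶠ C : ℝ in Filter.atTop, ∀ z ∈ D, |u z| ≤ C := by
  obtain ⟨C, hC⟩ := h.2 []
  filter_upwards [Filter.eventually_ge_atTop C] with C' hC' z hz
  have := hC z hz
  simp [pdList] at this
  linarith

theorem IsO.eventually_abs_pd_le {D : Set (Coord d)} {u : Coord d → ℝ} (h : IsO D 1 u)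
    {α : SIdx d} (hα : α ≠ none) :
    ∀ᶠ C : ℝ in Filter.atTop, ∀ z ∈ D, |pd α u z| ≤ C := by
  obtain ⟨C, hC⟩ := h.2 [α]
  filter_upwards [Filter.eventually_ge_atTop C] with C' hC' z hz
  have := hC z hz
  simp [pdList, hα] at this
  linarith

/-- An `𝒪(1)` function may have a `ρ`-derivative of size `ρ⁻¹`. The metric contains such a function
only through `ρ R`, so the weighted bound suffices. -/
theorem IsO.eventually_rho_mul_abs_pd_le {D : Set (Coord d)} {u : Coord d → ℝ} (h : IsO D 1 u)
    (hD : ∀ z ∈ D, 0 < rho z) :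
    ∀ᶠ C : ℝ in Filter.atTop, ∀ z ∈ D, rho z * |pd none u z| ≤ C := by
  obtain ⟨C, hC⟩ := h.2 [none]
  filter_upwards [Filter.eventually_ge_atTop C] with C' hC' z hz
  have h1 := hC z hz
  have h2 := hD z hz
  simp [pdList] at h1
  calc rho z * |pd none u z| ≤ rho z * (C * (rho z)⁻¹) := by gcongr
    _ = C := by field_simp
    _ ≤ C' := hC'

theorem isOpen_chartDom {S : Type*} [TopologicalSpace S]
    (φ : OpenPartialHomeomorph S (Model d)) (ρs T : ℝ) : IsOpen (chartDom φ ρs T) :=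
  (isOpen_Ioo.preimage continuous_rho).inter
    ((isOpen_Ioo.preimage continuous_tim).inter (φ.open_target.preimage continuous_spc))

end PartialDerivatives

/-! ### The components of the metric in a chart -/

section Charts

variable {d : ℕ} {S : Type*} [TopologicalSpace S] [ChartedSpace (Model d) S]
  {ρs T : ℝ} {g gm gs gr : Tensor2 d S} {Ξ : Set (OpenPartialHomeomorph S (Model d))}
  {φ : OpenPartialHomeomorph S (Model d)} {z : Coord d}

/-- The spatial part of the tangent vector with components `X`. -/
def spatial (φ : OpenPartialHomeomorph S (Model d)) (z : Coord d) (X : SIdx d → ℝ) :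
    TangentSpace (𝓡 d) (φ.symm (spc z)) :=
  mfderiv (𝓡 d) (𝓡 d) φ.symm (spc z) (spc X)

theorem sum_smul_coordVec (φ : OpenPartialHomeomorph S (Model d)) (z : Coord d) (X : SIdx d → ℝ) :
    ∑ α, X α • coordVec φ z α =
      ((X none, X (some none), spatial φ z X) : TM d (φ.symm (spc z))) := by
  have h1 : (spc X : Model d) = ∑ A, X (some (some A)) • EuclideanSpace.single A (1 : ℝ) := by
    ext B
    simp [spc, Pi.single_apply]
  have h2 : spatial φ z X = ∑ A, X (some (some A)) •
      mfderiv (𝓡 d) (𝓡 d) φ.symm (spc z) (EuclideanSpace.single A (1 : ℝ)) := by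
    unfold spatial
    rw [h1]
    exact (map_sum (mfderiv (𝓡 d) (𝓡 d) φ.symm (spc z)) _ _).trans
      (Finset.sum_congr rfl fun A _ => map_smul (mfderiv (𝓡 d) (𝓡 d) φ.symm (spc z)) _ _)
  rw [Fintype.sum_option, Fintype.sum_option, h2]
  simp only [coordVec]
  refine Prod.ext ?_ (Prod.ext ?_ ?_)
  · simp [Prod.fst_sum]
  · simp [Prod.fst_sum, Prod.snd_sum]
  · simp [Prod.snd_sum]

theorem ip_comps (h : Tensor2 d S) (φ : OpenPartialHomeomorph S (Model d)) (z : Coord d)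
    (X Y : SIdx d → ℝ) : ip (comps h φ z) X Y =
      h (rho z) (tim z) (φ.symm (spc z)) (X none, X (some none), spatial φ z X)
        (Y none, Y (some none), spatial φ z Y) := by
  rw [← sum_smul_coordVec, ← sum_smul_coordVec, map_sum]
  unfold ip comps
  rw [Finset.sum_comm]
  refine Finset.sum_congr rfl fun β _ => ?_
  rw [map_smul, map_sum, LinearMap.sum_apply, Finset.smul_sum]
  refine Finset.sum_congr rfl fun α _ => ?_
  simp only [Matrix.of_apply, map_smul, LinearMap.smul_apply, smul_eq_mul]
  ring

/-- The curve of components of a tensor along a coordinate line in the direction of `ρ` or `t`. -/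
theorem ip_comps_update_tim (h : Tensor2 d S) (φ : OpenPartialHomeomorph S (Model d)) (z : Coord d)
    (X Y : SIdx d → ℝ) (s : ℝ) : ip (comps h φ (Function.update z (some none) s)) X Y =
      h (rho z) s (φ.symm (spc z)) (X none, X (some none), spatial φ z X)
        (Y none, Y (some none), spatial φ z Y) := by
  rw [ip_comps]
  have h1 : rho (Function.update z (some none) s) = rho z := by simp [rho]
  have h2 : tim (Function.update z (some none) s) = s := by simp [tim]
  have h3 : spc (Function.update z (some none) s) = spc z := by simp [spc]
  unfold spatial
  rw [h1, h2, h3]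

theorem comps_update_rho (h : Tensor2 d S) (φ : OpenPartialHomeomorph S (Model d)) (z : Coord d)
    (s : ℝ) (hs : ∀ x, h s (tim z) x = h (rho z) (tim z) x) :
    comps h φ (Function.update z none s) = comps h φ z := by
  have key : ∀ X Y, ip (comps h φ (Function.update z none s)) X Y = ip (comps h φ z) X Y := by
    intro X Y
    rw [ip_comps, ip_comps]
    have h1 : rho (Function.update z none s) = s := by simp [rho]
    have h2 : tim (Function.update z none s) = tim z := by simp [tim]
    have h3 : spc (Function.update z none s) = spc z := by simp [spc]
    unfold spatial
    rw [h1, h2, h3, hs]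
  ext α β
  simpa only [ip_single_single] using key (Pi.single α 1) (Pi.single β 1)

/-- The chain rule for the chart composed with its inverse shows that coordinate components are
determined by the tangent vector. Positivity of `γ` on tangent vectors thus becomes definiteness in
components. -/
theorem spatial_injective [IsManifold (𝓡 d) ∞ S] (hφ : φ ∈ IsManifold.maximalAtlas (𝓡 d) ∞ S)
    (hz : spc z ∈ φ.target) {X : SIdx d → ℝ} (hX : spatial φ z X = 0) : spc X = 0 := by
  have h1 : MDifferentiableAt (𝓡 d) (𝓡 d) φ.symm (spc z) :=
    (contMDiffAt_symm_of_mem_maximalAtlas hφ hz).mdifferentiableAt (by simp)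
  have h2 : MDifferentiableAt (𝓡 d) (𝓡 d) φ (φ.symm (spc z)) :=
    (contMDiffAt_of_mem_maximalAtlas hφ (φ.map_target hz)).mdifferentiableAt (by simp)
  have h3 := mfderiv_comp (spc z) h2 h1
  have h4 : mfderiv (𝓡 d) (𝓡 d) (φ ∘ φ.symm) (spc z) = ContinuousLinearMap.id ℝ _ := by
    rw [← mfderiv_id]
    refine Filter.EventuallyEq.mfderiv_eq ?_
    filter_upwards [φ.open_target.mem_nhds hz] with y hy
    exact φ.right_inv hy
  rw [h4] at h3
  have h5 : spc X = mfderiv (𝓡 d) (𝓡 d) φ (φ.symm (spc z))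
      (mfderiv (𝓡 d) (𝓡 d) φ.symm (spc z) (spc X)) := congrArg (fun L => L (spc X)) h3
  exact h5.trans ((congrArg (mfderiv (𝓡 d) (𝓡 d) φ (φ.symm (spc z))) hX).trans (map_zero _))

theorem eR_spc : spc (eR : SIdx d → ℝ) = 0 := by ext; simp [spc, eR]
theorem eT_spc : spc (eT : SIdx d → ℝ) = 0 := by ext; simp [spc, eT]

theorem spatial_eR : spatial φ z (eR : SIdx d → ℝ) = 0 := by
  unfold spatial; rw [eR_spc]; exact map_zero _
theorem spatial_eT : spatial φ z (eT : SIdx d → ℝ) = 0 := by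
  unfold spatial; rw [eT_spc]; exact map_zero _

end Charts

/-! ### Uniform coercivity from bounds on the inverse metric -/

section Coercivity

variable {d : ℕ}

theorem ip_sq_le_of_nonneg {B : Matrix (SIdx d) (SIdx d) ℝ} (hs : ∀ α β, B α β = B β α)
    (h : ∀ X, 0 ≤ ip B X X) (X Y : SIdx d → ℝ) : ip B X Y ^ 2 ≤ ip B X X * ip B Y Y := by
  have hd : ∀ t : ℝ, 0 ≤ ip B Y Y * (t * t) + 2 * ip B X Y * t + ip B X X := fun t => by
    have := h (X + t • Y)
    simp only [ip_add_left, ip_add_right, ip_smul_left, ip_smul_right] at this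
    rw [ip_comm Y X hs] at this
    linarith
  have := discrim_le_zero hd
  unfold discrim at this
  linarith

theorem norm_sq_le_dotProduct (X : SIdx d → ℝ) : ‖X‖ ^ 2 ≤ dotProduct X X := by
  have h0 : 0 ≤ dotProduct X X := Finset.sum_nonneg fun i _ => mul_self_nonneg _
  have h1 : ‖X‖ ≤ Real.sqrt (dotProduct X X) := by
    refine (pi_norm_le_iff_of_nonneg (Real.sqrt_nonneg _)).2 fun i => Real.le_sqrt_of_sq_le ?_
    rw [Real.norm_eq_abs, sq_abs, sq]
    exact Finset.single_le_sum (f := fun i => X i * X i) (fun i _ => mul_self_nonneg _)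
      (Finset.mem_univ i)
  calc ‖X‖ ^ 2 ≤ Real.sqrt (dotProduct X X) ^ 2 := by gcongr
    _ = _ := Real.sq_sqrt h0

theorem reflT_reflT (X : SIdx d → ℝ) : reflT (reflT X) = X := by
  unfold reflT
  ext i
  simp only [Pi.sub_apply, Pi.smul_apply, smul_eq_mul, eT_tim]
  ring

/-- A Lorentzian form that is block-diagonal with `-1` as its `t`-component is coercive after
reflection in `t`, with a constant depending only on bounds for the inverse. -/
theorem norm_sq_le_of_inv_bound {A : Matrix (SIdx d) (SIdx d) ℝ} {C₀ : ℝ}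
    (hs : ∀ α β, A α β = A β α) (hT : ∀ X, ip A eT X = -X (some none))
    (hpos : ∀ X, X ≠ 0 → 0 < ip A X X + 2 * X (some none) ^ 2)
    (hinv : ∀ α β, |A⁻¹ α β| ≤ C₀) (X : SIdx d → ℝ) :
    ‖X‖ ^ 2 ≤ (((d : ℝ) + 2) ^ 2 * C₀ + 2) * (ip A X X + 2 * X (some none) ^ 2) := by
  have hTr : ∀ X, ip A X eT = -X (some none) := fun X => by rw [ip_comm _ _ hs, hT]
  have hr : ∀ X Y, ip A X (reflT Y) = ip A X Y + 2 * X (some none) * Y (some none) :=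
    fun X Y => by
      unfold reflT
      rw [ip_sub_right, ip_smul_right, hTr]; ring
  -- the reflected form
  set B : Matrix (SIdx d) (SIdx d) ℝ := A + Matrix.of fun α β =>
    if α = some none ∧ β = some none then 2 else 0 with hB
  have hBs : ∀ α β, B α β = B β α := fun α β => by simp [hB, hs α β, and_comm]
  have hBip : ∀ X Y, ip B X Y = ip A X (reflT Y) := fun X Y => by
    rw [hB, ip_add_form, hr]
    congr 1
    unfold ip
    rw [Finset.sum_eq_single (some none), Finset.sum_eq_single (some none)]
    · simp
    · intro b _ hb; simp [hb]
    · simp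
    · intro b _ hb; simp [hb]
    · simp
  have hBX : ∀ X, ip B X X = ip A X X + 2 * X (some none) ^ 2 := fun X => by
    rw [hBip, hr]; ring
  have hBnn : ∀ X, 0 ≤ ip B X X := fun X => by
    rcases eq_or_ne X 0 with rfl | h
    · simp [ip]
    · rw [hBX]; exact (hpos X h).le
  have hu : IsUnit A.det := by
    rw [← Matrix.isUnit_iff_isUnit_det, ← Matrix.mulVec_injective_iff_isUnit]
    refine (injective_iff_map_eq_zero (Matrix.mulVecLin A)).2 fun Y hY => ?_
    rw [Matrix.mulVecLin_apply] at hY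
    by_contra hne
    have h1 := hpos Y hne
    have h2 : ip A Y (reflT Y) = 0 := by
      rw [ip_comm _ _ hs, ip_eq_dotProduct, hY, dotProduct_zero]
    rw [hr] at h2
    linarith
  -- Chart domains are not compact, so definiteness alone gives no uniform constant. With this `Y`,
  -- the reflected form satisfies `B(Y, reflT X) = X·X`, and Cauchy–Schwarz gives `‖X‖⁴ ≤ B(Y,Y)
  -- B(X,X)`; the bound on the inverse controls `B(Y,Y)`.
  set Y := A⁻¹.mulVec X with hY
  have hAY : ∀ Z, ip A Y Z = dotProduct X Z := fun Z => by
    rw [ip_comm _ _ hs, ip_eq_dotProduct, hY, Matrix.mulVec_mulVec, Matrix.mul_nonsing_inv _ hu,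
      Matrix.one_mulVec, dotProduct_comm]
  have hYt : Y (some none) = -X (some none) := by
    have h1 := hAY eT
    rw [hTr] at h1
    have h2 : dotProduct X eT = X (some none) := by
      unfold eT; rw [dotProduct_single_one]
    linarith
  have c1 : ip B Y (reflT X) = dotProduct X X := by rw [hBip, reflT_reflT, hAY]
  have c2 : ip B (reflT X) (reflT X) = ip B X X := by
    rw [hBip, reflT_reflT, ip_comm _ _ hs, ← hBip]
  have c3 : ip B Y Y ≤ (((d : ℝ) + 2) ^ 2 * C₀ + 2) * ‖X‖ ^ 2 := by
    rw [hBX, hYt, hAY, dotProduct_comm]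
    have e1 : dotProduct Y X = ip A⁻¹ X X := by
      rw [dotProduct_comm, ip_eq_dotProduct]
    have e2 := (abs_le.1 (abs_ip_le X X hinv)).2
    have e3 : |X (some none)| ≤ ‖X‖ := norm_le_pi_norm X _
    have e4 : X (some none) ^ 2 ≤ ‖X‖ ^ 2 := by rw [← sq_abs]; gcongr
    rw [e1]
    linarith
  have c4 := ip_sq_le_of_nonneg hBs hBnn Y (reflT X)
  rw [c1, c2] at c4
  have c5 := norm_sq_le_dotProduct X
  rw [← hBX]
  have c6 := hBnn X
  rcases (norm_nonneg X).eq_or_lt with h0 | h0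
  · have : X = 0 := norm_eq_zero.1 h0.symm
    subst this
    simp [ip]
  have c7 : (‖X‖ ^ 2) * ‖X‖ ^ 2 ≤ (((d : ℝ) + 2) ^ 2 * C₀ + 2) * ip B X X * ‖X‖ ^ 2 := by
    calc (‖X‖ ^ 2) * ‖X‖ ^ 2 = (‖X‖ ^ 2) ^ 2 := by ring
      _ ≤ (dotProduct X X) ^ 2 := by gcongr
      _ ≤ ip B Y Y * ip B X X := c4
      _ ≤ (((d : ℝ) + 2) ^ 2 * C₀ + 2) * ‖X‖ ^ 2 * ip B X X := by gcongr
      _ = _ := by ring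
  exact le_of_mul_le_mul_right c7 (by positivity)

end Coercivity

/-! ### Partial derivatives of matrix-valued functions -/

section Derivatives

variable {d : ℕ} {S : Type*} [TopologicalSpace S] {ρs T : ℝ}
  {φ : OpenPartialHomeomorph S (Model d)} {z : Coord d}

/-- The partial derivatives of a matrix-valued function. -/
def pdMat (M : Coord d → Matrix (SIdx d) (SIdx d) ℝ) (z : Coord d) (μ : SIdx d) :
    Matrix (SIdx d) (SIdx d) ℝ :=
  Matrix.of fun α β => pd μ (fun z' => M z' α β) z

theorem pd_const_of_mem {u : Coord d → ℝ} {c : ℝ} (hu : ∀ z ∈ chartDom φ ρs T, u z = c)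
    (hz : z ∈ chartDom φ ρs T) (μ : SIdx d) : pd μ u z = 0 := by
  have h : u =ᶠ[nhds z] fun _ => c := by
    filter_upwards [(isOpen_chartDom φ ρs T).mem_nhds hz] with z' hz' using hu z' hz'
  rw [pd_congr h]
  unfold pd
  simp

theorem pdMat_symm {M : Coord d → Matrix (SIdx d) (SIdx d) ℝ}
    (hM : ∀ z ∈ chartDom φ ρs T, ∀ α β, M z α β = M z β α) (hz : z ∈ chartDom φ ρs T)
    (μ α β : SIdx d) : pdMat M z μ α β = pdMat M z μ β α := by
  refine pd_congr ?_ μ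
  filter_upwards [(isOpen_chartDom φ ρs T).mem_nhds hz] with z' hz' using hM z' hz' α β

theorem tri_pdMat_eq_zero {M : Coord d → Matrix (SIdx d) (SIdx d) ℝ} {α : SIdx d}
    {c : SIdx d → ℝ} (hM : ∀ z ∈ chartDom φ ρs T, ∀ β, M z α β = c β)
    (hz : z ∈ chartDom φ ρs T) (Z X : SIdx d → ℝ) : tri (pdMat M z) Z (Pi.single α 1) X = 0 := by
  unfold tri
  refine Finset.sum_eq_zero fun μ _ => ?_
  rw [ip_single, Finset.sum_eq_zero fun β _ => ?_, mul_zero]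
  rw [pdMat, Matrix.of_apply, pd_const_of_mem (fun z hz => hM z hz β) hz, zero_mul]

end Derivatives

/-! ### From admissibility to the pointwise data -/

section Admissible

variable {d : ℕ} {S : Type*} [TopologicalSpace S] [ChartedSpace (Model d) S]
  {ρs T : ℝ} {g gm gs gr : Tensor2 d S} {Ξ : Set (OpenPartialHomeomorph S (Model d))}
  {φ : OpenPartialHomeomorph S (Model d)} {z : Coord d}

/-- The components of the part of the metric that is bounded up to the boundary. -/
def remComps (gs gr : Tensor2 d S) (φ : OpenPartialHomeomorph S (Model d)) (z : Coord d) :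
    Matrix (SIdx d) (SIdx d) ℝ :=
  comps gs φ z + rho z • comps gr φ z

theorem comps_symm {h : Tensor2 d S} (hs : ∀ ρ ∈ Ioo 0 ρs, ∀ t ∈ Ioo 0 (Real.pi * T), ∀ x X Y,
    h ρ t x X Y = h ρ t x Y X) (hz : z ∈ chartDom φ ρs T) (α β : SIdx d) :
    comps h φ z α β = comps h φ z β α :=
  hs _ hz.1 _ hz.2.1 _ _ _

variable (hg : IsAdmissibleFG ρs T g gm gs gr Ξ)
include hg

namespace IsAdmissibleFG

theorem ip_gm_rho (hz : z ∈ chartDom φ ρs T) (X : SIdx d → ℝ) :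
    ip (comps gm φ z) eR X = X none := by
  rw [ip_comps, hg.gm_form _ hz.1 _ hz.2.1, spatial_eR, eR_rho, eR_tim]
  have : ((0, 0, 0) : TM d (φ.symm (spc z))) = 0 := rfl
  simp only [this, map_zero, LinearMap.zero_apply]
  ring

theorem ip_gm_tim (hz : z ∈ chartDom φ ρs T) (X : SIdx d → ℝ) :
    ip (comps gm φ z) eT X = -X (some none) := by
  rw [ip_comps, hg.gm_form _ hz.1 _ hz.2.1, spatial_eT, eT_rho, eT_tim]
  have : ((0, 0, 0) : TM d (φ.symm (spc z))) = 0 := rfl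
  simp only [this, map_zero, LinearMap.zero_apply]
  ring

theorem ip_gm_self (hz : z ∈ chartDom φ ρs T) (X : SIdx d → ℝ) :
    ip (comps gm φ z) X X = X none ^ 2 - X (some none) ^ 2 +
      gm (rho z) (tim z) (φ.symm (spc z)) (0, 0, spatial φ z X) (0, 0, spatial φ z X) := by
  rw [ip_comps, hg.gm_form _ hz.1 _ hz.2.1]
  ring

theorem ip_gs_rho (hz : z ∈ chartDom φ ρs T) (X : SIdx d → ℝ) :
    ip (comps gs φ z) eR X = 0 := by
  rw [ip_comps, spatial_eR, eR_rho, eR_tim, hg.gs_tangent _ hz.1 _ hz.2.1]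

theorem ip_gr_rho (hz : z ∈ chartDom φ ρs T) (X : SIdx d → ℝ) :
    ip (comps gr φ z) eR X = 0 := by
  rw [ip_comps, spatial_eR, eR_rho, eR_tim, hg.gr_tangent _ hz.1 _ hz.2.1]

theorem comps_metric (hz : z ∈ chartDom φ ρs T) :
    comps g φ z = (rho z ^ 2)⁻¹ • comps gm φ z + remComps gs gr φ z := by
  ext α β
  have hρ : rho z ≠ 0 := hz.1.1.ne'
  simp only [comps, remComps, Matrix.add_apply, Matrix.smul_apply, Matrix.of_apply, smul_eq_mul,
    hg.expansion _ hz.1 _ hz.2.1]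
  field_simp
  ring

theorem remComps_symm (hz : z ∈ chartDom φ ρs T) (α β : SIdx d) :
    remComps gs gr φ z α β = remComps gs gr φ z β α := by
  simp only [remComps, Matrix.add_apply, Matrix.smul_apply, comps_symm hg.gs_symm hz α β,
    comps_symm hg.gr_symm hz α β]

theorem differentiableAt_gm (hφ : φ ∈ Ξ) (hz : z ∈ chartDom φ ρs T) (α β : SIdx d) :
    DifferentiableAt ℝ (fun z => comps gm φ z α β) z :=
  (hg.gm_bdd φ hφ α β).differentiableAt (isOpen_chartDom φ ρs T) hz

theorem differentiableAt_gs (hφ : φ ∈ Ξ) (hz : z ∈ chartDom φ ρs T) (α β : SIdx d) :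
    DifferentiableAt ℝ (fun z => comps gs φ z α β) z :=
  (hg.gs_bdd φ hφ α β).differentiableAt (isOpen_chartDom φ ρs T) hz

theorem differentiableAt_gr (hφ : φ ∈ Ξ) (hz : z ∈ chartDom φ ρs T) (α β : SIdx d) :
    DifferentiableAt ℝ (fun z => comps gr φ z α β) z :=
  (hg.gr_bdd φ hφ α β).differentiableAt (isOpen_chartDom φ ρs T) hz

theorem hasFDerivAt_remComps (hφ : φ ∈ Ξ) (hz : z ∈ chartDom φ ρs T) (α β : SIdx d) :
    HasFDerivAt (fun z => remComps gs gr φ z α β)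
      (fderiv ℝ (fun z => comps gs φ z α β) z +
        (rho z • fderiv ℝ (fun z => comps gr φ z α β) z +
          comps gr φ z α β • ContinuousLinearMap.proj (R := ℝ) (φ := fun _ => ℝ) none)) z :=
  (hg.differentiableAt_gs hφ hz α β).hasFDerivAt.add
    ((hasFDerivAt_coord none z).mul (hg.differentiableAt_gr hφ hz α β).hasFDerivAt)

theorem pd_rho_gm (hφ : φ ∈ Ξ) (hz : z ∈ chartDom φ ρs T) (α β : SIdx d) :
    pd none (fun z => comps gm φ z α β) z = 0 := by
  refine pd_eq_zero_of_eventually (hg.differentiableAt_gm hφ hz α β) ?_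
  filter_upwards [isOpen_Ioo.mem_nhds hz.1] with s hs
  rw [comps_update_rho gm φ z s fun x => hg.gm_indep _ hs _ hz.1 _ hz.2.1 x]

theorem pd_rho_gs (hφ : φ ∈ Ξ) (hz : z ∈ chartDom φ ρs T) (α β : SIdx d) :
    pd none (fun z => comps gs φ z α β) z = 0 := by
  refine pd_eq_zero_of_eventually (hg.differentiableAt_gs hφ hz α β) ?_
  filter_upwards [isOpen_Ioo.mem_nhds hz.1] with s hs
  rw [comps_update_rho gs φ z s fun x => hg.gs_indep _ hs _ hz.1 _ hz.2.1 x]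

theorem pd_remComps (hφ : φ ∈ Ξ) (hz : z ∈ chartDom φ ρs T) (μ α β : SIdx d) :
    pd μ (fun z => remComps gs gr φ z α β) z = pd μ (fun z => comps gs φ z α β) z +
      (rho z * pd μ (fun z => comps gr φ z α β) z +
        comps gr φ z α β * (Pi.single μ 1 : SIdx d → ℝ) none) :=
  HasFDerivAt.pd_eq (hg.hasFDerivAt_remComps hφ hz α β) μ

theorem pd_metric (hφ : φ ∈ Ξ) (hz : z ∈ chartDom φ ρs T) (μ α β : SIdx d) :
    pd μ (fun z => comps g φ z α β) z =
      (rho z ^ 2)⁻¹ * pdMat (comps gm φ) z μ α β + pdMat (remComps gs gr φ) z μ α β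
        - 2 * (rho z ^ 3)⁻¹ * (Pi.single μ 1 : SIdx d → ℝ) none * comps gm φ z α β := by
  have hρ : rho z ≠ 0 := hz.1.1.ne'
  have h1 : HasDerivAt (fun s : ℝ => (s ^ 2)⁻¹) (-(2 * rho z) / (rho z ^ 2) ^ 2) (rho z) := by
    exact ((hasDerivAt_pow 2 (rho z)).inv (pow_ne_zero 2 hρ)).congr_deriv (by simp)
  have h2 := h1.comp_hasFDerivAt z (hasFDerivAt_coord none z)
  have h3 := (h2.mul (hg.differentiableAt_gm hφ hz α β).hasFDerivAt).add
    (hg.hasFDerivAt_remComps hφ hz α β)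
  have h4 : (fun z => comps g φ z α β) =ᶠ[nhds z] fun z =>
      (rho z ^ 2)⁻¹ * comps gm φ z α β + remComps gs gr φ z α β := by
    filter_upwards [(isOpen_chartDom φ ρs T).mem_nhds hz] with z' hz'
    rw [hg.comps_metric hz']
    simp
  refine (pd_congr h4 μ).trans ((HasFDerivAt.pd_eq h3 μ).trans ?_)
  rw [pdMat, pdMat, Matrix.of_apply, Matrix.of_apply,
    hg.pd_remComps hφ hz]
  simp only [pd, Function.comp, add_apply, smul_apply,
    smul_eq_mul, ContinuousLinearMap.proj_apply, rho]
  change z none ≠ 0 at hρ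
  field_simp
  ring

theorem tri_metric (hφ : φ ∈ Ξ) (hz : z ∈ chartDom φ ρs T) (Z X Y : SIdx d → ℝ) :
    tri (pdMat (comps g φ) z) Z X Y = triG (rho z) (comps gm φ z) (pdMat (comps gm φ) z)
      (pdMat (remComps gs gr φ) z) Z X Y := by
  have h1 : ∀ μ, pdMat (comps g φ) z μ = (rho z ^ 2)⁻¹ • pdMat (comps gm φ) z μ +
      pdMat (remComps gs gr φ) z μ
      - (2 * (rho z ^ 3)⁻¹ * (Pi.single μ 1 : SIdx d → ℝ) none) • comps gm φ z := fun μ => by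
    ext α β
    rw [pdMat, Matrix.of_apply, hg.pd_metric hφ hz]
    simp
  have h2 : Z none = ∑ μ, Z μ * (Pi.single μ 1 : SIdx d → ℝ) none := by
    rw [Finset.sum_eq_single none]
    · simp
    · intro b _ hb; simp [hb.symm]
    · simp
  unfold triG tri
  rw [h2]
  simp only [h1, ip_sub_form, ip_add_form, ip_smul_form, Finset.mul_sum, Finset.sum_mul,
    ← Finset.sum_add_distrib, ← Finset.sum_sub_distrib]
  exact Finset.sum_congr rfl fun μ _ => by ring

/-- The derivative of the boundary metric in time. -/
theorem hasDerivAt_gm_tim (hφ : φ ∈ Ξ) (hz : z ∈ chartDom φ ρs T) (X : SIdx d → ℝ) :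
    HasDerivAt (fun s => gm (rho z) s (φ.symm (spc z)) (0, 0, spatial φ z X)
      (0, 0, spatial φ z X)) (tri (pdMat (comps gm φ) z) eT X X) (tim z) := by
  have h1 : HasDerivAt (fun s => ip (comps gm φ (Function.update z (some none) s)) X X)
      (tri (pdMat (comps gm φ) z) eT X X) (tim z) := by
    unfold eT
    rw [tri_single₁]
    unfold ip
    refine HasDerivAt.fun_sum fun α _ => HasDerivAt.fun_sum fun β _ => ?_
    exact ((hasDerivAt_comp_update (hg.differentiableAt_gm hφ hz α β) (some none)).mul_const
      (X α)).mul_const (X β)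
  have h2 := h1.sub_const (X none ^ 2 - X (some none) ^ 2)
  refine h2.congr_of_eventuallyEq ?_
  filter_upwards [isOpen_Ioo.mem_nhds hz.2.1] with s hs
  have h3 := hg.gm_form _ hz.1 _ hs (φ.symm (spc z)) (X none, X (some none), spatial φ z X)
    (X none, X (some none), spatial φ z X)
  rw [ip_comps_update_tim, h3]
  ring

/-- Stating the bounds for all large `C` lets finitely many of them be merged into one. The delicate
one is the `ρ`-derivative of the remainder: `gs` does not depend on `ρ`, and `∂_ρ(ρ R) = R + ρ ∂_ρR`
is bounded although `∂_ρR` need not be. -/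
theorem exists_pointData [IsManifold (𝓡 d) ∞ S] (hφ : φ ∈ Ξ) :
    ∀ᶠ C : ℝ in Filter.atTop, ∀ z ∈ chartDom φ ρs T,
      PointData C (rho z) (comps gm φ z) (comps gs φ z) (comps gr φ z) (remComps gs gr φ z)
        (pdMat (comps gm φ) z) (pdMat (remComps gs gr φ) z) := by
  have hρ : ∀ z ∈ chartDom φ ρs T, 0 < rho z := fun z hz => hz.1.1
  -- bounds for the components
  have b1 : ∀ᶠ C : ℝ in Filter.atTop, ∀ α β, ∀ z ∈ chartDom φ ρs T, |(comps gm φ z)⁻¹ α β| ≤ C :=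
    Filter.eventually_all.2 fun α => Filter.eventually_all.2 fun β =>
      (hg.gm_inv_bdd φ hφ α β).eventually_abs_le
  have b2 : ∀ᶠ C : ℝ in Filter.atTop, ∀ α β, ∀ z ∈ chartDom φ ρs T, |comps gs φ z α β| ≤ C :=
    Filter.eventually_all.2 fun α => Filter.eventually_all.2 fun β =>
      (hg.gs_bdd φ hφ α β).eventually_abs_le
  have b3 : ∀ᶠ C : ℝ in Filter.atTop, ∀ α β, ∀ z ∈ chartDom φ ρs T, |comps gr φ z α β| ≤ C :=
    Filter.eventually_all.2 fun α => Filter.eventually_all.2 fun β =>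
      (hg.gr_bdd φ hφ α β).eventually_abs_le
  have b4 : ∀ᶠ C : ℝ in Filter.atTop, ∀ μ : Option (Fin d), ∀ α β, ∀ z ∈ chartDom φ ρs T,
      |pd (some μ) (fun z => comps gm φ z α β) z| ≤ C :=
    Filter.eventually_all.2 fun μ => Filter.eventually_all.2 fun α =>
      Filter.eventually_all.2 fun β => (hg.gm_bdd φ hφ α β).eventually_abs_pd_le (by simp)
  have b5 : ∀ᶠ C : ℝ in Filter.atTop, ∀ μ : Option (Fin d), ∀ α β, ∀ z ∈ chartDom φ ρs T,
      |pd (some μ) (fun z => comps gs φ z α β) z| ≤ C :=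
    Filter.eventually_all.2 fun μ => Filter.eventually_all.2 fun α =>
      Filter.eventually_all.2 fun β => (hg.gs_bdd φ hφ α β).eventually_abs_pd_le (by simp)
  have b6 : ∀ᶠ C : ℝ in Filter.atTop, ∀ μ : Option (Fin d), ∀ α β, ∀ z ∈ chartDom φ ρs T,
      |pd (some μ) (fun z => comps gr φ z α β) z| ≤ C :=
    Filter.eventually_all.2 fun μ => Filter.eventually_all.2 fun α =>
      Filter.eventually_all.2 fun β => (hg.gr_bdd φ hφ α β).eventually_abs_pd_le (by simp)
  have b7 : ∀ᶠ C : ℝ in Filter.atTop, ∀ α β, ∀ z ∈ chartDom φ ρs T,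
      rho z * |pd none (fun z => comps gr φ z α β) z| ≤ C :=
    Filter.eventually_all.2 fun α => Filter.eventually_all.2 fun β =>
      (hg.gr_bdd φ hφ α β).eventually_rho_mul_abs_pd_le hρ
  obtain ⟨C₀, c0, c1, c2, c3, c4, c5, c6, c7, c8⟩ := ((Filter.eventually_ge_atTop (1 : ℝ)).and
    ((Filter.eventually_ge_atTop ρs).and
    (b1.and (b2.and (b3.and (b4.and (b5.and (b6.and b7)))))))).exists
  have k1 : ∀ z ∈ chartDom φ ρs T, ∀ α β, |remComps gs gr φ z α β| ≤ 2 * C₀ ^ 2 := by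
    intro z hz α β
    have hρz := hρ z hz
    have hρ1 : rho z ≤ C₀ := hz.1.2.le.trans c1
    simp only [remComps, Matrix.add_apply, Matrix.smul_apply, smul_eq_mul]
    refine (abs_add_le _ _).trans ?_
    rw [abs_mul, abs_of_pos hρz]
    calc _ ≤ C₀ + C₀ * C₀ := add_le_add (c3 α β z hz) (by have := c4 α β z hz; gcongr)
      _ ≤ _ := by nlinarith
  have k2 : ∀ z ∈ chartDom φ ρs T, ∀ μ α β, |pdMat (comps gm φ) z μ α β| ≤ 2 * C₀ ^ 2 := by
    intro z hz μ α β
    rw [pdMat, Matrix.of_apply]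
    rcases μ with _ | μ
    · rw [hg.pd_rho_gm hφ hz, abs_zero]; positivity
    · exact (c5 μ α β z hz).trans (by nlinarith)
  have k3 : ∀ z ∈ chartDom φ ρs T, ∀ μ α β,
      |pdMat (remComps gs gr φ) z μ α β| ≤ 2 * C₀ ^ 2 := by
    intro z hz μ α β
    have hρz := hρ z hz
    have hρ1 : rho z ≤ C₀ := hz.1.2.le.trans c1
    rw [pdMat, Matrix.of_apply, hg.pd_remComps hφ hz]
    rcases μ with _ | μ
    · rw [hg.pd_rho_gs hφ hz, Pi.single_eq_same, mul_one, zero_add]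
      refine (abs_add_le _ _).trans ?_
      rw [abs_mul, abs_of_pos hρz]
      have := c8 α β z hz
      have := c4 α β z hz
      nlinarith
    · rw [Pi.single_eq_of_ne (by simp), mul_zero, add_zero]
      refine (abs_add_le _ _).trans ?_
      rw [abs_mul, abs_of_pos hρz]
      calc _ ≤ C₀ + C₀ * C₀ :=
            add_le_add (c6 μ α β z hz) (by have := c7 μ α β z hz; gcongr)
        _ ≤ _ := by nlinarith
  have hd1 : 1 ≤ ((d : ℝ) + 2) := by linarith [(Nat.cast_nonneg d : (0 : ℝ) ≤ d)]
  -- Entries are bounded by `C₀ + C₀² ≤ 2 C₀²`, and a trilinear form sums over `(d+2)³` index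
  -- triples; the extra 2 is needed for the coercivity constant.
  filter_upwards [Filter.eventually_ge_atTop (((d : ℝ) + 2) ^ 3 * (2 * C₀ ^ 2) + 2)] with C hC z hz
  have hd2 : ((d : ℝ) + 2) ^ 2 ≤ ((d : ℝ) + 2) ^ 3 := pow_le_pow_right₀ hd1 (by norm_num)
  have hC1 : ((d : ℝ) + 2) ^ 2 * (2 * C₀ ^ 2) ≤ C := by
    have : ((d : ℝ) + 2) ^ 2 * (2 * C₀ ^ 2) ≤ ((d : ℝ) + 2) ^ 3 * (2 * C₀ ^ 2) := by gcongr
    linarith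
  have hC2 : ((d : ℝ) + 2) ^ 3 * (2 * C₀ ^ 2) ≤ C := by linarith
  have hCC : C₀ ≤ 2 * C₀ ^ 2 := by nlinarith
  have hC3 : ((d : ℝ) + 2) ^ 2 * C₀ + 2 ≤ C := by
    have : ((d : ℝ) + 2) ^ 2 * C₀ ≤ ((d : ℝ) + 2) ^ 3 * (2 * C₀ ^ 2) := by gcongr
    linarith
  have hA : ∀ z ∈ chartDom φ ρs T, ∀ α β, comps gm φ z α β = comps gm φ z β α :=
    fun z hz => comps_symm hg.gm_symm hz
  have hP : ∀ z ∈ chartDom φ ρs T, ∀ α β, remComps gs gr φ z α β = remComps gs gr φ z β α :=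
    fun z hz => hg.remComps_symm hz
  have hPR : ∀ z ∈ chartDom φ ρs T, ∀ X, ip (remComps gs gr φ z) eR X = 0 := fun z hz X => by
    rw [remComps, ip_add_form, ip_smul_form, hg.ip_gs_rho hz, hg.ip_gr_rho hz]; ring
  have hpos : ∀ X, X ≠ 0 → 0 < ip (comps gm φ z) X X + 2 * X (some none) ^ 2 := fun X hX => by
    rw [hg.ip_gm_self hz]
    have h0 : 0 ≤ gm (rho z) (tim z) (φ.symm (spc z)) (0, 0, spatial φ z X)
        (0, 0, spatial φ z X) := by
      rcases eq_or_ne (spatial φ z X) 0 with h | h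
      · rw [h]
        have : ((0, 0, 0) : TM d (φ.symm (spc z))) = 0 := rfl
        rw [this, map_zero]
      · exact (hg.gm_pos _ hz.1 _ hz.2.1 _ _ h).le
    by_contra hcon
    have h1 : X none = 0 := by nlinarith [sq_nonneg (X none), sq_nonneg (X (some none))]
    have h2 : X (some none) = 0 := by nlinarith [sq_nonneg (X none), sq_nonneg (X (some none))]
    have h3 : spatial φ z X = 0 := by
      by_contra h
      have := hg.gm_pos _ hz.1 _ hz.2.1 _ _ h
      rw [h1, h2] at hcon
      apply hcon
      linarith
    have h4 := spatial_injective (hg.compatible φ hφ) hz.2.2 h3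
    refine hX (funext fun i => ?_)
    rcases i with _ | _ | A
    · exact h1
    · exact h2
    · exact congrArg (fun v : Model d => v A) h4
  exact
  { one_le := by linarith [show 0 ≤ ((d : ℝ) + 2) ^ 3 * (2 * C₀ ^ 2) by positivity]
    ρ_pos := hρ z hz
    P_eq := rfl
    A_symm := hA z hz
    P_symm := hP z hz
    dA_symm := pdMat_symm hA hz
    dP_symm := pdMat_symm hP hz
    A_rho := hg.ip_gm_rho hz
    A_tim := hg.ip_gm_tim hz
    P_rho := hPR z hz
    dA_none := fun X Y => by
      unfold eR
      rw [tri_single₁]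
      unfold ip
      simp only [pdMat, Matrix.of_apply, hg.pd_rho_gm hφ hz, zero_mul, Finset.sum_const_zero]
    dA_rho := tri_pdMat_eq_zero (c := fun β => (Pi.single β 1 : SIdx d → ℝ) none)
      (fun z hz β => by
        have := hg.ip_gm_rho hz (Pi.single β 1); rwa [eR, ip_single_single] at this) hz
    dA_tim := tri_pdMat_eq_zero (c := fun β => -(Pi.single β 1 : SIdx d → ℝ) (some none))
      (fun z hz β => by
        have := hg.ip_gm_tim hz (Pi.single β 1); rwa [eT, ip_single_single] at this) hz
    dP_rho := tri_pdMat_eq_zero (c := fun β => 0)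
      (fun z hz β => by
        have := hPR z hz (Pi.single β 1); rwa [eR, ip_single_single] at this) hz
    P_le := fun X Y => (abs_ip_le X Y (k1 z hz)).trans (by gcongr)
    R_le := fun X Y => (abs_ip_le X Y fun α β => (c4 α β z hz).trans hCC).trans (by gcongr)
    dA_le := fun Z X Y => (abs_tri_le X Y Z (k2 z hz)).trans (by gcongr)
    dP_le := fun Z X Y => (abs_tri_le X Y Z (k3 z hz)).trans (by gcongr)
    coercive := fun X => (norm_sq_le_of_inv_bound (hA z hz) (hg.ip_gm_tim hz) hpos
      (fun α β => c2 α β z hz) X).trans (by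
        have : 0 ≤ ip (comps gm φ z) X X + 2 * X (some none) ^ 2 := by
          rcases eq_or_ne X 0 with rfl | h
          · simp [ip]
          · exact (hpos X h).le
        gcongr) }

end IsAdmissibleFG

end Admissible

/-! ### First and second derivatives of `f` in coordinates -/

section Foliation

theorem isOpen_tim (d : ℕ) (T : ℝ) : IsOpen {z : Coord d | tim z ∈ Ioo 0 (Real.pi * T)} :=
  isOpen_Ioo.preimage continuous_tim

variable {d : ℕ} {T ξ μ : ℝ} (hT : 0 < T) (hξ : 0 ≤ ξ) (hμ : IsMu T ξ μ) {z : Coord d}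
include hT hξ hμ

theorem hasDerivAt_inv_eta {t : ℝ} (ht : t ∈ Ioo 0 (Real.pi * T)) :
    HasDerivAt (fun s => (eta T ξ μ s)⁻¹) (-eta' T ξ μ t / eta T ξ μ t ^ 2) t :=
  (hasDerivAt_eta hT hξ hμ t).inv (eta_pos hT hξ hμ ht).ne'

theorem hasDerivAt_inv_eta' {t : ℝ} (ht : t ∈ Ioo 0 (Real.pi * T)) :
    HasDerivAt (fun s => -eta' T ξ μ s / eta T ξ μ s ^ 2)
      (-eta'' T ξ μ t / eta T ξ μ t ^ 2 + 2 * eta' T ξ μ t ^ 2 / eta T ξ μ t ^ 3) t := by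
  have h0 := (eta_pos hT hξ hμ ht).ne'
  have h1 := ((hasDerivAt_eta' hT hξ hμ ht).neg).div ((hasDerivAt_eta hT hξ hμ t).pow 2)
    (pow_ne_zero 2 h0)
  refine h1.congr_deriv ?_
  simp only [Pi.neg_apply, Pi.pow_apply]
  field_simp
  push_cast
  ring

theorem hasFDerivAt_fol (hz : tim z ∈ Ioo 0 (Real.pi * T)) :
    HasFDerivAt (fol T ξ μ) ((eta T ξ μ (tim z))⁻¹ •
        ContinuousLinearMap.proj (R := ℝ) (φ := fun _ : SIdx d => ℝ) none +
      (rho z * (-eta' T ξ μ (tim z) / eta T ξ μ (tim z) ^ 2)) •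
        ContinuousLinearMap.proj (R := ℝ) (φ := fun _ => ℝ) (some none)) z :=
  hasFDerivAt_rho_mul (hasDerivAt_inv_eta hT hξ hμ hz)

theorem pd_fol (hz : tim z ∈ Ioo 0 (Real.pi * T)) (α : SIdx d) :
    pd α (fol T ξ μ) z = (eta T ξ μ (tim z))⁻¹ * (Pi.single α 1 : SIdx d → ℝ) none +
      rho z * (-eta' T ξ μ (tim z) / eta T ξ μ (tim z) ^ 2) *
        (Pi.single α 1 : SIdx d → ℝ) (some none) :=
  HasFDerivAt.pd_eq (hasFDerivAt_fol hT hξ hμ hz) α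

theorem fol_pos (hρ : 0 < rho z) (hz : tim z ∈ Ioo 0 (Real.pi * T)) : 0 < fol T ξ μ z :=
  div_pos hρ (eta_pos hT hξ hμ hz)

theorem sum_mul_pd_fol (hρ : 0 < rho z) (hz : tim z ∈ Ioo 0 (Real.pi * T)) (X : SIdx d → ℝ) :
    ∑ α, X α * pd α (fol T ξ μ) z = dF (fol T ξ μ z) (rho z) (eta' T ξ μ (tim z)) X := by
  have h0 := (eta_pos hT hξ hμ hz).ne'
  simp only [pd_fol hT hξ hμ hz, Fintype.sum_option]
  simp [dF, fol]
  field_simp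
  ring

/-- The formula includes `t = πT/2`, because `η` is twice differentiable there. This is why
pseudoconvexity holds across the midpoint. -/
theorem hasFDerivAt_pd_fol (hz : tim z ∈ Ioo 0 (Real.pi * T)) (β : SIdx d) :
    HasFDerivAt (pd β (fol T ξ μ))
      (((Pi.single β 1 : SIdx d → ℝ) none * (-eta' T ξ μ (tim z) / eta T ξ μ (tim z) ^ 2)) •
          ContinuousLinearMap.proj (R := ℝ) (φ := fun _ : SIdx d => ℝ) (some none) +
        (Pi.single β 1 : SIdx d → ℝ) (some none) •
          ((-eta' T ξ μ (tim z) / eta T ξ μ (tim z) ^ 2) •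
            ContinuousLinearMap.proj (R := ℝ) (φ := fun _ : SIdx d => ℝ) none +
          (rho z * (-eta'' T ξ μ (tim z) / eta T ξ μ (tim z) ^ 2 +
            2 * eta' T ξ μ (tim z) ^ 2 / eta T ξ μ (tim z) ^ 3)) •
            ContinuousLinearMap.proj (R := ℝ) (φ := fun _ => ℝ) (some none))) z := by
  have h1 : HasFDerivAt (fun z : Coord d => (eta T ξ μ (tim z))⁻¹)
      ((-eta' T ξ μ (tim z) / eta T ξ μ (tim z) ^ 2) •
        ContinuousLinearMap.proj (R := ℝ) (φ := fun _ => ℝ) (some none)) z :=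
    (hasDerivAt_inv_eta hT hξ hμ hz).comp_hasFDerivAt z (hasFDerivAt_coord (some none) z)
  have h2 := hasFDerivAt_rho_mul (hasDerivAt_inv_eta' hT hξ hμ hz)
  have h3 := (h1.const_mul ((Pi.single β 1 : SIdx d → ℝ) none)).add
    (h2.const_mul ((Pi.single β 1 : SIdx d → ℝ) (some none)))
  rw [smul_smul] at h3
  refine h3.congr_of_eventuallyEq ?_
  filter_upwards [(isOpen_tim d T).mem_nhds hz] with z' hz'
  rw [pd_fol hT hξ hμ hz']
  simp only [Pi.add_apply]
  ring

theorem ip_second_fol (hρ : 0 < rho z) (hz : tim z ∈ Ioo 0 (Real.pi * T)) (X Y : SIdx d → ℝ) :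
    ip (Matrix.of fun α β => pd α (pd β (fol T ξ μ)) z) X Y =
      secondF (fol T ξ μ z) (rho z) (eta' T ξ μ (tim z)) (eta'' T ξ μ (tim z)) X Y := by
  have h0 := (eta_pos hT hξ hμ hz).ne'
  have h1 : ∀ α β, pd α (pd β (fol T ξ μ)) z = _ :=
    fun α β => HasFDerivAt.pd_eq (hasFDerivAt_pd_fol hT hξ hμ hz β) α
  unfold ip
  simp only [Matrix.of_apply, h1, Fintype.sum_option]
  simp [secondF, fol]
  field_simp
  ring

end Foliation

/-! ### Gradient, Hessian and deformation tensor of the actual metric -/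

section Geometry

variable {d : ℕ} {T ξ μ : ℝ} (hT : 0 < T) (hξ : 0 ≤ ξ) (hμ : IsMu T ξ μ) {z : Coord d}
  {G : Coord d → Matrix (SIdx d) (SIdx d) ℝ} {C : ℝ} {A B R P : Matrix (SIdx d) (SIdx d) ℝ}
  {dA dP : SIdx d → Matrix (SIdx d) (SIdx d) ℝ} {ζ : Coord d → ℝ}

theorem eq_of_ip_eq {M : Matrix (SIdx d) (SIdx d) ℝ} (hM : ∀ α β, M α β = M β α)
    (hu : IsUnit M.det) {X Y : SIdx d → ℝ} (h : ∀ Z, ip M X Z = ip M Y Z) : X = Y := by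
  rw [← Matrix.isUnit_iff_isUnit_det, ← Matrix.mulVec_injective_iff_isUnit] at hu
  refine hu (funext fun α => ?_)
  have := h (Pi.single α 1)
  rw [ip_comm _ _ hM, ip_comm Y _ hM, ip_eq_dotProduct, ip_eq_dotProduct, single_one_dotProduct,
    single_one_dotProduct] at this
  exact this

/-- Raising both indices amounts to evaluating the tensor on the vector dual to `θ`, which can then
be expanded in the frame. -/
theorem defContraction_eq_ip (hG : ∀ α β, G z α β = G z β α) (θ : SIdx d → ℝ) :
    defContraction G T ξ μ ζ z θ = ip (defTensor G T ξ μ ζ z) ((G z)⁻¹.mulVec θ)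
      ((G z)⁻¹.mulVec θ) := by
  unfold defContraction ip Matrix.mulVec dotProduct
  simp only [Finset.sum_mul, Finset.mul_sum]
  -- reorder the sums
  have h1 : ∀ F : SIdx d → SIdx d → SIdx d → SIdx d → ℝ,
      ∑ a, ∑ b, ∑ c, ∑ e, F a b c e = ∑ c, ∑ e, ∑ b, ∑ a, F a b c e := fun F => by
    calc ∑ a, ∑ b, ∑ c, ∑ e, F a b c e = ∑ a, ∑ c, ∑ e, ∑ b, F a b c e := by
          refine Finset.sum_congr rfl fun a _ => ?_
          rw [Finset.sum_comm]
          exact Finset.sum_congr rfl fun c _ => Finset.sum_comm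
      _ = ∑ c, ∑ a, ∑ e, ∑ b, F a b c e := Finset.sum_comm
      _ = ∑ c, ∑ e, ∑ a, ∑ b, F a b c e := Finset.sum_congr rfl fun c _ => Finset.sum_comm
      _ = _ := Finset.sum_congr rfl fun c _ => Finset.sum_congr rfl fun e _ => Finset.sum_comm
  rw [h1]
  refine Finset.sum_congr rfl fun c _ => Finset.sum_congr rfl fun e _ =>
    Finset.sum_congr rfl fun b _ => Finset.sum_congr rfl fun a _ => ?_
  rw [inv_symm hG a c, inv_symm hG b e]
  ring

include hT hξ hμ

/-- Differentiating the weight `f^{n-3}` in `S` adds `(n-3)/f` times the square of `df`; here `n - 3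
= d - 2`. -/
theorem ip_defTensor (hρ : 0 < rho z) (hz : tim z ∈ Ioo 0 (Real.pi * T)) (Z : SIdx d → ℝ) :
    ip (defTensor G T ξ μ ζ z) Z Z =
      -(fol T ξ μ z ^ ((d : ℤ) + 1 - 3) * (ip (hess G (fol T ξ μ) z) Z Z
        + wfun T ξ μ ζ z * ip (G z) Z Z + ((d : ℝ) - 2) / fol T ξ μ z *
          dF (fol T ξ μ z) (rho z) (eta' T ξ μ (tim z)) Z ^ 2)) := by
  have hf := fol_pos hT hξ hμ hρ hz
  set f := fol T ξ μ z with hfdef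
  have h1 : ∀ α β, pd α (fun z' => Sform T ξ μ z' β) z =
      f ^ ((d : ℤ) + 1 - 3) * pd α (pd β (fol T ξ μ)) z +
        ((d : ℝ) - 2) / f * f ^ ((d : ℤ) + 1 - 3) * (pd α (fol T ξ μ) z * pd β (fol T ξ μ) z) :=
    fun α β => by
      have a1 := (hasDerivAt_zpow ((d : ℤ) + 1 - 3) f (Or.inl hf.ne')).comp_hasFDerivAt z
        (hasFDerivAt_fol hT hξ hμ hz)
      have a2 := a1.mul (hasFDerivAt_pd_fol hT hξ hμ hz β)
      have a3 := HasFDerivAt.pd_eq a2 α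
      have a4 := HasFDerivAt.pd_eq (hasFDerivAt_pd_fol hT hξ hμ hz β) α
      have a5 := HasFDerivAt.pd_eq (hasFDerivAt_fol hT hξ hμ hz) α
      refine Eq.trans a3 ?_
      rw [add_apply, smul_apply, smul_apply, smul_apply, ← a4, ← a5, zpow_sub_one₀ hf.ne']
      simp only [Function.comp, smul_eq_mul, ← hfdef]
      push_cast
      field_simp
      ring
  have h2 : covD G (Sform T ξ μ) z = f ^ ((d : ℤ) + 1 - 3) • hess G (fol T ξ μ) z +
      (((d : ℝ) - 2) / f * f ^ ((d : ℤ) + 1 - 3)) •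
        Matrix.of fun α β => pd α (fol T ξ μ) z * pd β (fol T ξ μ) z := by
    ext α β
    simp only [covD, hess, Matrix.of_apply, Matrix.add_apply, Matrix.smul_apply, smul_eq_mul]
    rw [h1]
    have h3 : ∑ ν, christoffel G z ν α β * Sform T ξ μ z ν =
        f ^ ((d : ℤ) + 1 - 3) * ∑ ν, christoffel G z ν α β * pd ν (fol T ξ μ) z := by
      rw [Finset.mul_sum]
      exact Finset.sum_congr rfl fun ν _ => by unfold Sform; ring
    rw [h3]
    ring
  have h4 : ip (Matrix.of fun α β => pd α (fol T ξ μ) z * pd β (fol T ξ μ) z) Z Z =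
      dF f (rho z) (eta' T ξ μ (tim z)) Z ^ 2 := by
    rw [hfdef, ← sum_mul_pd_fol hT hξ hμ hρ hz, sq, Finset.sum_mul_sum]
    unfold ip
    refine Finset.sum_congr rfl fun α _ => Finset.sum_congr rfl fun β _ => ?_
    rw [Matrix.of_apply]; ring
  unfold defTensor
  rw [ip_neg_form, ip_add_form, h2, ip_add_form, ip_smul_form, ip_smul_form, ip_smul_form, h4]
  ring

variable (hP : PointData C (rho z) A B R P dA dP) (hGz : G z = (rho z ^ 2)⁻¹ • A + P)
  (hD : ∀ Z X Y, tri (pdMat G z) Z X Y = triG (rho z) A dA dP Z X Y) {j : SIdx d → ℝ}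
  (hj : ∀ X, ip A j X + rho z ^ 2 * ip P j X = rho z ^ 2 * ip P eT X)
  (hC : 6 * C ^ 2 * rho z ^ 2 ≤ 1)
include hP hGz hj hC

theorem grad_fol (hz : tim z ∈ Ioo 0 (Real.pi * T)) :
    grad G (fol T ξ μ) z = gradF (fol T ξ μ z) (rho z) (eta' T ξ μ (tim z)) j := by
  have hs : ∀ α β, G z α β = G z β α := fun α β => by rw [hGz]; exact hP.metric_symm α β
  have hu : IsUnit (G z).det := by rw [hGz]; exact hP.isUnit_det hC
  refine eq_of_ip_eq hs hu fun Z => ?_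
  rw [ip_grad (fol T ξ μ) hu hs, sum_mul_pd_fol hT hξ hμ hP.ρ_pos hz, hGz, hP.ip_gradF hj]

theorem gradSq_fol (hj0 : j none = 0) (hz : tim z ∈ Ioo 0 (Real.pi * T)) :
    gradSq G (fol T ξ μ) z = sqF (fol T ξ μ z) (eta' T ξ μ (tim z)) j := by
  unfold gradSq
  rw [sum_mul_pd_fol hT hξ hμ hP.ρ_pos hz, grad_fol hT hξ hμ hP hGz hj hC hz, hP.dF_gradF hj0]

include hD in
theorem ip_hess_fol (hz : tim z ∈ Ioo 0 (Real.pi * T)) (X Y : SIdx d → ℝ) :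
    ip (hess G (fol T ξ μ) z) X Y = hessF (fol T ξ μ z) (rho z) (eta' T ξ μ (tim z))
      (eta'' T ξ μ (tim z)) A dA dP j X Y := by
  have hs : ∀ α β, G z α β = G z β α := fun α β => by rw [hGz]; exact hP.metric_symm α β
  rw [ip_hess X Y (fol T ξ μ) hs (pdMat G z) (fun _ _ _ => rfl),
    ip_second_fol hT hξ hμ hP.ρ_pos hz, grad_fol hT hξ hμ hP hGz hj hC hz, hD, hD, hD]
  rfl

end Geometry

/-! ### Symbol bounds for the error terms -/

section Symbols

theorem pd_add {d : ℕ} {u v : Coord d → ℝ} {z : Coord d} (hu : DifferentiableAt ℝ u z)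
    (hv : DifferentiableAt ℝ v z) (α : SIdx d) :
    pd α (fun z => u z + v z) z = pd α u z + pd α v z :=
  HasFDerivAt.pd_eq (hu.hasFDerivAt.add hv.hasFDerivAt) α

theorem pd_mul {d : ℕ} {u v : Coord d → ℝ} {z : Coord d} (hu : DifferentiableAt ℝ u z)
    (hv : DifferentiableAt ℝ v z) (α : SIdx d) :
    pd α (fun z => u z * v z) z = u z * pd α v z + v z * pd α u z :=
  HasFDerivAt.pd_eq (hu.hasFDerivAt.mul hv.hasFDerivAt) α

/-- The sign of `η'`. -/
def etaSign (T t : ℝ) : ℝ := if t < Real.pi * T / 2 then 1 else -1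

theorem contDiffAt_ite_lt {m t : ℝ} (ht : t ≠ m) {p q : ℝ → ℝ} (hp : ContDiff ℝ ∞ p)
    (hq : ContDiff ℝ ∞ q) : ContDiffAt ℝ ∞ (fun s => if s < m then p s else q s) t := by
  rcases ht.lt_or_gt with h | h
  · refine hp.contDiffAt.congr_of_eventuallyEq ?_
    filter_upwards [eventually_lt_nhds h] with s hs
    simp [hs]
  · refine hq.contDiffAt.congr_of_eventuallyEq ?_
    filter_upwards [eventually_gt_nhds h] with s hs
    simp [not_lt.2 hs.le]

theorem contDiff_etaHalf (ξ μ : ℝ) : ContDiff ℝ ∞ (etaHalf ξ μ) := by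
  unfold etaHalf; fun_prop

theorem contDiff_etaHalf' (ξ μ : ℝ) : ContDiff ℝ ∞ (etaHalf' ξ μ) := by
  unfold etaHalf'; fun_prop

variable {d : ℕ} (T ξ μ : ℝ)

theorem contDiffAt_eta {t : ℝ} (ht : t ≠ Real.pi * T / 2) : ContDiffAt ℝ ∞ (eta T ξ μ) t :=
  contDiffAt_ite_lt ht (contDiff_etaHalf ξ μ)
    ((contDiff_etaHalf ξ μ).comp (contDiff_const.sub contDiff_id))

theorem contDiffAt_eta' {t : ℝ} (ht : t ≠ Real.pi * T / 2) : ContDiffAt ℝ ∞ (eta' T ξ μ) t :=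
  contDiffAt_ite_lt ht (contDiff_etaHalf' ξ μ)
    ((contDiff_etaHalf' ξ μ).comp (contDiff_const.sub contDiff_id)).neg

theorem contDiffAt_etaSign {t : ℝ} (ht : t ≠ Real.pi * T / 2) : ContDiffAt ℝ ∞ (etaSign T) t :=
  contDiffAt_ite_lt ht contDiff_const contDiff_const

/-- The algebra of functions generated by `ρ`, `f`, `η`, `η'` and the sign of `η'`. -/
inductive Symbol : (Coord d → ℝ) → Prop
  | const (c : ℝ) : Symbol fun _ => c
  | rhoFun : Symbol rho
  | folFun : Symbol (fol T ξ μ)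
  | etaFun : Symbol fun z => eta T ξ μ (tim z)
  | etaDeriv : Symbol fun z => eta' T ξ μ (tim z)
  | sign : Symbol fun z => etaSign T (tim z)
  | add {p q : Coord d → ℝ} : Symbol p → Symbol q → Symbol fun z => p z + q z
  | mul {p q : Coord d → ℝ} : Symbol p → Symbol q → Symbol fun z => p z * q z

variable {T ξ μ} {D : Set (Coord d)} {ρs f₀ : ℝ} (hT : 0 < T) (hξ : 0 ≤ ξ) (hμ : IsMu T ξ μ)
  (hDo : IsOpen D) (hD : ∀ z ∈ D, rho z ∈ Ioo 0 ρs ∧ tim z ∈ Ioo 0 (Real.pi * T) ∧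
    tim z ≠ Real.pi * T / 2 ∧ fol T ξ μ z < f₀)
include hT hξ hμ

theorem abs_eta'_eq {t : ℝ} (ht : t ∈ Ioo 0 (Real.pi * T)) :
    |eta' T ξ μ t| = etaSign T t * eta' T ξ μ t := by
  unfold eta' etaSign
  split_ifs with h
  · rw [abs_of_nonneg (etaHalf'_nonneg hT hξ hμ ht.1 h.le), one_mul]
  · rw [abs_neg, abs_of_nonneg (etaHalf'_nonneg hT hξ hμ (by linarith [ht.2]) (by linarith))]
    ring

include hD

theorem Symbol.contDiffAt {p : Coord d → ℝ} (hp : Symbol T ξ μ p) {z : Coord d} (hz : z ∈ D) :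
    ContDiffAt ℝ ∞ p z := by
  have hr : ContDiffAt ℝ ∞ (rho : Coord d → ℝ) z := (contDiff_apply ℝ ℝ none).contDiffAt
  have ht : ContDiffAt ℝ ∞ (tim : Coord d → ℝ) z := (contDiff_apply ℝ ℝ (some none)).contDiffAt
  have hz' := hD z hz
  induction hp with
  | const c => exact contDiffAt_const
  | rhoFun => exact hr
  | folFun => exact hr.div ((contDiffAt_eta T ξ μ hz'.2.2.1).comp z ht) (eta_pos hT hξ hμ hz'.2.1).ne'
  | etaFun => exact (contDiffAt_eta T ξ μ hz'.2.2.1).comp z ht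
  | etaDeriv => exact (contDiffAt_eta' T ξ μ hz'.2.2.1).comp z ht
  | sign => exact (contDiffAt_etaSign T hz'.2.2.1).comp z ht
  | add _ _ h1 h2 => exact h1.add h2
  | mul _ _ h1 h2 => exact h1.mul h2

theorem Symbol.differentiableAt {p : Coord d → ℝ} (hp : Symbol T ξ μ p) {z : Coord d}
    (hz : z ∈ D) : DifferentiableAt ℝ p z :=
  (hp.contDiffAt hT hξ hμ hD hz).differentiableAt (by simp)

theorem Symbol.exists_bound {p : Coord d → ℝ} (hp : Symbol T ξ μ p) :
    ∃ M, ∀ z ∈ D, |p z| ≤ M := by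
  obtain ⟨M, hM⟩ := exists_eta_bound T μ hξ
  induction hp with
  | const c => exact ⟨|c|, fun _ _ => le_rfl⟩
  | rhoFun => exact ⟨ρs, fun z hz => by
      rw [abs_of_pos (hD z hz).1.1]; exact (hD z hz).1.2.le⟩
  | folFun => exact ⟨f₀, fun z hz => by
      rw [abs_of_pos (fol_pos hT hξ hμ (hD z hz).1.1 (hD z hz).2.1)]; exact (hD z hz).2.2.2.le⟩
  | etaFun => exact ⟨M, fun z hz => (hM _ (hD z hz).2.1).1⟩
  | etaDeriv => exact ⟨M, fun z hz => (hM _ (hD z hz).2.1).2.1⟩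
  | sign => exact ⟨1, fun z hz => by
      change |etaSign T (tim z)| ≤ 1
      unfold etaSign; split_ifs <;> simp⟩
  | add _ _ h1 h2 =>
    obtain ⟨M1, h1⟩ := h1
    obtain ⟨M2, h2⟩ := h2
    exact ⟨M1 + M2, fun z hz => (abs_add_le _ _).trans (add_le_add (h1 z hz) (h2 z hz))⟩
  | mul _ _ h1 h2 =>
    obtain ⟨M1, h1⟩ := h1
    obtain ⟨M2, h2⟩ := h2
    refine ⟨M1 * M2, fun z hz => ?_⟩
    rw [abs_mul]
    exact mul_le_mul (h1 z hz) (h2 z hz) (abs_nonneg _) ((abs_nonneg _).trans (h1 z hz))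

theorem rho_mul_pd_fol {z : Coord d} (hz : z ∈ D) (α : SIdx d) :
    rho z * pd α (fol T ξ μ) z = fol T ξ μ z * (Pi.single α 1 : SIdx d → ℝ) none +
      -1 * (fol T ξ μ z * (fol T ξ μ z * (eta' T ξ μ (tim z) *
        (Pi.single α 1 : SIdx d → ℝ) (some none)))) := by
  have h0 := (eta_pos hT hξ hμ (hD z hz).2.1).ne'
  rw [pd_fol hT hξ hμ (hD z hz).2.1]
  unfold fol
  field_simp

/-- The algebra is closed under `ρ ∂_α` for every coordinate. For `f` this holds since `ρ df = f dρ
- f² η' dt`; for `η'` the sign is included among the generators so that `|η'|` stays in the algebra,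
and that sign is locally constant away from the midpoint. -/
theorem Symbol.exists_rho_mul_pd {p : Coord d → ℝ} (hp : Symbol T ξ μ p) (α : SIdx d) :
    ∃ q, Symbol T ξ μ q ∧ ∀ z ∈ D, rho z * pd α p z = q z := by
  have ht : ∀ {b : ℝ → ℝ} {b' : ℝ} {z : Coord d}, HasDerivAt b b' (tim z) →
      pd α (fun z => b (tim z)) z = b' * (Pi.single α 1 : SIdx d → ℝ) (some none) :=
    fun hb => HasFDerivAt.pd_eq (hb.comp_hasFDerivAt _ (hasFDerivAt_coord (some none) _)) α
  induction hp with
  | const c => exact ⟨_, .const 0, fun z _ => by simp [pd]⟩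
  | rhoFun =>
    refine ⟨_, .mul .rhoFun (.const ((Pi.single α 1 : SIdx d → ℝ) none)), fun z _ => ?_⟩
    rw [show pd α rho z = (Pi.single α 1 : SIdx d → ℝ) none from
      HasFDerivAt.pd_eq (hasFDerivAt_coord none z) α]
  | folFun =>
    exact ⟨_, .add (.mul .folFun (.const _)) (.mul (.const (-1)) (.mul .folFun (.mul .folFun
      (.mul .etaDeriv (.const _))))), fun z hz => rho_mul_pd_fol hT hξ hμ hD hz α⟩
  | etaFun =>
    refine ⟨_, .mul .rhoFun (.mul .etaDeriv (.const ((Pi.single α 1 : SIdx d → ℝ) (some none)))),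
      fun z _ => ?_⟩
    rw [ht (hasDerivAt_eta hT hξ hμ _)]
  | etaDeriv =>
    refine ⟨_, .mul .rhoFun (.mul (.add (.mul (.const (ξ / 2)) (.mul .sign .etaDeriv))
      (.mul (.const (-(μ ^ 2 + ξ ^ 2 / 16))) .etaFun))
      (.const ((Pi.single α 1 : SIdx d → ℝ) (some none)))), fun z hz => ?_⟩
    rw [ht (hasDerivAt_eta' hT hξ hμ (hD z hz).2.1), eta'',
      abs_eta'_eq hT hξ hμ (hD z hz).2.1]
    ring
  | sign =>
    refine ⟨_, .const 0, fun z hz => ?_⟩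
    have h1 : HasDerivAt (etaSign T) 0 (tim z) := by
      rcases (hD z hz).2.2.1.lt_or_gt with h | h
      · refine (hasDerivAt_const _ (1 : ℝ)).congr_of_eventuallyEq ?_
        filter_upwards [eventually_lt_nhds h] with s hs
        simp [etaSign, hs]
      · refine (hasDerivAt_const _ (-1 : ℝ)).congr_of_eventuallyEq ?_
        filter_upwards [eventually_gt_nhds h] with s hs
        simp [etaSign, not_lt.2 hs.le]
    rw [ht h1]; ring
  | add hp hq h1 h2 =>
    obtain ⟨p', hp', h1⟩ := h1
    obtain ⟨q', hq', h2⟩ := h2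
    refine ⟨_, .add hp' hq', fun z hz => ?_⟩
    rw [pd_add (hp.differentiableAt hT hξ hμ hD hz) (hq.differentiableAt hT hξ hμ hD hz), mul_add,
      h1 z hz, h2 z hz]
  | @mul p q hp hq h1 h2 =>
    obtain ⟨p', hp', h1⟩ := h1
    obtain ⟨q', hq', h2⟩ := h2
    refine ⟨_, .add (.mul hp hq') (.mul hq hp'), fun z hz => ?_⟩
    rw [pd_mul (hp.differentiableAt hT hξ hμ hD hz) (hq.differentiableAt hT hξ hμ hD hz),
      ← h1 z hz, ← h2 z hz]
    ring

include hDo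

/-- Each derivative costs exactly one power of `ρ` and keeps the power of `f`, the coefficient
remaining in the bounded algebra. This is the shape of an `𝒪₀` estimate. -/
theorem exists_pdList_eq {u : Coord d → ℝ} {a k : ℤ} {q₀ : Coord d → ℝ} (hq₀ : Symbol T ξ μ q₀)
    (hu : ∀ z ∈ D, u z = rho z ^ a * fol T ξ μ z ^ k * q₀ z) (L : List (SIdx d)) :
    ∃ q, Symbol T ξ μ q ∧ ∀ z ∈ D,
      pdList L u z = rho z ^ (a - L.length) * fol T ξ μ z ^ k * q z := by
  induction L with
  | nil => exact ⟨q₀, hq₀, fun z hz => by simpa [pdList] using hu z hz⟩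
  | cons α L ih =>
    obtain ⟨q, hq, h⟩ := ih
    obtain ⟨q', hq', h'⟩ := hq.exists_rho_mul_pd hT hξ hμ hD α
    set b : ℤ := a - L.length with hb
    -- The new coefficient comes from `ρ d(ρ^b f^k) = ρ^b f^k ((b + k) dρ - k f η' dt)`, together
    -- with `ρ` times the derivative of the old one.
    refine ⟨_, .add (.mul (.add (.const ((b + k : ℝ) * (Pi.single α 1 : SIdx d → ℝ) none))
      (.mul (.const (-(k * (Pi.single α 1 : SIdx d → ℝ) (some none)))) (.mul .folFun .etaDeriv))) hq) hq',
      fun z hz => ?_⟩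
    have hρ := (hD z hz).1.1
    have hf := fol_pos hT hξ hμ hρ (hD z hz).2.1
    have h1 : pd α (pdList L u) z = pd α (fun z => rho z ^ b * fol T ξ μ z ^ k * q z) z := by
      refine pd_congr ?_ α
      filter_upwards [hDo.mem_nhds hz] with z' hz' using h z' hz'
    have a1 := (hasDerivAt_zpow b (rho z) (Or.inl hρ.ne')).comp_hasFDerivAt z
      (hasFDerivAt_coord none z)
    have a2 := (hasDerivAt_zpow k (fol T ξ μ z) (Or.inl hf.ne')).comp_hasFDerivAt z
      (hasFDerivAt_fol hT hξ hμ (hD z hz).2.1)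
    have a3 := (a1.mul a2).mul (hq.differentiableAt hT hξ hμ hD hz).hasFDerivAt
    have a4 := HasFDerivAt.pd_eq (hasFDerivAt_fol hT hξ hμ (hD z hz).2.1) α
    have a5 := rho_mul_pd_fol hT hξ hμ hD hz α
    have a6 : pd α (fol T ξ μ) z = (rho z)⁻¹ *
        (fol T ξ μ z * (Pi.single α 1 : SIdx d → ℝ) none +
        -1 * (fol T ξ μ z * (fol T ξ μ z * (eta' T ξ μ (tim z) *
          (Pi.single α 1 : SIdx d → ℝ) (some none))))) := by
      rw [← a5]; field_simp
    have a7 : pd α q z = (rho z)⁻¹ * q' z := by rw [← h' z hz]; field_simp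
    have e1 : a - ((α :: L).length : ℤ) = b - 1 := by
      rw [hb]; push_cast [List.length_cons]; ring
    rw [pdList, h1, e1]
    refine (HasFDerivAt.pd_eq a3 α).trans ?_
    simp only [add_apply, smul_apply, ← a4, smul_eq_mul, Function.comp, a6,
      ContinuousLinearMap.proj_apply, Pi.mul_apply]
    rw [show fderiv ℝ q z (Pi.single α 1) = pd α q z from rfl, a7, zpow_sub_one₀ hρ.ne',
      zpow_sub_one₀ hf.ne']
    field_simp
    ring

/-- Powers of `f` and `ρ` are symbols of their own size. -/
theorem isO₀_fol_mul_rho (k p : ℕ) (c : ℝ) :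
    IsO₀ D (fun z => fol T ξ μ z ^ k * rho z ^ p) (fun z => c * (fol T ξ μ z ^ k * rho z ^ p)) := by
  refine ⟨fun z hz => ?_, fun L => ?_⟩
  · have h1 := Symbol.contDiffAt hT hξ hμ hD (Symbol.folFun (d := d)) hz
    have h2 := Symbol.contDiffAt hT hξ hμ hD (Symbol.rhoFun (d := d)) hz
    exact (contDiffAt_const.mul ((h1.pow k).mul (h2.pow p))).contDiffWithinAt
  · obtain ⟨q, hq, h⟩ := exists_pdList_eq hT hξ hμ hDo hD (a := p) (k := k) (.const c)
      (u := fun z => c * (fol T ξ μ z ^ k * rho z ^ p))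
      (fun z _ => by simp only [zpow_natCast]; ring) L
    obtain ⟨M, hM⟩ := hq.exists_bound hT hξ hμ hD
    refine ⟨M, fun z hz => ?_⟩
    have hρ := (hD z hz).1.1
    have hf := fol_pos hT hξ hμ hρ (hD z hz).2.1
    rw [h z hz, abs_mul, abs_of_pos (by positivity), sub_eq_add_neg, zpow_add₀ hρ.ne', zpow_natCast,
      zpow_natCast]
    calc _ ≤ rho z ^ p * rho z ^ (-(L.length : ℤ)) * fol T ξ μ z ^ k * M := by
          gcongr; exact hM z hz
      _ = _ := by ring

end Symbols

/-! ### Transfer of the boundary conditions to charts, and the two conclusions -/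

section Assembly

variable {d : ℕ} {S : Type*} [TopologicalSpace S] [ChartedSpace (Model d) S]
  {ρs T : ℝ} {g gm gs gr : Tensor2 d S} {Ξ : Set (OpenPartialHomeomorph S (Model d))}
  {φ : OpenPartialHomeomorph S (Model d)} {z : Coord d} {K ξ μ : ℝ} {ζ : ℝ → ℝ → S → ℝ}

namespace IsAdmissibleFG

variable (hg : IsAdmissibleFG ρs T g gm gs gr Ξ)
  (hpc : PseudoconvexityProperty ρs T gm gs Ξ K ξ μ ζ)
include hg hpc

theorem abs_tri_tim_le (hφ : φ ∈ Ξ) (hz : z ∈ chartDom φ ρs T) (X : SIdx d → ℝ) :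
    |tri (pdMat (comps gm φ) z) eT X X| ≤
      ξ * (posForm (comps gm φ z) X - X (some none) ^ 2) := by
  rw [← (hg.hasDerivAt_gm_tim hφ hz X).deriv, posForm, hg.ip_gm_self hz]
  refine (hpc.nonstatic _ hz.1 _ hz.2.1 _ _).trans (le_of_eq ?_)
  ring

/-- The condition concerns vectors tangent to the boundary. It extends to every `X`, since `posForm`
and `gs` do not see the `ρ`-component. -/
theorem mul_posForm_le (hz : z ∈ chartDom φ ρs T) (X : SIdx d → ℝ) :
    K * posForm (comps gm φ z) X ≤
      -ip (comps gs φ z) X X - (μ ^ 2 + ξ ^ 2 / 16) * X (some none) ^ 2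
        - inChart ζ φ z * (posForm (comps gm φ z) X - 2 * X (some none) ^ 2) := by
  have h1 := hpc.positive _ hz.1 _ hz.2.1 (φ.symm (spc z)) (X (some none), spatial φ z X)
  have h2 : ip (comps gs φ z) X X = gs (rho z) (tim z) (φ.symm (spc z))
      (0, X (some none), spatial φ z X) (0, X (some none), spatial φ z X) := by
    have e : ((X none, X (some none), spatial φ z X) : TM d (φ.symm (spc z))) =
        X none • ((1, 0, 0) : TM d (φ.symm (spc z))) + (0, X (some none), spatial φ z X) := by
      refine Prod.ext ?_ (Prod.ext ?_ ?_) <;> simp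
    have h3 := hg.gs_tangent _ hz.1 _ hz.2.1 (φ.symm (spc z))
    have h4 := fun Y => (hg.gs_symm _ hz.1 _ hz.2.1 (φ.symm (spc z)) Y (1, 0, 0)).trans (h3 Y)
    rw [ip_comps, e]
    simp only [map_add, map_smul, LinearMap.add_apply, LinearMap.smul_apply, h3, h4, smul_zero,
      zero_add, add_zero]
  rw [posForm, hg.ip_gm_self hz, h2]
  rw [hg.gm_form _ hz.1 _ hz.2.1 _ (0, X (some none), spatial φ z X)] at h1
  simp only [inChart]
  convert h1 using 1 <;> ring

end IsAdmissibleFG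

theorem scalarData_fol {C c : ℝ} (hT : 0 < T) (hξ : 0 ≤ ξ) (hμ : IsMu T ξ μ) (hρ : 0 < rho z)
    (ht : tim z ∈ Ioo 0 (Real.pi * T)) (hM : |eta T ξ μ (tim z)| ≤ C ∧ |eta' T ξ μ (tim z)| ≤ C ∧
      |eta'' T ξ μ (tim z)| ≤ C) (hξC : ξ ≤ C) {u : Coord d → ℝ} (hu : |u z| ≤ C)
    (hc : 1000 * C ^ 10 * c ≤ 1) (hC : 0 ≤ C) (hf : fol T ξ μ z ≤ c) :
    ScalarData C (fol T ξ μ z) (rho z) (eta T ξ μ (tim z)) (eta' T ξ μ (tim z))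
      (eta'' T ξ μ (tim z)) ξ (μ ^ 2 + ξ ^ 2 / 16) (u z) (wfun T ξ μ u z) := by
  have h0 := eta_pos hT hξ hμ ht
  have hf0 := fol_pos hT hξ hμ hρ ht
  have hm : fol T ξ μ z * eta T ξ μ (tim z) = rho z := div_mul_cancel₀ _ h0.ne'
  refine ⟨hf0, hm, ?_, ?_, hM.2.1, hM.2.2, hu, hξ, hξC, rfl, ?_⟩
  · rw [← hm, mul_comm]
    exact mul_le_mul_of_nonneg_right ((le_abs_self _).trans hM.1) hf0.le
  · exact (mul_le_mul_of_nonneg_left hf (mul_nonneg (by norm_num) (pow_nonneg hC 10))).trans hc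
  · rw [wfun, deriv_eta hT hξ hμ, fol]
    field_simp

theorem isOpen_smoothRegion (hT : 0 < T) (hξ : 0 ≤ ξ) (hμ : IsMu T ξ μ)
    (φ : OpenPartialHomeomorph S (Model d)) (ρs f₀ : ℝ) :
    IsOpen (smoothRegion φ ρs T ξ μ f₀) := by
  have h1 : ContinuousOn (fol T ξ μ : Coord d → ℝ) (chartDom φ ρs T) := fun z hz =>
    (hasFDerivAt_fol hT hξ hμ hz.2.1).continuousAt.continuousWithinAt
  have h2 := h1.isOpen_inter_preimage (isOpen_chartDom φ ρs T) (isOpen_Iio (a := f₀))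
  have h3 : IsOpen {z : Coord d | tim z ≠ Real.pi * T / 2} :=
    isOpen_ne.preimage continuous_tim
  convert h2.inter h3 using 1
  ext z
  simp only [smoothRegion, mem_ofPred_eq, mem_inter_iff, mem_preimage, mem_Iio]
  tauto

/-- A constant controlling all the geometric data in all the charts. -/
theorem exists_uniform_bound [IsManifold (𝓡 d) ∞ S] (hg : IsAdmissibleFG ρs T g gm gs gr Ξ)
    (hpc : PseudoconvexityProperty ρs T gm gs Ξ K ξ μ ζ) :
    ∃ C : ℝ, 1 ≤ C ∧ ξ ≤ C ∧ K ≤ C ∧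
      (∀ t ∈ Ioo 0 (Real.pi * T), |eta T ξ μ t| ≤ C ∧ |eta' T ξ μ t| ≤ C ∧ |eta'' T ξ μ t| ≤ C) ∧
      ∀ φ ∈ Ξ, ∀ z ∈ chartDom φ ρs T, |inChart ζ φ z| ≤ C ∧
        PointData C (rho z) (comps gm φ z) (comps gs φ z) (comps gr φ z) (remComps gs gr φ z)
          (pdMat (comps gm φ) z) (pdMat (remComps gs gr φ) z) := by
  obtain ⟨M, hM⟩ := exists_eta_bound T μ hpc.ξ_nonneg
  have h1 : ∀ᶠ C : ℝ in Filter.atTop, ∀ φ ∈ Ξ, ∀ z ∈ chartDom φ ρs T, |inChart ζ φ z| ≤ C :=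
    (Filter.eventually_all_finite hg.finite).2 fun φ hφ => (hpc.ζ_bdd φ hφ).eventually_abs_le
  have h2 := (Filter.eventually_all_finite hg.finite).2 fun φ hφ => hg.exists_pointData hφ
  obtain ⟨C, c1, c2, c3, c4, c5, c6⟩ := ((Filter.eventually_ge_atTop (1 : ℝ)).and
    ((Filter.eventually_ge_atTop ξ).and ((Filter.eventually_ge_atTop K).and
      ((Filter.eventually_ge_atTop M).and (h1.and h2))))).exists
  exact ⟨C, c1, c2, c3, fun t ht => ⟨(hM t ht).1.trans c4, (hM t ht).2.1.trans c4,
    (hM t ht).2.2.trans c4⟩, fun φ hφ z hz => ⟨c5 φ hφ z hz, c6 φ hφ z hz⟩⟩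

theorem levelSetPseudoconvexAt_fol {C : ℝ} {G : Coord d → Matrix (SIdx d) (SIdx d) ℝ}
    {A B R P : Matrix (SIdx d) (SIdx d) ℝ} {dA dP : SIdx d → Matrix (SIdx d) (SIdx d) ℝ} {c w : ℝ}
    (hT : 0 < T) (hξ : 0 ≤ ξ) (hμ : IsMu T ξ μ) (hz : tim z ∈ Ioo 0 (Real.pi * T))
    (hP : PointData C (rho z) A B R P dA dP) (hGz : G z = (rho z ^ 2)⁻¹ • A + P)
    (hD : ∀ Z X Y, tri (pdMat G z) Z X Y = triG (rho z) A dA dP Z X Y)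
    (s : ScalarData C (fol T ξ μ z) (rho z) (eta T ξ μ (tim z)) (eta' T ξ μ (tim z))
      (eta'' T ξ μ (tim z)) ξ (μ ^ 2 + ξ ^ 2 / 16) c w)
    (hns : ∀ X, |tri dA eT X X| ≤ ξ * (posForm A X - X (some none) ^ 2))
    (hpos : ∀ X, K * posForm A X ≤ -ip B X X - (μ ^ 2 + ξ ^ 2 / 16) * X (some none) ^ 2
      - c * (posForm A X - 2 * X (some none) ^ 2)) (hKf : 78 * C ^ 6 * fol T ξ μ z ≤ K) :
    LevelSetPseudoconvexAt G (fol T ξ μ) z := by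
  have hC := s.ρ_sq_le hP.one_le hP.ρ_pos
  obtain ⟨j, hj0, hj1, hj⟩ := hP.exists_dual hC
  have hf := s.f_pos
  refine ⟨?_, fun X hX0 hX hd => ?_⟩
  · rw [gradSq_fol hT hξ hμ hP hGz hj hC hj0 hz]
    exact lt_of_lt_of_le (by positivity) (hP.sqF_bounds s hj1).2
  · rw [ip_hess_fol hT hξ hμ hP hGz hD hj hC hz]
    rw [sum_mul_pd_fol hT hξ hμ hP.ρ_pos hz] at hd
    rw [hGz] at hX
    exact hP.hessF_neg_of_null s hj0 hj1 hj hns hpos hKf hX0 hd hX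

theorem defContraction_ge {C : ℝ} {G : Coord d → Matrix (SIdx d) (SIdx d) ℝ}
    {A B R P : Matrix (SIdx d) (SIdx d) ℝ} {dA dP : SIdx d → Matrix (SIdx d) (SIdx d) ℝ}
    {u : Coord d → ℝ}
    (hT : 0 < T) (hξ : 0 ≤ ξ) (hμ : IsMu T ξ μ) (hz : tim z ∈ Ioo 0 (Real.pi * T))
    (hP : PointData C (rho z) A B R P dA dP) (hGz : G z = (rho z ^ 2)⁻¹ • A + P)
    (hD : ∀ Z X Y, tri (pdMat G z) Z X Y = triG (rho z) A dA dP Z X Y)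
    (s : ScalarData C (fol T ξ μ z) (rho z) (eta T ξ μ (tim z)) (eta' T ξ μ (tim z))
      (eta'' T ξ μ (tim z)) ξ (μ ^ 2 + ξ ^ 2 / 16) (u z) (wfun T ξ μ u z))
    (hns : ∀ X, |tri dA eT X X| ≤ ξ * (posForm A X - X (some none) ^ 2))
    (hpos : ∀ X, K * posForm A X ≤ -ip B X X - (μ ^ 2 + ξ ^ 2 / 16) * X (some none) ^ 2
      - u z * (posForm A X - 2 * X (some none) ^ 2)) (hK : K ≤ C)
    (hKf : 78 * C ^ 6 * fol T ξ μ z ≤ K) {E : Fin d → SIdx d → ℝ} (hE : IsHorizontalFrame G z E)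
    (θ : SIdx d → ℝ) :
    (K * fol T ξ μ z ^ ((d : ℤ) + 1 - 2) * rho z ^ 2
          + -(105 * C ^ 8) * (fol T ξ μ z ^ d * rho z ^ 2)) *
        (|pair θ (vecV G T ξ μ E z)| ^ 2 + ∑ X, |pair θ (E X)| ^ 2)
      - ((((d : ℝ) + 1) - 1) * fol T ξ μ z ^ ((d : ℤ) + 1 - 2)
          + (78 + 2 * |(d : ℝ) - 2|) * C ^ 4 * fol T ξ μ z ^ (d + 1)) *
        |pair θ (vecN G T ξ μ z)| ^ 2
      ≤ defContraction G T ξ μ u z θ := by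
  have hC := s.ρ_sq_le hP.one_le hP.ρ_pos
  obtain ⟨j, hj0, hj1, hj⟩ := hP.exists_dual hC
  have hf := s.f_pos
  have hGs : ∀ α β, G z α β = G z β α := fun α β => by rw [hGz]; exact hP.metric_symm α β
  have hE' := hE.2
  rw [hGz] at hE'
  have hS : 0 < sqF (fol T ξ μ z) (eta' T ξ μ (tim z)) j :=
    lt_of_lt_of_le (by positivity) (hP.sqF_bounds s hj1).2
  have hW : vecW T ξ μ z = levelT (fol T ξ μ z) (eta' T ξ μ (tim z)) := by
    rw [vecW, deriv_eta hT hξ hμ]; rfl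
  have hVt : vecVtilde G T ξ μ E z = levelV (G z) (fol T ξ μ z) (eta' T ξ μ (tim z)) E := by
    rw [vecVtilde, hW]; rfl
  have hv := (hP.levelV_bounds s hE.1 hE').1
  rw [← hGz] at hv
  have key := hP.contraction_le s hj0 hj1 hj hns hpos hK hKf ((d : ℝ) - 2)
    (fun X Y => ip_hess_fol hT hξ hμ hP hGz hD hj hC hz X Y) hE.1 hE' rfl θ
    (N := vecN G T ξ μ z) (V := vecV G T ξ μ E z) (Z := (G z)⁻¹.mulVec θ)
    (by rw [vecN, gradSq_fol hT hξ hμ hP hGz hj hC hj0 hz, abs_of_pos hS,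
      grad_fol hT hξ hμ hP hGz hj hC hz])
    (by rw [vecV, hVt, abs_of_neg hv, hGz]) (by rw [hGz])
  rw [← hGz] at key
  rw [defContraction_eq_ip hGs, ip_defTensor hT hξ hμ hP.ρ_pos hz]
  set f := fol T ξ μ z
  -- All powers of `f` in the claim are this weight, positive even for a negative exponent, times
  -- the powers in the pointwise estimate.
  have hF : 0 < f ^ ((d : ℤ) + 1 - 3) := zpow_pos hf _
  have e1 : f ^ ((d : ℤ) + 1 - 2) = f ^ ((d : ℤ) + 1 - 3) * f := by
    rw [← zpow_add_one₀ hf.ne']; congr 1; ring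
  have e2 : f ^ d = f ^ ((d : ℤ) + 1 - 3) * f ^ 2 := by
    rw [← zpow_natCast, ← zpow_natCast, ← zpow_add₀ hf.ne']; congr 1; push_cast; ring
  have e3 : f ^ (d + 1) = f ^ ((d : ℤ) + 1 - 3) * f ^ 3 := by rw [pow_succ, e2]; ring
  simp only [sq_abs]
  rw [e1, e2, e3]
  refine le_trans (le_of_eq ?_) (neg_le_neg (mul_le_mul_of_nonneg_left key hF.le))
  ring

end Assembly

end AADS
end

open AADS

theorem theorem3p2 {d : ℕ} {S : Type*} [TopologicalSpace S] [ChartedSpace (Model d) S]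
    [IsManifold (𝓡 d) ∞ S] (ρs T : ℝ) (hρs : 0 < ρs) (hT : 0 < T)
    (g gm gs gr : Tensor2 d S) (Ξ : Set (OpenPartialHomeomorph S (Model d)))
    (hg : IsAdmissibleFG ρs T g gm gs gr Ξ)
    (K ξ μ : ℝ) (ζ : ℝ → ℝ → S → ℝ) (hμ : IsMu T ξ μ)
    (hpc : PseudoconvexityProperty ρs T gm gs Ξ K ξ μ ζ) :
    ∃ f₀ : ℝ, 0 < f₀ ∧
      -- the frames exist, and the level sets of `f` are pseudoconvex, wherever `f < f₀`
      (∀ φ ∈ Ξ, ∀ z ∈ chartDom φ ρs T, fol T ξ μ z < f₀ →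
        HorizontalSpacelikeAt (comps g φ) z ∧
        LevelSetPseudoconvexAt (comps g φ) (fol T ξ μ) z) ∧
      -- the lower bound, with error terms `u = 𝒪₀(f^{n-1} ρ²)` and `v = 𝒪₀(f^n)`, `n = d + 1`
      ∃ u v : ℝ → ℝ → S → ℝ,
        (∀ φ ∈ Ξ, IsO₀ (smoothRegion φ ρs T ξ μ f₀)
          (fun z => fol T ξ μ z ^ ((d : ℤ) + 1 - 1) * rho z ^ 2) (inChart u φ)) ∧
        (∀ φ ∈ Ξ, IsO₀ (smoothRegion φ ρs T ξ μ f₀)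
          (fun z => fol T ξ μ z ^ ((d : ℤ) + 1)) (inChart v φ)) ∧
        ∀ φ ∈ Ξ, ∀ z ∈ smoothRegion φ ρs T ξ μ f₀,
          ∀ E : Fin d → SIdx d → ℝ, IsHorizontalFrame (comps g φ) z E →
          ∀ θ : SIdx d → ℝ,
            (K * fol T ξ μ z ^ ((d : ℤ) + 1 - 2) * rho z ^ 2 + inChart u φ z) *
                (|pair θ (vecV (comps g φ) T ξ μ E z)| ^ 2 + ∑ X, |pair θ (E X)| ^ 2)
              - ((((d : ℝ) + 1) - 1) * fol T ξ μ z ^ ((d : ℤ) + 1 - 2) + inChart v φ z) *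
                |pair θ (vecN (comps g φ) T ξ μ z)| ^ 2
            ≤ defContraction (comps g φ) T ξ μ (inChart ζ φ) z θ := by
  have hξ := hpc.ξ_nonneg
  have hK := hpc.K_pos
  obtain ⟨C, hC1, hξC, hKC, hM, hP⟩ := exists_uniform_bound hg hpc
  have hC0 : 0 < C := lt_of_lt_of_le one_pos hC1
  -- The first bound makes every perturbative error absorbable. The second keeps `K - 78 C⁶ f`
  -- nonnegative, so that the tangential estimate retains its sign.
  set f₀ := min (1 / (1000 * C ^ 10)) (K / (78 * C ^ 6))
  have hf1 : 1000 * C ^ 10 * f₀ ≤ 1 := by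
    rw [mul_comm, ← le_div_iff₀ (by positivity)]; exact min_le_left _ _
  have hf2 : 78 * C ^ 6 * f₀ ≤ K := by
    rw [mul_comm, ← le_div_iff₀ (by positivity)]; exact min_le_right _ _
  have hs : ∀ φ ∈ Ξ, ∀ z ∈ chartDom φ ρs T, fol T ξ μ z < f₀ →
      ScalarData C (fol T ξ μ z) (rho z) (eta T ξ μ (tim z)) (eta' T ξ μ (tim z))
        (eta'' T ξ μ (tim z)) ξ (μ ^ 2 + ξ ^ 2 / 16) (inChart ζ φ z)
        (wfun T ξ μ (inChart ζ φ) z) ∧ 78 * C ^ 6 * fol T ξ μ z ≤ K := fun φ hφ z hz hzf =>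
    ⟨scalarData_fol hT hξ hμ hz.1.1 hz.2.1 (hM _ hz.2.1) hξC (hP φ hφ z hz).1 hf1 hC0.le hzf.le,
      (mul_le_mul_of_nonneg_left hzf.le (by positivity)).trans hf2⟩
  have hO : ∀ (φ : OpenPartialHomeomorph S (Model d)) (k p : ℕ) (c : ℝ),
      IsO₀ (smoothRegion φ ρs T ξ μ f₀) (fun z => fol T ξ μ z ^ k * rho z ^ p)
        (fun z => c * (fol T ξ μ z ^ k * rho z ^ p)) := fun φ k p c =>
    isO₀_fol_mul_rho (ρs := ρs) (f₀ := f₀) hT hξ hμ (isOpen_smoothRegion hT hξ hμ φ ρs f₀)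
      (fun z hz => ⟨hz.1.1, hz.1.2.1, hz.2.1, hz.2.2⟩) k p c
  -- The error functions depend on `ρ` and `t` only, so the same pair serves in every chart.
  refine ⟨f₀, lt_min (by positivity) (by positivity), fun φ hφ z hz hzf => ⟨?_, ?_⟩,
    fun ρ t _ => -(105 * C ^ 8) * ((ρ / eta T ξ μ t) ^ d * ρ ^ 2),
    fun ρ t _ => (78 + 2 * |(d : ℝ) - 2|) * C ^ 4 * (ρ / eta T ξ μ t) ^ (d + 1),
    fun φ hφ => ?_, fun φ hφ => ?_, fun φ hφ z hz E hE θ => ?_⟩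
  · intro Y _ hY1 hY
    rw [hg.comps_metric hz]
    exact (hP φ hφ z hz).2.ip_pos_of_horizontal (hs φ hφ z hz hzf).1 hY1 hY
  · exact levelSetPseudoconvexAt_fol hT hξ hμ hz.2.1 (hP φ hφ z hz).2 (hg.comps_metric hz)
      (hg.tri_metric hφ hz) (hs φ hφ z hz hzf).1 (hg.abs_tri_tim_le hpc hφ hz)
      (hg.mul_posForm_le hpc hz) (hs φ hφ z hz hzf).2
  · have h := hO φ d 2 (-(105 * C ^ 8))
    simp only [← zpow_natCast (fol T ξ μ _) d] at h
    simp only [add_sub_cancel_right]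
    exact h
  · have h := hO φ (d + 1) 0 ((78 + 2 * |(d : ℝ) - 2|) * C ^ 4)
    simp only [pow_zero, mul_one] at h
    have e : ∀ x : ℝ, x ^ ((d : ℤ) + 1) = x ^ (d + 1) := fun x => by
      exact_mod_cast zpow_natCast x (d + 1)
    simp only [e]
    exact h
  · exact defContraction_ge hT hξ hμ hz.1.2.1 (hP φ hφ z hz.1).2 (hg.comps_metric hz.1)
      (hg.tri_metric hφ hz.1) (hs φ hφ z hz.1 hz.2.2).1 (hg.abs_tri_tim_le hpc hφ hz.1)
      (hg.mul_posForm_le hpc hz.1) hKC (hs φ hφ z hz.1 hz.2.2).2 hE θ
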